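/- **Setup.** All vector spaces are over $\mathbb R$. For $N\ge 1$ let $C^\bullet(S^1)$ be the complex of cellular cochains for the subdivision of $S^1$ with vertex set $\mathbb Z/N\mathbb Z$ and one edge from $x$ to $x+1$ for each $x$. It has the basis $f_x$ (degree $0$) and $g_{x+\frac12}$ (degree $1$), $x\in\mathbb Z/N\mathbb Z$, with $\mathrm d f_x=g_{x-\frac12}-g_{x+\frac12}$. Its endomorphism dg properad $\mathrm{End}(C^\bullet(S^1))$ consists of the complexes $\hom(C^\bullet(S^1)^{\otimes m},C^\bullet(S^1)^{\otimes n})$, whose elements are described by matrices in the tensor bases. The distance from a basic cochain $a$ to a basic cochain $b$ is $\max_{x\in a}\min_{y\in b}|y-x|$, where $x$, $y$ run over the vertices in the closures of the cells and $|y-x|$ is the distance on the cycle $\mathbb Z/N\mathbb Z$. An $m$-to-$n$ operation is *$\ell$-quasilocal* if, whenever its matrix entry from $a_1\otimes\dots\otimes a_m$ to $b_1\otimes\dots\otimes b_n$ is nonzero, the distance from $a_i$ to $b_j$ is at most $\ell$ for all $i,j$. Let $\mathrm{Frob}_1$ be the quadratic properad generated by a commutative multiplication of degree $0$ and arity $(2,1)$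 and an anticommutative comultiplication $\Delta$ of degree $1$ and arity $(1,2)$, modulo associativity, coassociativity and the Frobenius relations. Its quadratic dual $\mathrm{Frob}_1^{¡}$ is the largest sub-coproperad of the cofree conilpotent coproperad on the generators shifted by $[1]$ whose weight-two part is contained in the shifted relations. It is graded by genus $\beta$ and arity $(m,n)$. Let $\mathrm{sh}^{\mathrm{pr}}\mathrm{Frob}_1$ be the cobar construction of $\mathrm{Frob}_1^{¡}$, a quasifree dg properad whose generators of genus $\beta$ and arity $(m,n)$ have degree $2-(\beta+m)$. Its *first few* generators are those with $\beta+m+n\le 4$: the multiplication, the comultiplication, the homotopies for associativity, coassociativity and the Frobenius relation, the genus-one generators of arities $(2,1)$ and $(1,2)$, and the genus-two generator $b$ of arity $(1,1)$. They are closed under taking derivatives. Here $b$ is normalised so that its coefficient on the composite "$(\Delta\otimes\mathrm{id})\circ\Delta$ followed by $x\otimes y\otimes z\mapsto x\cdot(y\cdot z)$" is $1$. The standard $1$-shifted Frobenius structure on $H^\bullet(S^1)=\langle 1,\omega\rangle$, $\int_{S^1}\omega=1$, is the cup product together with $\Delta(1)=\omega\otimes1-1\otimes\omega$ and $\Delta(\omega)=\omega\otimes\omega$.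 **Theorem.** The normalised generator $b$ exists, and there is a constant $C$ such that the following holds for all natural numbers $N\ge1$ and $\ell\ge 0$ with $C(\ell+1)\le N$. 1. There is no action of $\mathrm{sh}^{\mathrm{pr}}\mathrm{Frob}_1$ on $C^\bullet(S^1)$ (that is, no homomorphism of dg properads $\mathrm{sh}^{\mathrm{pr}}\mathrm{Frob}_1\to\mathrm{End}(C^\bullet(S^1))$) that induces the standard Frobenius structure on $H^\bullet(S^1)$ and in which all of the first few generators act $\ell$-quasilocally. 2. Let $\eta$ be any action on $C^\bullet(S^1)$ of the sub-dg-properad of $\mathrm{sh}^{\mathrm{pr}}\mathrm{Frob}_1$ generated by the first few generators other than $b$, such that $\eta$ induces the standard Frobenius structure on $H^\bullet(S^1)$ and these generators act $\ell$-quasilocally. Then the obstruction to extending $\eta$ to $b$, the operation $\eta(\partial b)$, is closed and acts on $H^\bullet(S^1)$ as $-\frac1{12}\,\mathrm{id}$. -/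

import Mathlib

open scoped TensorProduct Nat

noncomputable section

namespace ShFrob

/-! ### Formal properadic composites of a multiplication and a comultiplication

`Composite A B` is the type of formal properadic composites, with inputs labelled by `A` and
outputs labelled by `B`, of the two generators of `Frob₁`, shifted by `[1]`: the commutative
multiplication (degree `-1` after the shift) and the anticommutative comultiplication
(degree `0` after the shift). -/

/-- Formal composites. In `comp s t` the nonempty set `K` of outputs of the upper composite `t` is
plugged into the inputs `K` of the lower composite `s` (`s` is applied after `t`). -/
inductive Composite : Type → Type → Type 1
  | mult : Composite (Fin 2) (Fin 1)
  | comult : Composite (Fin 1) (Fin 2)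
  | relabel {A A' B B' : Type} (e : A ≃ A') (e' : B ≃ B') (t : Composite A B) : Composite A' B'
  | comp {M₁ M₂ N₁ N₂ K : Type} [Nonempty K]
      (s : Composite (M₁ ⊕ K) N₁) (t : Composite M₂ (K ⊕ N₂)) : Composite (M₁ ⊕ M₂) (N₁ ⊕ N₂)

namespace Composite

/-- The number of multiplications; the degree of `t` (after the shift) is `-numMult t`. -/
def numMult : {A B : Type} → Composite A B → ℕ
  | _, _, mult => 1
  | _, _, comult => 0
  | _, _, relabel _ _ t => t.numMult
  | _, _, comp s t => s.numMult + t.numMult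

/-- The genus (first Betti number) of the underlying connected graph. -/
def genus : {A B : Type} → Composite A B → ℕ
  | _, _, mult => 0
  | _, _, comult => 0
  | _, _, relabel _ _ t => t.genus
  | _, _, comp (K := K) s t => s.genus + t.genus + (Nat.card K - 1)

/-- Composition with numbered inputs and outputs: the first `k + 1` outputs of `t` are plugged into
the last `k + 1` inputs of `s`. -/
def compFin (k : ℕ) {m₁ m₂ n₁ n₂ : ℕ} (s : Composite (Fin (m₁ + (k + 1))) (Fin n₁))
    (t : Composite (Fin m₂) (Fin ((k + 1) + n₂))) :
    Composite (Fin (m₁ + m₂)) (Fin (n₁ + n₂)) :=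
  relabel finSumFinEquiv finSumFinEquiv
    (comp (K := Fin (k + 1))
      (relabel finSumFinEquiv.symm (Equiv.refl _) s)
      (relabel (Equiv.refl _) finSumFinEquiv.symm t))

end Composite

open Composite

/-- Moves a middle summand to the end. -/
def swapRight (X Y Z : Type) : (X ⊕ Y) ⊕ Z ≃ (X ⊕ Z) ⊕ Y :=
  (Equiv.sumAssoc X Y Z).trans
    (((Equiv.refl X).sumCongr (Equiv.sumComm Y Z)).trans (Equiv.sumAssoc X Z Y).symm)

/-- Exchanges the first two summands. -/
def swapLeft (X Y Z : Type) : X ⊕ (Y ⊕ Z) ≃ Y ⊕ (X ⊕ Z) :=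
  (Equiv.sumAssoc X Y Z).symm.trans
    (((Equiv.sumComm X Y).sumCongr (Equiv.refl Z)).trans (Equiv.sumAssoc Y X Z))

/-- `Cong ε s t` says that `s = ε t` in the free nonunital graded properad on the two generators:
it is generated by the axioms of a properad (functoriality and equivariance of relabelling and the
associativity laws for connected graphs with three vertices, with Koszul signs) and by the
symmetries of the generators. -/
inductive Cong : {A B : Type} → ℤˣ → Composite A B → Composite A B → Prop
  | refl {A B : Type} (t : Composite A B) : Cong 1 t t
  | symm {A B : Type} {ε : ℤˣ} {s t : Composite A B} : Cong ε s t → Cong ε t s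
  | trans {A B : Type} {ε ε' : ℤˣ} {s t u : Composite A B} :
      Cong ε s t → Cong ε' t u → Cong (ε * ε') s u
  | relabel {A A' B B' : Type} (e : A ≃ A') (e' : B ≃ B') {ε : ℤˣ} {s t : Composite A B} :
      Cong ε s t → Cong ε (relabel e e' s) (relabel e e' t)
  | comp {M₁ M₂ N₁ N₂ K : Type} [Nonempty K] {ε ε' : ℤˣ} {s s' : Composite (M₁ ⊕ K) N₁}
      {t t' : Composite M₂ (K ⊕ N₂)} :
      Cong ε s s' → Cong ε' t t' → Cong (ε * ε') (comp s t) (comp s' t')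
  | relabel_refl {A B : Type} (t : Composite A B) :
      Cong 1 (Composite.relabel (Equiv.refl A) (Equiv.refl B) t) t
  | relabel_trans {A A' A'' B B' B'' : Type} (e₁ : A ≃ A') (e₂ : A' ≃ A'') (e₁' : B ≃ B')
      (e₂' : B' ≃ B'') (t : Composite A B) :
      Cong 1 (Composite.relabel e₂ e₂' (Composite.relabel e₁ e₁' t))
        (Composite.relabel (e₁.trans e₂) (e₁'.trans e₂') t)
  | comp_relabel {M₁ M₂ N₁ N₂ K M₁' M₂' N₁' N₂' K' : Type} [Nonempty K] [Nonempty K']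
      (e₁ : M₁ ≃ M₁') (e₂ : M₂ ≃ M₂') (e₁' : N₁ ≃ N₁') (e₂' : N₂ ≃ N₂') (κ : K ≃ K')
      (s : Composite (M₁ ⊕ K) N₁) (t : Composite M₂ (K ⊕ N₂)) :
      Cong 1
        (Composite.comp (Composite.relabel (e₁.sumCongr κ) e₁' s)
          (Composite.relabel e₂ (κ.sumCongr e₂') t))
        (Composite.relabel (e₁.sumCongr e₂) (e₁'.sumCongr e₂') (Composite.comp s t))
  /-- Associativity for a chain or triangle: `t` sits above `s`, and `u` above `t`; there are edges
  `a` from `t` to `s`, possibly edges `b` from `u` to `s`, and edges `c` from `u` to `t`. -/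
  | assoc {M₁ M₂ M₃ N₁ N₂ N₃ a b c : Type} [Nonempty a] [Nonempty c]
      (s : Composite (M₁ ⊕ (a ⊕ b)) N₁) (t : Composite (M₂ ⊕ c) (a ⊕ N₂))
      (u : Composite M₃ ((b ⊕ c) ⊕ N₃)) :
      Cong 1
        (Composite.relabel (Equiv.sumAssoc M₁ M₂ M₃) (Equiv.sumAssoc N₁ N₂ N₃)
          (Composite.comp
            (Composite.relabel (Equiv.sumSumSumComm M₁ b M₂ c) (Equiv.refl _)
              (Composite.comp
                (Composite.relabel
                  ((Equiv.sumAssoc M₁ a b).symm.trans (swapRight M₁ a b)) (Equiv.refl _) s)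
                t))
            u))
        (Composite.comp s
          (Composite.relabel (Equiv.refl _) (Equiv.sumSumSumComm a N₂ b N₃)
            (Composite.comp t
              (Composite.relabel (Equiv.refl _)
                ((Equiv.sumAssoc b c N₃).trans (swapLeft b c N₃)) u))))
  /-- Associativity for two upper vertices `t`, `u` over one lower vertex `s`. -/
  | assoc_upper {M₁ M₂ M₃ N₁ N₂ N₃ a b : Type} [Nonempty a] [Nonempty b]
      (s : Composite (M₁ ⊕ (a ⊕ b)) N₁) (t : Composite M₂ (a ⊕ N₂)) (u : Composite M₃ (b ⊕ N₃)) :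
      Cong ((-1) ^ (t.numMult * u.numMult))
        (Composite.relabel (swapRight M₁ M₂ M₃) (swapRight N₁ N₂ N₃)
          (Composite.comp
            (Composite.relabel (swapRight M₁ b M₂) (Equiv.refl _)
              (Composite.comp
                (Composite.relabel
                  ((Equiv.sumAssoc M₁ a b).symm.trans (swapRight M₁ a b)) (Equiv.refl _) s)
                t))
            u))
        (Composite.comp
          (Composite.relabel (swapRight M₁ a M₃) (Equiv.refl _)
            (Composite.comp
              (Composite.relabel (Equiv.sumAssoc M₁ a b).symm (Equiv.refl _) s) u))
          t)
  /-- Associativity for two lower vertices `s`, `t` under one upper vertex `u`. -/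
  | assoc_lower {M₁ M₂ M₃ N₁ N₂ N₃ a b : Type} [Nonempty a] [Nonempty b]
      (s : Composite (M₁ ⊕ a) N₁) (t : Composite (M₂ ⊕ b) N₂) (u : Composite M₃ ((a ⊕ b) ⊕ N₃)) :
      Cong ((-1) ^ (s.numMult * t.numMult))
        (Composite.relabel (swapLeft M₁ M₂ M₃) (swapLeft N₁ N₂ N₃)
          (Composite.comp s
            (Composite.relabel (Equiv.refl _) (swapLeft N₂ a N₃)
              (Composite.comp t
                (Composite.relabel (Equiv.refl _)
                  ((Equiv.sumAssoc a b N₃).trans (swapLeft a b N₃)) u)))))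
        (Composite.comp t
          (Composite.relabel (Equiv.refl _) (swapLeft N₁ b N₃)
            (Composite.comp s
              (Composite.relabel (Equiv.refl _) (Equiv.sumAssoc a b N₃) u))))
  | mult_comm :
      Cong 1 (Composite.relabel (Equiv.swap 0 1) (Equiv.refl _) Composite.mult) Composite.mult
  | comult_anticomm :
      Cong (-1) (Composite.relabel (Equiv.refl _) (Equiv.swap 0 1) Composite.comult)
        Composite.comult

/-! ### The quadratic dual coproperad of `Frob₁` -/

/-- The genus-`β` part of the free (co)properad on the generators of `Frob₁` shifted by `[1]`, with
inputs `A` and outputs `B`. An element is recorded by its coefficients on all formal composites;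
for given `β`, `A`, `B` there are only finitely many of these up to `Cong`. The decomposition maps
are read off as follows: the coefficient of `s ⊗ t` in the decomposition of `x` is the coefficient
of `comp s t` in `x`. -/
def cofree (β : ℕ) (A B : Type) : Submodule ℝ (Composite A B → ℝ) where
  carrier := {x | (∀ (ε : ℤˣ) (s t : Composite A B), Cong ε s t → x s = ((ε : ℤ) : ℝ) * x t) ∧
    ∀ t, x t ≠ 0 → t.genus = β}
  add_mem' := by
    rintro x y ⟨hx, hx'⟩ ⟨hy, hy'⟩
    refine ⟨fun ε s t h => ?_, fun t h => ?_⟩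
    · simp only [Pi.add_apply, hx ε s t h, hy ε s t h, mul_add]
    · by_contra hne
      have h1 : x t = 0 := by
        by_contra h0
        exact hne (hx' t h0)
      have h2 : y t = 0 := by
        by_contra h0
        exact hne (hy' t h0)
      exact h (by simp only [Pi.add_apply, h1, h2, add_zero])
  zero_mem' := ⟨fun ε s t _ => by simp, fun t h => absurd rfl h⟩
  smul_mem' := by
    rintro c x ⟨hx, hx'⟩
    refine ⟨fun ε s t h => ?_, fun t h => hx' t ?_⟩
    · simp only [Pi.smul_apply, smul_eq_mul, hx ε s t h]
      ring
    · intro h0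
      exact h (by simp [h0])

/-- A graded sub-coproperad of `cofree`: a family of subspaces stable under relabelling and
under both kinds of slices of all decompositions (equivalently, the decompositions of its members
lie in its tensor square). -/
structure IsSubcoproperad
    (S : ∀ (_ : ℕ) (A B : Type), Submodule ℝ (Composite A B → ℝ)) : Prop where
  le_cofree : ∀ (β : ℕ) (A B : Type), S β A B ≤ cofree β A B
  relabel_mem : ∀ {β : ℕ} {A A' B B' : Type} (e : A' ≃ A) (e' : B' ≃ B)
    {x : Composite A B → ℝ}, x ∈ S β A B → (fun t : Composite A' B' => x (relabel e e' t)) ∈ S β A' B'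
  lower_slice_mem : ∀ {β β₂ : ℕ} {M₁ M₂ N₁ N₂ K : Type} [Nonempty K]
    {x : Composite (M₁ ⊕ M₂) (N₁ ⊕ N₂) → ℝ} (s : Composite (M₁ ⊕ K) N₁),
    x ∈ S β (M₁ ⊕ M₂) (N₁ ⊕ N₂) → s.genus + β₂ + (Nat.card K - 1) = β →
    (fun t : Composite M₂ (K ⊕ N₂) => x (comp s t)) ∈ S β₂ M₂ (K ⊕ N₂)
  upper_slice_mem : ∀ {β β₁ : ℕ} {M₁ M₂ N₁ N₂ K : Type} [Nonempty K]
    {x : Composite (M₁ ⊕ M₂) (N₁ ⊕ N₂) → ℝ} (t : Composite M₂ (K ⊕ N₂)),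
    x ∈ S β (M₁ ⊕ M₂) (N₁ ⊕ N₂) → β₁ + t.genus + (Nat.card K - 1) = β →
    (fun s : Composite (M₁ ⊕ K) N₁ => x (comp s t)) ∈ S β₁ (M₁ ⊕ K) N₁

/-- `(x, y, z) ↦ x · (y · z)`. -/
def multMult : Composite (Fin 3) (Fin 1) :=
  compFin 0 (m₁ := 1) (m₂ := 2) (n₁ := 1) (n₂ := 0) mult mult

/-- `(Δ ⊗ id) ∘ Δ`. -/
def comultComult : Composite (Fin 1) (Fin 3) :=
  compFin 0 (m₁ := 0) (m₂ := 1) (n₁ := 2) (n₂ := 1) comult comult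

/-- Multiply, then comultiply. -/
def comultMult : Composite (Fin 2) (Fin 2) :=
  compFin 0 (m₁ := 0) (m₂ := 2) (n₁ := 2) (n₂ := 0) comult mult

/-- Comultiply the second input, multiply the first input by the left output of this; the product
is the first output. -/
def zigzag : Composite (Fin 2) (Fin 2) :=
  compFin 0 (m₁ := 1) (m₂ := 1) (n₁ := 1) (n₂ := 1) mult comult

/-- Membership in the shifted relations `R[2]` of `Frob₁` with three inputs and one output.
`R` is spanned by the differences of the three ways to multiply three inputs. -/
def IsAssocRelation (x : Composite (Fin 3) (Fin 1) → ℝ) : Prop :=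
  x multMult + x (relabel (finRotate 3) (Equiv.refl _) multMult) +
    x (relabel ((finRotate 3).trans (finRotate 3)) (Equiv.refl _) multMult) = 0

/-- Membership in `R[2]` with one input and three outputs. `R` is spanned by the
differences of the three cyclic rotations of `(Δ ⊗ id) ∘ Δ`. -/
def IsCoassocRelation (x : Composite (Fin 1) (Fin 3) → ℝ) : Prop :=
  x comultComult + x (relabel (Equiv.refl _) (finRotate 3) comultComult) +
    x (relabel (Equiv.refl _) ((finRotate 3).trans (finRotate 3)) comultComult) = 0

/-- Membership in `R[2]` with two inputs and two outputs. `R` is spanned by `comultMult - zigzag`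
and its images under permutations of the inputs and of the outputs; in passing to `R[2]`
the sign of `zigzag`, whose upper vertex has odd unshifted degree, changes. So `R[2]` is spanned by
`comultMult + zigzag` and its images, where a transposition of the outputs negates `comultMult`. -/
def IsFrobRelation (x : Composite (Fin 2) (Fin 2) → ℝ) : Prop :=
  x comultMult = x zigzag + x (relabel (Equiv.swap 0 1) (Equiv.refl _) zigzag)
    - x (relabel (Equiv.refl _) (Equiv.swap 0 1) zigzag)
    - x (relabel (Equiv.swap 0 1) (Equiv.swap 0 1) zigzag)

/-- All members of `S` of weight two (two generators) lie in `R[2]`. (There is no nonzero element of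
weight two in arity `(1, 1)`.) -/
structure WeightTwoInRelations
    (S : ∀ (_ : ℕ) (A B : Type), Submodule ℝ (Composite A B → ℝ)) : Prop where
  assoc : ∀ x ∈ S 0 (Fin 3) (Fin 1), IsAssocRelation x
  coassoc : ∀ x ∈ S 0 (Fin 1) (Fin 3), IsCoassocRelation x
  frob : ∀ x ∈ S 0 (Fin 2) (Fin 2), IsFrobRelation x

/-- The quadratic dual coproperad of `Frob₁`: the largest graded sub-coproperad of the
cofree coproperad whose weight-two part consists of the shifted relations. -/
def quadraticDual (β : ℕ) (A B : Type) : Submodule ℝ (Composite A B → ℝ) :=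
  ⨆ (S : ∀ (_ : ℕ) (A B : Type), Submodule ℝ (Composite A B → ℝ))
    (_ : IsSubcoproperad S ∧ WeightTwoInRelations S), S β A B

/-- The generators of genus `β`, with `m` inputs and `n` outputs, of `sh Frob₁`, the cobar
construction of the quadratic dual of `Frob₁` (without the final shift by `[-1]`: as a
generator of `sh Frob₁` an element has degree `2 - (β + m)`, its number of multiplications being
`β + m - 1`). -/
abbrev Gen (β m n : ℕ) : Type 1 := quadraticDual β (Fin m) (Fin n)

/-- The coefficient of a generator on a formal composite. -/
def coeff {β m n : ℕ} (t : Composite (Fin m) (Fin n)) : Gen β m n →ₗ[ℝ] ℝ :=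
  LinearMap.proj t ∘ₗ Submodule.subtype _

/-- The coefficient on `s ⊗ t` of an element of a tensor product of spaces of generators. -/
def coeffPair {β₁ m₁ n₁ β₂ m₂ n₂ : ℕ} (s : Composite (Fin m₁) (Fin n₁))
    (t : Composite (Fin m₂) (Fin n₂)) : Gen β₁ m₁ n₁ ⊗[ℝ] Gen β₂ m₂ n₂ →ₗ[ℝ] ℝ :=
  LinearMap.mul' ℝ ℝ ∘ₗ TensorProduct.map (coeff s) (coeff t)

/-- The type of families of binary decompositions, one for every way of distributing `m` inputs and
`n` outputs over a lower and an upper vertex joined by `k + 1` edges. -/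
abbrev Decomposition (m n : ℕ) : Type 1 :=
  ∀ (k β₁ β₂ m₁ m₂ n₁ n₂ : ℕ) (_ : Fin (m₁ + m₂) ≃ Fin m) (_ : Fin (n₁ + n₂) ≃ Fin n),
    Gen β₁ (m₁ + (k + 1)) n₁ ⊗[ℝ] Gen β₂ m₂ ((k + 1) + n₂)

/-- `u` is the family of all binary decompositions of `q`. -/
def IsDecomposition {β m n : ℕ} (q : Gen β m n) (u : Decomposition m n) : Prop :=
  ∀ (k β₁ β₂ m₁ m₂ n₁ n₂ : ℕ) (σ : Fin (m₁ + m₂) ≃ Fin m) (τ : Fin (n₁ + n₂) ≃ Fin n),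
    k + (β₁ + β₂) = β →
    ∀ (s : Composite (Fin (m₁ + (k + 1))) (Fin n₁)) (t : Composite (Fin m₂) (Fin ((k + 1) + n₂))),
      s.genus = β₁ → t.genus = β₂ →
      coeffPair s t (u k β₁ β₂ m₁ m₂ n₁ n₂ σ τ) = coeff (relabel σ τ (compFin k s t)) q

/-! ### Cellular cochains on the circle and their endomorphism properad -/

/-- The basis of cellular cochains of the subdivision of the circle into `N` intervals: `inl x` is
the vertex cochain `f_x`, and `inr x` is the edge cochain `g_{x + 1/2}`. -/
abbrev Cell (N : ℕ) : Type := ZMod N ⊕ ZMod N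

/-- The cohomological degree of a basic cochain. -/
def cellDeg {N : ℕ} : Cell N → ℕ
  | Sum.inl _ => 0
  | Sum.inr _ => 1

/-- The matrix of the differential: `d f_x = g_{x - 1/2} - g_{x + 1/2}`. -/
def cellD {N : ℕ} : Cell N → Cell N → ℝ
  | Sum.inl x, Sum.inr y => (if y = x - 1 then 1 else 0) - (if y = x then 1 else 0)
  | _, _ => 0

/-- The vertices in the closure of a cell. -/
def cellVerts {N : ℕ} : Cell N → Finset (ZMod N)
  | Sum.inl x => {x}
  | Sum.inr x => {x, x + 1}

theorem cellVerts_nonempty {N : ℕ} (a : Cell N) : (cellVerts a).Nonempty := by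
  cases a <;> simp [cellVerts]

/-- The distance of vertices on the circle, adjacent vertices being at distance one. -/
def vertexDist {N : ℕ} (x y : ZMod N) : ℕ := (y - x).valMinAbs.natAbs

/-- The nonsymmetric distance `max_{x ∈ a} min_{y ∈ b} |y - x|`. -/
def cellDist {N : ℕ} (a b : Cell N) : ℕ :=
  (cellVerts a).sup' (cellVerts_nonempty a) fun x =>
    (cellVerts b).inf' (cellVerts_nonempty b) fun y => vertexDist x y

/-- Linear maps from the `m`-th to the `n`-th tensor power of the cochains, as matrices: `f x y` is
the coefficient of `⊗ y_j` in the image of `⊗ x_i`. -/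
abbrev Op (N m n : ℕ) : Type := (Fin m → Cell N) → (Fin n → Cell N) → ℝ

/-- The degree of a basic tensor. -/
def tensorDeg {N n : ℕ} (x : Fin n → Cell N) : ℕ := ∑ i, cellDeg (x i)

/-- The matrix of the differential of the `n`-th tensor power. -/
def tensorD {N n : ℕ} (x y : Fin n → Cell N) : ℝ :=
  ∑ i, if ∀ j, j ≠ i → x j = y j then
    (-1) ^ (∑ j ∈ Finset.univ.filter (· < i), cellDeg (x j)) * cellD (x i) (y i) else 0

/-- The Koszul sign of the permutation `e` of the tensor factors of `⊗ x_i`. -/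
def koszulSign {N m m' : ℕ} (e : Fin m ≃ Fin m') (x : Fin m → Cell N) : ℝ :=
  ∏ i, ∏ j, if i < j ∧ e j < e i then (-1) ^ (cellDeg (x i) * cellDeg (x j)) else 1

namespace Op

/-- The operation is homogeneous of degree `r`. -/
def IsHomogeneous {N m n : ℕ} (f : Op N m n) (r : ℤ) : Prop :=
  ∀ x y, f x y ≠ 0 → (tensorDeg y : ℤ) - tensorDeg x = r

/-- All matrix entries of the operation that join cells at distance more than `ℓ` vanish. -/
def IsQuasilocal {N m n : ℕ} (ℓ : ℕ) (f : Op N m n) : Prop :=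
  ∀ x y, f x y ≠ 0 → ∀ i j, cellDist (x i) (y j) ≤ ℓ

/-- The differential `[d, f] = d ∘ f - (-1)^{deg f} f ∘ d`. -/
def bracketD {N : ℕ} [NeZero N] {m n : ℕ} (f : Op N m n) : Op N m n := fun x y =>
  ∑ z, f x z * tensorD z y - ∑ z, (-1) ^ (tensorDeg z + tensorDeg y) * (tensorD x z * f z y)

/-- The action of permutations of inputs and outputs, with Koszul signs. -/
def relabel {N m m' n n' : ℕ} (σ : Fin m ≃ Fin m') (τ : Fin n ≃ Fin n') (f : Op N m n) :
    Op N m' n' := fun x y =>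
  koszulSign σ (x ∘ σ) * koszulSign τ (y ∘ τ) * f (x ∘ σ) (y ∘ τ)

/-- The properadic composition `(f ⊗ id) ∘ (id ⊗ g)`, in which the first `k` outputs of `g` are
plugged into the last `k` inputs of `f`; the sign is that of moving `g` past the first `m₁`
inputs. -/
def comp {N : ℕ} [NeZero N] {k m₁ m₂ n₁ n₂ : ℕ} (f : Op N (m₁ + k) n₁) (g : Op N m₂ (k + n₂)) :
    Op N (m₁ + m₂) (n₁ + n₂) := fun x y =>
  ∑ z : Fin k → Cell N,
    (-1) ^ ((tensorDeg z + tensorDeg (y ∘ Fin.natAdd n₁) + tensorDeg (x ∘ Fin.natAdd m₁)) *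
        tensorDeg (x ∘ Fin.castAdd m₂)) *
      (f (Fin.append (x ∘ Fin.castAdd m₂) z) (y ∘ Fin.castAdd n₂) *
        g (x ∘ Fin.natAdd m₁) (Fin.append z (y ∘ Fin.natAdd n₁)))

/-- Properadic composition as a bilinear map. -/
def compₗ {N : ℕ} [NeZero N] {k m₁ m₂ n₁ n₂ : ℕ} :
    Op N (m₁ + k) n₁ →ₗ[ℝ] Op N m₂ (k + n₂) →ₗ[ℝ] Op N (m₁ + m₂) (n₁ + n₂) :=
  LinearMap.mk₂ ℝ comp
    (by
      intro f f' g
      funext x y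
      simp only [comp, Pi.add_apply, add_mul, mul_add, Finset.sum_add_distrib])
    (by
      intro c f g
      funext x y
      simp only [comp, Pi.smul_apply, smul_eq_mul, Finset.mul_sum]
      exact Finset.sum_congr rfl fun z _ => by ring)
    (by
      intro f g g'
      funext x y
      simp only [comp, Pi.add_apply, mul_add, Finset.sum_add_distrib])
    (by
      intro c f g
      funext x y
      simp only [comp, Pi.smul_apply, smul_eq_mul, Finset.mul_sum]
      exact Finset.sum_congr rfl fun z _ => by ring)

/-- Matrices of maps between tensor powers of the cohomology of the circle, in its basis `1`
(index `0`, degree `0`) and `ω` (index `1`, degree `1`, of total volume one). -/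
abbrev CohomOp (m n : ℕ) : Type := (Fin m → Fin 2) → (Fin n → Fin 2) → ℝ

/-- Cocycles representing the basis of cohomology: `∑ x, f_x` for `1` and `g_{1/2}` for `ω`. -/
def representative {N : ℕ} : Fin 2 → Cell N → ℝ
  | 0, Sum.inl _ => 1
  | 1, Sum.inr y => if y = 0 then 1 else 0
  | _, _ => 0

/-- `f` is closed and acts on cohomology as `Ψ`: on every tensor product of representatives of basis
classes, `f` differs by a coboundary from the corresponding representative of the value of `Ψ`. -/
def Induces {N : ℕ} [NeZero N] {m n : ℕ} (f : Op N m n) (Ψ : CohomOp m n) : Prop :=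
  bracketD f = 0 ∧
  ∃ E : (Fin m → Fin 2) → (Fin n → Cell N) → ℝ, ∀ h y,
    (∑ x : Fin m → Cell N, (∏ i, representative (h i) (x i)) * f x y) -
        ∑ k : Fin n → Fin 2, Ψ h k * ∏ j, representative (k j) (y j) =
      ∑ z, E h z * tensorD z y

end Op

/-- The cup product on the cohomology of the circle. -/
def cohomMult : Op.CohomOp 2 1 := fun h k =>
  if (h 0 : ℕ) + (h 1 : ℕ) = (k 0 : ℕ) then 1 else 0

/-- The comultiplication `1 ↦ ω ⊗ 1 - 1 ⊗ ω`, `ω ↦ ω ⊗ ω` on the cohomology of the circle. -/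
def cohomComult : Op.CohomOp 1 2 := fun h k =>
  if h 0 = 0 then
    (if k 0 = 1 ∧ k 1 = 0 then 1 else 0) - (if k 0 = 0 ∧ k 1 = 1 then 1 else 0)
  else if k 0 = 1 ∧ k 1 = 1 then 1 else 0

/-! ### Actions of `sh Frob₁` on cellular cochains -/

/-- Candidate values of an action on the generators of `sh Frob₁`. -/
abbrev GenMap (N : ℕ) : Type 1 := ∀ β m n : ℕ, Gen β m n →ₗ[ℝ] Op N m n

/-- The value of the properad homomorphism determined by `η` on the derivative, in the cobar
construction, of a generator of genus `β` with family of decompositions `u`: the sum of the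
compositions of all binary decompositions, each with the sign `(-1)^{deg q₁}`, where `q₁` is the
lower vertex, of degree `-(β₁ + m₁ + k)`. Since the inputs, the outputs and the `k + 1` internal
edges are numbered in all possible ways, every decomposition occurs `m₁! m₂! n₁! n₂! (k + 1)!`
times. -/
def imageOfDerivative {N : ℕ} [NeZero N] (η : GenMap N) (β : ℕ) {m n : ℕ}
    (u : Decomposition m n) : Op N m n :=
  ∑ k ∈ Finset.range (β + 1), ∑ b ∈ Finset.HasAntidiagonal.antidiagonal (β - k),
    ∑ p ∈ Finset.HasAntidiagonal.antidiagonal m, ∑ r ∈ Finset.HasAntidiagonal.antidiagonal n,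
      ∑ σ : Fin (p.1 + p.2) ≃ Fin m, ∑ τ : Fin (r.1 + r.2) ≃ Fin n,
        ((-1) ^ (b.1 + p.1 + k) / ((p.1)! * (p.2)! * (r.1)! * (r.2)! * (k + 1)! : ℝ)) •
          Op.relabel σ τ
            (TensorProduct.lift (Op.compₗ.compl₁₂ (η b.1 (p.1 + (k + 1)) r.1)
              (η b.2 p.2 ((k + 1) + r.2))) (u k b.1 b.2 p.1 p.2 r.1 r.2 σ τ))

/-- `η` is an action, on the cellular cochains of the circle with `N` cells, of the quasifree dg
properad generated by the generators of `sh Frob₁` of genus `β`, with `m` inputs and `n` outputs,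
for `(β, m, n) ∈ I`, where `I` is such that the derivatives of these generators involve no further
generators. (A homomorphism out of a quasifree properad is a degree preserving equivariant map on
generators that is compatible with the differentials of the generators.) For `I = Set.univ` this is
an action of `sh Frob₁`. -/
structure IsAction {N : ℕ} [NeZero N] (I : Set (ℕ × ℕ × ℕ)) (η : GenMap N) : Prop where
  homogeneous : ∀ {β m n : ℕ}, (β, m, n) ∈ I → ∀ q : Gen β m n,
    (η β m n q).IsHomogeneous (2 - ((β : ℤ) + m))
  equivariant : ∀ {β m n : ℕ}, (β, m, n) ∈ I →
    ∀ (σ : Fin m ≃ Fin m) (τ : Fin n ≃ Fin n) (q q' : Gen β m n),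
      (∀ t, coeff (relabel σ τ t) q' = coeff t q) → η β m n q' = Op.relabel σ τ (η β m n q)
  map_derivative : ∀ {β m n : ℕ}, (β, m, n) ∈ I → ∀ (q : Gen β m n) (u : Decomposition m n),
    IsDecomposition q u → (η β m n q).bracketD = imageOfDerivative η β u

/-- The action lifts the `1`-shifted Frobenius algebra structure on the cohomology of the circle. -/
structure LiftsFrobenius {N : ℕ} [NeZero N] (η : GenMap N) : Prop where
  induces_mult : ∀ q : Gen 0 2 1, (η 0 2 1 q).Induces (coeff mult q • cohomMult)
  induces_comult : ∀ q : Gen 0 1 2, (η 0 1 2 q).Induces (coeff comult q • cohomComult)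

/-- The generators with index in `I` act `ℓ`-quasilocally. -/
def IsQuasilocalOn {N : ℕ} (I : Set (ℕ × ℕ × ℕ)) (ℓ : ℕ) (η : GenMap N) : Prop :=
  ∀ {β m n : ℕ}, (β, m, n) ∈ I → ∀ q : Gen β m n, (η β m n q).IsQuasilocal ℓ

/-- The first few generators, namely those of genus `β` with `m` inputs and `n` outputs such that
`β + m + n ≤ 4`: the multiplication, the comultiplication, the homotopies for associativity,
coassociativity and the Frobenius relation, the genus-one generators with arities `(2, 1)`
and `(1, 2)`, and the genus-two generator with arity `(1, 1)`. -/
def firstFew : Set (ℕ × ℕ × ℕ) := {i | i.1 + i.2.1 + i.2.2 ≤ 4}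

/-- The first few generators without the genus-two generator of arity `(1, 1)`. -/
def firstFewBefore : Set (ℕ × ℕ × ℕ) := firstFew \ {(2, 1, 1)}

/-- The genus-two composite with one input and one output: `(Δ ⊗ id) ∘ Δ` followed by
`(x, y, z) ↦ x · (y · z)`. -/
def genusTwoGraph : Composite (Fin 1) (Fin 1) :=
  compFin 2 (m₁ := 0) (m₂ := 1) (n₁ := 1) (n₂ := 0) multMult comultComult

end ShFrob

end

open ShFrob

/-!
Products of operations are read from left to right, and `1` denotes the constant cochain
`∑ x, f_x`, which is `unit 1`.

**The generator.** The quadratic dual of `Frob₁` is dual to the properad of Lie bialgebras with an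
odd bracket. Hence every such bialgebra `V` over an exterior algebra gives elements of the
quadratic dual, the matrix coefficients of composites between elements of `V` (`coeffSpace_le`).
The generator `b`, here `genusTwo`, is such a coefficient for a bialgebra with nine basis elements
(`Letter`), in which the axioms need to hold only in low content. Cutting `b` open yields explicit
generators for the multiplication `m`, the comultiplication `Δ` and the homotopies, whose
decompositions are computed, and `η(∂b)` takes the form `T = -1/2 H m + 1/2 Δ G + 1/6 ∑ i, X i M i`
(`FewOperations.obstruction`). Here `G`, `H` have genus one, and `M i`, `X i` are homotopies for
associativity and coassociativity. The relations for the derivatives of these operations imply that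
`T` is closed.

**The value on an arc.** Over an arc, closed elements of degree one in tensor powers of the
cochains are exact (`exists_agreeOn_mul_d`). So `1 Δ` has there an antisymmetric primitive `K`. By
quasilocality `K` is constant on either side of the diagonal, and its jump is the coefficient of
`ω ⊗ 1` in `Δ(1)`, so `K` takes the values `±1/2` (`K_low_and_high`). The elements `1 (X i)`,
corrected by terms `K Δ`, also have primitives `L i`, which are unique up to constants and are
normalised to have vanishing sum over the permutations of three distant points. Averaging the `L i`
gives a primitive `mean` for `1 Y`, where `Y` is another homotopy for coassociativity, again up to
terms `K Δ`. It too is constant as long as its arguments stay apart, and its jumps are values of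
`K`; the normalisation then shows that it equals `1/6` when two arguments are together and far from
the third (`mean_low_and_high`). Finally `1 H`, corrected by `mean m` and by the product of `K`
with the Frobenius homotopy, is closed, and so is a constant `κ`; at distant points only `mean`
contributes, and `κ = 1/6`. Replacing `1 H`, `1 Δ` and `1 (X i)` in `1 T` by derivatives of
primitives, everything but `κ` cancels, because operations of degree `-1` annihilate primitives,
which have degree zero. The result is `1 T = -κ/2 = -1/12` on the arc
(`Primitives.unit_mul_obstruction`).

**Conclusion.** As `1 T` is closed, it is equal to `-1/12` on the whole circle. For the class `ω`,
the operation `T` is applied to a chain of vertices whose coboundary is a difference of two edges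
(`sum_obstruction_middle`). If `b` itself acted, `T` would be the boundary of an operation of
degree `-1`, and `1 T` would vanish; so there is no such action.
-/

open scoped TensorProduct Nat

set_option linter.unusedSectionVars false
set_option linter.constructorNameAsVariable false

noncomputable section

namespace ShFrob

open Composite

/-! ### Formal composites -/

section

theorem finite_sum {A B : Type} : Finite (A ⊕ B) ↔ Finite A ∧ Finite B :=
  ⟨fun _ => ⟨Finite.of_injective (Sum.inl : A → A ⊕ B) Sum.inl_injective,
      Finite.of_injective (Sum.inr : B → A ⊕ B) Sum.inr_injective⟩,
    fun ⟨_, _⟩ => inferInstance⟩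

namespace Composite

/-- The number of comultiplications. -/
def numComult : {A B : Type} → Composite A B → ℕ
  | _, _, mult => 0
  | _, _, comult => 1
  | _, _, relabel _ _ t => t.numComult
  | _, _, comp s t => s.numComult + t.numComult

theorem finite {A B : Type} (t : Composite A B) : Finite A ∧ Finite B := by
  induction t with
  | mult => exact ⟨inferInstance, inferInstance⟩
  | comult => exact ⟨inferInstance, inferInstance⟩
  | relabel e e' t ih =>
    obtain ⟨_, _⟩ := ih
    exact ⟨Finite.of_equiv _ e, Finite.of_equiv _ e'⟩
  | comp s t ihs iht =>
    obtain ⟨h1, h2⟩ := ihs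
    obtain ⟨h3, h4⟩ := iht
    rw [finite_sum] at h1 h4
    have := h1.1; have := h4.2
    exact ⟨inferInstance, inferInstance⟩

/-- The number of multiplications is determined by the genus and the number of inputs. -/
theorem numMult_add_one {A B : Type} (t : Composite A B) :
    t.numMult + 1 = t.genus + Nat.card A := by
  induction t with
  | mult => simp [numMult, genus]
  | comult => simp [numMult, genus]
  | relabel e e' t ih => simpa [numMult, genus, Nat.card_congr e] using ih
  | @comp M₁ M₂ N₁ N₂ K _ s t ihs iht =>
    obtain ⟨h1, h2⟩ := s.finite
    obtain ⟨h3, h4⟩ := t.finite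
    rw [finite_sum] at h1 h4
    have := h1.1; have := h1.2
    have hK : 0 < Nat.card K := Nat.card_pos
    rw [Nat.card_sum] at ihs ⊢
    simp only [numMult, genus]
    omega

/-- The number of comultiplications is determined by the genus and the number of outputs. -/
theorem numComult_add_one {A B : Type} (t : Composite A B) :
    t.numComult + 1 = t.genus + Nat.card B := by
  induction t with
  | mult => simp [numComult, genus]
  | comult => simp [numComult, genus]
  | relabel e e' t ih => simpa [numComult, genus, Nat.card_congr e'] using ih
  | @comp M₁ M₂ N₁ N₂ K _ s t ihs iht =>
    obtain ⟨h1, h2⟩ := s.finite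
    obtain ⟨h3, h4⟩ := t.finite
    rw [finite_sum] at h1 h4
    have := h4.1; have := h4.2
    have hK : 0 < Nat.card K := Nat.card_pos
    rw [Nat.card_sum] at iht ⊢
    simp only [numComult, genus]
    omega

theorem one_le_weight {A B : Type} (t : Composite A B) : 1 ≤ t.numMult + t.numComult := by
  induction t with
  | mult => simp [numMult]
  | comult => simp [numComult]
  | relabel e e' t ih => simpa [numMult, numComult] using ih
  | comp s t ihs iht => simp only [numMult, numComult]; omega

end Composite

/-- A composite with a single vertex is a relabelled generator. -/
theorem Cong.of_weight_one {A B : Type} (t : Composite A B) (h : t.numMult + t.numComult = 1) :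
    (∃ (e : Fin 2 ≃ A) (e' : Fin 1 ≃ B), Cong 1 t (Composite.relabel e e' Composite.mult)) ∨
      ∃ (e : Fin 1 ≃ A) (e' : Fin 2 ≃ B), Cong 1 t (Composite.relabel e e' Composite.comult) := by
  induction t with
  | mult => exact Or.inl ⟨Equiv.refl _, Equiv.refl _, (Cong.relabel_refl _).symm⟩
  | comult => exact Or.inr ⟨Equiv.refl _, Equiv.refl _, (Cong.relabel_refl _).symm⟩
  | relabel f f' t ih =>
    rcases ih h with ⟨e, e', H⟩ | ⟨e, e', H⟩
    · exact Or.inl ⟨e.trans f, e'.trans f', by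
        simpa using (Cong.relabel f f' H).trans (Cong.relabel_trans _ _ _ _ _)⟩
    · exact Or.inr ⟨e.trans f, e'.trans f', by
        simpa using (Cong.relabel f f' H).trans (Cong.relabel_trans _ _ _ _ _)⟩
  | comp s t _ _ =>
    have h1 := s.one_le_weight
    have h2 := t.one_le_weight
    simp only [Composite.numMult, Composite.numComult] at h
    omega

theorem perm_fin_two (e : Equiv.Perm (Fin 2)) : e = Equiv.refl _ ∨ e = Equiv.swap 0 1 := by
  revert e; decide

theorem Cong.mult_of_genus_zero (t : Composite (Fin 2) (Fin 1)) (h : t.genus = 0) :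
    Cong 1 t Composite.mult := by
  have h1 := t.numMult_add_one
  have h2 := t.numComult_add_one
  simp only [h, Nat.card_eq_fintype_card, Fintype.card_fin] at h1 h2
  rcases Cong.of_weight_one t (by omega) with ⟨e, e', H⟩ | ⟨e, e', H⟩
  · obtain rfl : e' = Equiv.refl _ := Subsingleton.elim _ _
    rcases perm_fin_two e with rfl | rfl
    · simpa using H.trans (Cong.relabel_refl _)
    · simpa using H.trans Cong.mult_comm
  · exact absurd (Fintype.card_congr e) (by simp)

theorem Cong.comult_of_genus_zero (t : Composite (Fin 1) (Fin 2)) (h : t.genus = 0) :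
    ∃ ε, Cong ε t Composite.comult := by
  have h1 := t.numMult_add_one
  have h2 := t.numComult_add_one
  simp only [h, Nat.card_eq_fintype_card, Fintype.card_fin] at h1 h2
  rcases Cong.of_weight_one t (by omega) with ⟨e, e', H⟩ | ⟨e, e', H⟩
  · exact absurd (Fintype.card_congr e) (by simp)
  · obtain rfl : e = Equiv.refl _ := Subsingleton.elim _ _
    rcases perm_fin_two e' with rfl | rfl
    · exact ⟨_, H.trans (Cong.relabel_refl _)⟩
    · exact ⟨_, H.trans Cong.comult_anticomm⟩

theorem Cong.compFin {ε ε' : ℤˣ} {k m₁ m₂ n₁ n₂ : ℕ}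
    {s s' : Composite (Fin (m₁ + (k + 1))) (Fin n₁)}
    {t t' : Composite (Fin m₂) (Fin ((k + 1) + n₂))} (hs : Cong ε s s') (ht : Cong ε' t t') :
    Cong (ε * ε') (Composite.compFin k s t) (Composite.compFin k s' t') :=
  Cong.relabel _ _ (Cong.comp (Cong.relabel _ _ hs) (Cong.relabel _ _ ht))

/-! ### The quadratic dual coproperad -/

theorem quadraticDual_le_cofree (β : ℕ) (A B : Type) : quadraticDual β A B ≤ cofree β A B :=
  iSup₂_le fun _ hS => hS.1.le_cofree β A B

theorem le_quadraticDual {S : ∀ (_ : ℕ) (A B : Type), Submodule ℝ (Composite A B → ℝ)}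
    (h : IsSubcoproperad S) (h' : WeightTwoInRelations S) (β : ℕ) (A B : Type) :
    S β A B ≤ quadraticDual β A B :=
  le_iSup₂_of_le (f := fun (S : ∀ (_ : ℕ) (A B : Type), Submodule ℝ (Composite A B → ℝ))
    (_ : IsSubcoproperad S ∧ WeightTwoInRelations S) => S β A B) S ⟨h, h'⟩ le_rfl

/-- Slicing is linear, so the supremum of all admissible sub-coproperads is again one. -/
theorem isSubcoproperad_quadraticDual : IsSubcoproperad quadraticDual where
  le_cofree := quadraticDual_le_cofree
  relabel_mem := by
    intro β A A' B B' e e' x hx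
    have : quadraticDual β A B ≤
        (quadraticDual β A' B').comap (LinearMap.funLeft ℝ ℝ (Composite.relabel e e')) :=
      iSup₂_le fun S hS y hy => le_quadraticDual hS.1 hS.2 _ _ _ (hS.1.relabel_mem e e' hy)
    exact this hx
  lower_slice_mem := by
    intro β β₂ M₁ M₂ N₁ N₂ K _ x s hx h
    have : quadraticDual β (M₁ ⊕ M₂) (N₁ ⊕ N₂) ≤ (quadraticDual β₂ M₂ (K ⊕ N₂)).comap
        (LinearMap.funLeft ℝ ℝ (Composite.comp (N₂ := N₂) s)) :=
      iSup₂_le fun S hS y hy => le_quadraticDual hS.1 hS.2 _ _ _ (hS.1.lower_slice_mem s hy h)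
    exact this hx
  upper_slice_mem := by
    intro β β₁ M₁ M₂ N₁ N₂ K _ x t hx h
    have : quadraticDual β (M₁ ⊕ M₂) (N₁ ⊕ N₂) ≤ (quadraticDual β₁ (M₁ ⊕ K) N₁).comap
        (LinearMap.funLeft ℝ ℝ (fun s => Composite.comp (M₁ := M₁) s t)) :=
      iSup₂_le fun S hS y hy => le_quadraticDual hS.1 hS.2 _ _ _ (hS.1.upper_slice_mem t hy h)
    exact this hx

theorem isCoassocRelation_of_mem {x : Composite (Fin 1) (Fin 3) → ℝ}
    (hx : x ∈ quadraticDual 0 (Fin 1) (Fin 3)) : IsCoassocRelation x := by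
  let ev (t : Composite (Fin 1) (Fin 3)) : (Composite (Fin 1) (Fin 3) → ℝ) →ₗ[ℝ] ℝ :=
    { toFun := fun x => x t, map_add' := fun _ _ => rfl, map_smul' := fun _ _ => rfl }
  let ψ : (Composite (Fin 1) (Fin 3) → ℝ) →ₗ[ℝ] ℝ :=
    ev comultComult +
      ev (Composite.relabel (Equiv.refl _) (finRotate 3) comultComult) +
      ev
        (Composite.relabel (Equiv.refl _) ((finRotate 3).trans (finRotate 3)) comultComult)
  have : quadraticDual 0 (Fin 1) (Fin 3) ≤ LinearMap.ker ψ :=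
    iSup₂_le fun S hS y hy => hS.2.coassoc y hy
  exact this hx

section Gen

variable {β m n : ℕ}

theorem coeff_eq_of_cong (q : Gen β m n) {ε : ℤˣ} {s t : Composite (Fin m) (Fin n)}
    (h : Cong ε s t) : coeff s q = ((ε : ℤ) : ℝ) * coeff t q :=
  (quadraticDual_le_cofree _ _ _ q.2).1 ε s t h

theorem coeff_eq_of_cong_one (q : Gen β m n) {s t : Composite (Fin m) (Fin n)}
    (h : Cong 1 s t) : coeff s q = coeff t q := by
  simpa using coeff_eq_of_cong q h

theorem coeff_eq_zero (q : Gen β m n) {t : Composite (Fin m) (Fin n)} (h : t.genus ≠ β) :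
    coeff t q = 0 := by
  by_contra h'
  exact h ((quadraticDual_le_cofree _ _ _ q.2).2 t h')

theorem gen_ext {q q' : Gen β m n} (h : ∀ t, t.genus = β → coeff t q = coeff t q') : q = q' := by
  apply Subtype.ext
  funext t
  by_cases ht : t.genus = β
  · exact h t ht
  · exact (coeff_eq_zero q ht).trans (coeff_eq_zero q' ht).symm

theorem genus_compFin {k m₁ m₂ n₁ n₂ : ℕ} (s : Composite (Fin (m₁ + (k + 1))) (Fin n₁))
    (t : Composite (Fin m₂) (Fin ((k + 1) + n₂))) :
    (Composite.compFin k s t).genus = k + (s.genus + t.genus) := by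
  simp [Composite.compFin, Composite.genus]
  omega

/-- The generator whose coefficient on `s` is that of `q` on `s` composed with the fixed upper
vertex `t`. -/
def sliceUpper (q : Gen β m n) (k β₁ : ℕ) {m₁ m₂ n₁ n₂ : ℕ} (σ : Fin (m₁ + m₂) ≃ Fin m)
    (τ : Fin (n₁ + n₂) ≃ Fin n) (t : Composite (Fin m₂) (Fin ((k + 1) + n₂)))
    (h : k + (β₁ + t.genus) = β) : Gen β₁ (m₁ + (k + 1)) n₁ :=
  ⟨fun s => q.1 (Composite.relabel σ τ (Composite.compFin k s t)), by
    have H := isSubcoproperad_quadraticDual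
    refine H.relabel_mem finSumFinEquiv.symm (Equiv.refl _) (H.upper_slice_mem
      (Composite.relabel (Equiv.refl _) finSumFinEquiv.symm t)
      (H.relabel_mem finSumFinEquiv finSumFinEquiv (H.relabel_mem σ τ q.2)) ?_)
    simp [Composite.genus]; omega⟩

/-- The generator whose coefficient on `t` is that of `q` on the fixed lower vertex `s` composed
with `t`. -/
def sliceLower (q : Gen β m n) (k β₂ : ℕ) {m₁ m₂ n₁ n₂ : ℕ} (σ : Fin (m₁ + m₂) ≃ Fin m)
    (τ : Fin (n₁ + n₂) ≃ Fin n) (s : Composite (Fin (m₁ + (k + 1))) (Fin n₁))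
    (h : k + (s.genus + β₂) = β) : Gen β₂ m₂ ((k + 1) + n₂) :=
  ⟨fun t => q.1 (Composite.relabel σ τ (Composite.compFin k s t)), by
    have H := isSubcoproperad_quadraticDual
    refine H.relabel_mem (Equiv.refl _) finSumFinEquiv.symm (H.lower_slice_mem
      (Composite.relabel finSumFinEquiv.symm (Equiv.refl _) s)
      (H.relabel_mem finSumFinEquiv finSumFinEquiv (H.relabel_mem σ τ q.2)) ?_)
    simp [Composite.genus]; omega⟩

end Gen

end

/-! ### Colourings of composites by a Lie bialgebra with odd bracket -/

section

/-- A basis of a module with a cobracket and an odd commutative bracket which satisfy the axioms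
of a Lie bialgebra in low content; edges of composites are coloured by these letters. The
letters `a` and `b` are primitive, the cobracket takes `w` to `b ∧ a`, `x` to `w ∧ a`, `p` to
`v ∧ b` and `r` to `u ∧ a`. -/
inductive Letter
  | a | b | w | x | v | u | p | r | y
  deriving DecidableEq

instance : Fintype Letter :=
  ⟨{.a, .b, .w, .x, .v, .u, .p, .r, .y}, by intro t; cases t <;> decide⟩

namespace Letter

/-- The numbers of `a`s and `b`s in a letter. The bracket and the cobracket preserve the
content. -/
def content : Letter → ℕ × ℕ
  | a => (1, 0)
  | b => (0, 1)
  | w => (1, 1)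
  | x => (2, 1)
  | v => (2, 0)
  | u => (1, 1)
  | p => (2, 1)
  | r => (2, 1)
  | y => (2, 1)

/-- `cobracket z x₁ x₂` is the coefficient of `x₁ ⊗ x₂` in the cobracket of `z`. -/
def cobracket : Letter → Letter → Letter → ℤ
  | w, b, a => 1
  | w, a, b => -1
  | x, w, a => 1
  | x, a, w => -1
  | p, v, b => 1
  | p, b, v => -1
  | r, u, a => 1
  | r, a, u => -1
  | _, _, _ => 0

/-- `prod₁ x₁ x₂ z` is the coefficient of `i • z` in the bracket of `x₁` and `x₂`, where `i` and
`j` are the two odd generators of `Grass`. -/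
def prod₁ : Letter → Letter → Letter → ℤ
  | v, b, y => 1
  | b, v, y => 1
  | a, b, u => 1
  | b, a, u => 1
  | a, w, r => 1
  | w, a, r => 1
  | _, _, _ => 0

/-- `prod₂ x₁ x₂ z` is the coefficient of `j • z` in the bracket of `x₁` and `x₂`. -/
def prod₂ : Letter → Letter → Letter → ℤ
  | a, a, v => 2
  | u, a, y => 1
  | a, u, y => 1
  | a, w, p => -2
  | w, a, p => -2
  | _, _, _ => 0

end Letter

open ShFrob.Letter (content cobracket prod₁ prod₂)

/-- The exterior algebra over `ℤ` on two generators `i` and `j`, realised as a degenerate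
quaternion algebra: `i ^ 2 = j ^ 2 = 0` and `i * j = -j * i = k`. -/
abbrev Grass : Type := QuaternionAlgebra ℤ 0 0 0

/-- The coefficient of `z` in the bracket of `x₁` and `x₂`, an odd element of the exterior
algebra. -/
def gmul (x₁ x₂ z : Letter) : Grass := ⟨0, prod₁ x₁ x₂ z, prod₂ x₁ x₂ z, 0⟩

theorem gmul_comm : ∀ x₁ x₂ z : Letter, gmul x₁ x₂ z = gmul x₂ x₁ z := by
  have h : ∀ x₁ x₂ z : Letter, prod₁ x₁ x₂ z = prod₁ x₂ x₁ z ∧ prod₂ x₁ x₂ z = prod₂ x₂ x₁ z := by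
    decide +kernel
  intro x₁ x₂ z
  rw [gmul, gmul, (h x₁ x₂ z).1, (h x₁ x₂ z).2]

theorem cobracket_anticomm :
    ∀ z x₁ x₂ : Letter, cobracket z x₁ x₂ = -cobracket z x₂ x₁ := by
  decide +kernel

/-- The matrix coefficient of a composite, between letters on its inputs and letters on its
outputs: the sum over all colourings of the internal edges of the products of the structure
constants at the vertices. The finite sum is a `finsum` because `K` carries no finiteness
instance. -/
def eval : {A B : Type} → Composite A B → (A → Letter) → (B → Letter) → Grass
  | _, _, .mult => fun X Y => gmul (X 0) (X 1) (Y 0)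
  | _, _, .comult => fun X Y => (cobracket (X 0) (Y 0) (Y 1) : Grass)
  | _, _, .relabel e e' t => fun X Y => eval t (X ∘ e) (Y ∘ e')
  | _, _, @Composite.comp _ _ _ _ K _ s t => fun X Y => ∑ᶠ z : K → Letter,
      eval s (Sum.elim (X ∘ Sum.inl) z) (Y ∘ Sum.inl) *
        eval t (X ∘ Sum.inr) (Sum.elim z (Y ∘ Sum.inr))

theorem eval_relabel {A A' B B' : Type} (e : A ≃ A') (e' : B ≃ B') (t : Composite A B)
    (X : A' → Letter) (Y : B' → Letter) :
    eval (relabel e e' t) X Y = eval t (X ∘ e) (Y ∘ e') := rfl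

theorem eval_comp {M₁ M₂ N₁ N₂ K : Type} [Nonempty K] [Fintype K] [DecidableEq K] (s : Composite
    (M₁ ⊕ K) N₁)
    (t : Composite M₂ (K ⊕ N₂)) (X : M₁ ⊕ M₂ → Letter) (Y : N₁ ⊕ N₂ → Letter) :
    eval (comp s t) X Y = ∑ z : K → Letter,
      eval s (Sum.elim (X ∘ Sum.inl) z) (Y ∘ Sum.inl) *
        eval t (X ∘ Sum.inr) (Sum.elim z (Y ∘ Sum.inr)) := by
  exact finsum_eq_sum_of_fintype _

/-- `q` is an even or an odd element of the exterior algebra, according to the parity of `n`. -/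
def IsPar (n : ℕ) (q : Grass) : Prop :=
  if Even n then q.imI = 0 ∧ q.imJ = 0 else q.re = 0 ∧ q.imK = 0

theorem IsPar.mul {m n : ℕ} {p q : Grass} (hp : IsPar m p) (hq : IsPar n q) :
    IsPar (m + n) (p * q) := by
  unfold IsPar at *
  have h := Nat.even_add (m := m) (n := n)
  by_cases hm : Even m <;> by_cases hn : Even n <;> simp only [h, hm, hn, if_true, if_false,
    iff_true, iff_false, not_true] at * <;>
    simp [hp.1, hp.2, hq.1, hq.2]

theorem IsPar.sum {n : ℕ} {I : Type*} (S : Finset I) {f : I → Grass} (h : ∀ i ∈ S, IsPar n (f i)) :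
    IsPar n (∑ i ∈ S, f i) := by
  classical
  induction S using Finset.induction_on with
  | empty => simp [IsPar]
  | insert i S hi ih =>
    rw [Finset.sum_insert hi]
    have h1 := h i (by simp)
    have h2 := ih fun j hj => h j (by simp [hj])
    unfold IsPar at *
    split_ifs at * <;> simp_all

theorem IsPar.mul_comm {m n : ℕ} {p q : Grass} (hp : IsPar m p) (hq : IsPar n q) :
    p * q = (-1) ^ (m * n) * (q * p) := by
  unfold IsPar at *
  rcases Nat.even_or_odd m with hm | hm
  · rw [if_pos hm] at hp
    rw [(hm.mul_right n).neg_one_pow]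
    ext <;> simp [hp.1, hp.2] <;> ring
  rcases Nat.even_or_odd n with hn | hn
  · rw [if_pos hn] at hq
    rw [(hn.mul_left m).neg_one_pow]
    ext <;> simp [hq.1, hq.2] <;> ring
  · rw [if_neg (Nat.not_even_iff_odd.2 hm)] at hp
    rw [if_neg (Nat.not_even_iff_odd.2 hn)] at hq
    rw [(hm.mul hn).neg_one_pow]
    ext <;> simp [hp.1, hp.2, hq.1, hq.2]; ring

theorem isPar_eval {A B : Type} (t : Composite A B) (X : A → Letter) (Y : B → Letter) :
    IsPar t.numMult (eval t X Y) := by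
  induction t with
  | mult => simp [IsPar, numMult, eval, gmul]
  | comult => simp [IsPar, numMult, eval]
  | relabel e e' t ih => exact ih _ _
  | @comp M₁ M₂ N₁ N₂ K _ s t ihs iht =>
    classical
    have := (finite_sum.1 s.finite.1).2
    have := Fintype.ofFinite K
    rw [eval_comp]
    exact IsPar.sum _ fun z _ => (ihs _ _).mul (iht _ _)

/-- Evaluation respects the congruence of composites: the signs of exchanging two
multiplications come from the supercommutativity of the exterior algebra. -/
theorem eval_cong {A B : Type} {ε : ℤˣ} {s t : Composite A B} (h : Cong ε s t)
    (X : A → Letter) (Y : B → Letter) : eval s X Y = ((ε : ℤ) : Grass) * eval t X Y := by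
  classical
  induction h with
  | refl t => simp
  | @symm _ _ ε s t h ih =>
    rw [ih, ← mul_assoc]
    rcases Int.units_eq_one_or ε with rfl | rfl <;> simp
  | trans h h' ih ih' => rw [ih, ih']; simp [mul_assoc]
  | relabel e e' h ih => exact ih _ _
  | @comp M₁ M₂ N₁ N₂ K _ ε ε' s s' t t' h h' ih ih' =>
    have := (finite_sum.1 s.finite.1).2
    have := Fintype.ofFinite K
    rw [eval_comp, eval_comp, Finset.mul_sum]
    refine Finset.sum_congr rfl fun z _ => ?_
    rw [ih, ih']
    rcases Int.units_eq_one_or ε with rfl | rfl <;>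
      rcases Int.units_eq_one_or ε' with rfl | rfl <;> simp
  | relabel_refl t => simp [eval]
  | relabel_trans e₁ e₂ e₁' e₂' t => simp [eval, Function.comp_assoc]
  | @comp_relabel M₁ M₂ N₁ N₂ K M₁' M₂' N₁' N₂' K' _ _ e₁ e₂ e₁' e₂' κ s t =>
    have := (finite_sum.1 s.finite.1).2
    have := Fintype.ofFinite K
    have := Fintype.ofEquiv K κ
    rw [eval_relabel, eval_comp, eval_comp]
    simp only [Units.val_one, Int.cast_one, one_mul]
    refine Fintype.sum_equiv (κ.symm.arrowCongr (Equiv.refl _)) _ _ fun z => ?_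
    simp only [eval]
    congr 2 <;> ext (i | i) <;> simp
  | @assoc M₁ M₂ M₃ N₁ N₂ N₃ a b c _ _ s t u =>
    have h1 := finite_sum.1 (finite_sum.1 s.finite.1).2
    have := h1.1
    have := h1.2
    have := (finite_sum.1 t.finite.1).2
    have := Fintype.ofFinite a
    have := Fintype.ofFinite b
    have := Fintype.ofFinite c
    rw [eval_relabel, eval_comp, eval_comp]
    simp only [eval_relabel, eval_comp, Units.val_one, Int.cast_one, one_mul, Finset.sum_mul,
      Finset.mul_sum]
    rw [← Finset.sum_product', ← Finset.sum_product']
    refine Fintype.sum_equiv (((Equiv.sumArrowEquivProdArrow b c Letter).prodCongr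
      (Equiv.refl (a → Letter))).trans (((Equiv.prodComm _ _).trans
        (Equiv.prodAssoc _ _ _).symm).trans
      ((Equiv.sumArrowEquivProdArrow a b Letter).symm.prodCongr (Equiv.refl _)))) _ _ fun z => ?_
    simp only [mul_assoc]
    refine congrArg₂ (· * ·) (congrArg₂ (eval s) ?_ rfl) (congrArg₂ (· * ·)
      (congrArg₂ (eval t) ?_ ?_) (congrArg₂ (eval u) rfl ?_))
    · funext i; rcases i with i | i | i <;> rfl
    · funext i; rcases i with i | i <;> rfl
    · funext i; rcases i with i | i <;> rfl
    · funext i; rcases i with (i | i) | i <;> rfl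
  | @assoc_upper M₁ M₂ M₃ N₁ N₂ N₃ a b _ _ s t u =>
    have h1 := finite_sum.1 (finite_sum.1 s.finite.1).2
    have := h1.1
    have := h1.2
    have := Fintype.ofFinite a
    have := Fintype.ofFinite b
    rw [eval_relabel, eval_comp, eval_comp]
    simp only [eval_relabel, eval_comp, Finset.sum_mul, Finset.mul_sum]
    rw [Finset.sum_comm]
    refine Finset.sum_congr rfl fun w _ => Finset.sum_congr rfl fun z _ => ?_
    rw [mul_assoc, (isPar_eval t _ _).mul_comm (isPar_eval u _ _)]
    push_cast
    rw [← mul_assoc, ← mul_assoc, ((Commute.neg_one_left _).pow_left _).symm.eq, mul_assoc,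
      mul_assoc,
      mul_assoc]
    refine congrArg₂ (· * ·) rfl (congrArg₂ (· * ·) (congrArg₂ (eval s) ?_ rfl) (congrArg₂ (· * ·)
      (congrArg₂ (eval u) rfl ?_) (congrArg₂ (eval t) rfl ?_)))
    · funext i; rcases i with i | i | i <;> rfl
    · funext i; rcases i with i | i <;> rfl
    · funext i; rcases i with i | i <;> rfl
  | @assoc_lower M₁ M₂ M₃ N₁ N₂ N₃ a b _ _ s t u =>
    have := (finite_sum.1 s.finite.1).2
    have := (finite_sum.1 t.finite.1).2
    have := Fintype.ofFinite a
    have := Fintype.ofFinite b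
    rw [eval_relabel, eval_comp, eval_comp]
    simp only [eval_relabel, eval_comp, Finset.mul_sum]
    rw [Finset.sum_comm]
    refine Finset.sum_congr rfl fun w _ => Finset.sum_congr rfl fun z _ => ?_
    rw [← mul_assoc, (isPar_eval s _ _).mul_comm (isPar_eval t _ _), mul_assoc, mul_assoc]
    push_cast
    refine congrArg₂ (· * ·) rfl (congrArg₂ (· * ·) (congrArg₂ (eval t) ?_ ?_) (congrArg₂ (· * ·)
      (congrArg₂ (eval s) ?_ ?_) (congrArg₂ (eval u) rfl ?_)))
    · funext i; rcases i with i | i <;> rfl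
    · funext i; rfl
    · funext i; rcases i with i | i <;> rfl
    · funext i; rfl
    · funext i; rcases i with (i | i) | i <;> rfl
  | mult_comm => simpa [eval] using gmul_comm _ _ _
  | comult_anticomm => simp [eval, cobracket_anticomm (X 0) (Y 1)]

end

/-! ### Matrix coefficients and the quadratic dual -/

section

open ShFrob.Letter (content cobracket prod₁ prod₂)

theorem Cong.numMult_eq {A B : Type} {ε : ℤˣ} {s t : Composite A B} (h : Cong ε s t) :
    s.numMult = t.numMult := by
  induction h with
  | refl t => rfl
  | symm h ih => exact ih.symm
  | trans h h' ih ih' => exact ih.trans ih'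
  | relabel e e' h ih => exact ih
  | comp h h' ih ih' => exact congrArg₂ (· + ·) ih ih'
  | relabel_refl t => rfl
  | relabel_trans => rfl
  | comp_relabel => rfl
  | assoc s t u => exact Nat.add_assoc _ _ _
  | assoc_upper s t u => exact Nat.add_right_comm _ _ _
  | assoc_lower s t u => exact Nat.add_left_comm _ _ _
  | mult_comm => rfl
  | comult_anticomm => rfl

theorem Cong.genus_eq {A B : Type} {ε : ℤˣ} {s t : Composite A B} (h : Cong ε s t) :
    s.genus = t.genus := by
  have := h.numMult_eq
  have := s.numMult_add_one
  have := t.numMult_add_one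
  omega

/-- The sum of the contents of a family of letters. -/
def totalContent {A : Type} (X : A → Letter) : ℕ × ℕ := ∑ᶠ i, content (X i)

theorem totalContent_eq {A : Type} [Fintype A] (X : A → Letter) :
    totalContent X = ∑ i, content (X i) := finsum_eq_sum_of_fintype _

theorem totalContent_comp_equiv {A B : Type} (e : A ≃ B) (X : B → Letter) :
    totalContent (X ∘ e) = totalContent X :=
  finsum_comp_equiv e (f := fun i => content (X i))

theorem totalContent_sum {A B : Type} [Finite A] [Finite B] (X : A ⊕ B → Letter) :
    totalContent X = totalContent (X ∘ Sum.inl) + totalContent (X ∘ Sum.inr) := by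
  have := Fintype.ofFinite A
  have := Fintype.ofFinite B
  simp [totalContent_eq]

theorem content_gmul : ∀ x₁ x₂ z : Letter, prod₁ x₁ x₂ z ≠ 0 ∨ prod₂ x₁ x₂ z ≠ 0 →
    content x₁ + content x₂ = content z := by decide +kernel

theorem content_cobracket : ∀ z x₁ x₂ : Letter, cobracket z x₁ x₂ ≠ 0 →
    content z = content x₁ + content x₂ := by decide +kernel

theorem eval_eq_zero {A B : Type} (t : Composite A B) (X : A → Letter) (Y : B → Letter)
    (h : totalContent X ≠ totalContent Y) : eval t X Y = 0 := by
  classical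
  induction t with
  | mult =>
    by_contra h'
    refine h ?_
    simp only [totalContent_eq, Fin.sum_univ_two, Fin.sum_univ_one]
    apply content_gmul
    by_contra! h''
    exact h' (by simp only [eval, gmul, h''.1, h''.2]; rfl)
  | comult =>
    by_contra h'
    refine h ?_
    simp only [totalContent_eq, Fin.sum_univ_two, Fin.sum_univ_one]
    apply content_cobracket
    intro h''
    exact h' (by simp [eval, h''])
  | relabel e e' t ih =>
    exact ih _ _ (by simpa [totalContent_comp_equiv] using h)
  | @comp M₁ M₂ N₁ N₂ K _ s t ihs iht =>
    obtain ⟨h1, h2⟩ := finite_sum.1 s.finite.1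
    obtain ⟨h3, h4⟩ := finite_sum.1 t.finite.2
    have := s.finite.2
    have := t.finite.1
    have := Fintype.ofFinite K
    rw [eval_comp]
    refine Finset.sum_eq_zero fun z _ => ?_
    by_cases hs : totalContent (Sum.elim (X ∘ Sum.inl) z) = totalContent (Y ∘ Sum.inl)
    · by_cases ht : totalContent (X ∘ Sum.inr) = totalContent (Sum.elim z (Y ∘ Sum.inr))
      · refine absurd ?_ h
        rw [totalContent_sum] at hs ht
        rw [totalContent_sum X, totalContent_sum Y, ht, ← hs]
        simp only [Sum.elim_comp_inl, Sum.elim_comp_inr]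
        abel
      · rw [iht _ _ ht, mul_zero]
    · rw [ihs _ _ hs, zero_mul]

/-- A linear functional of the matrix coefficients of all composites of genus `β`. -/
def matrixCoeff (β : ℕ) {A B : Type} (X : A → Letter) (Y : B → Letter) (ψ : Grass →+ ℝ) :
    Composite A B → ℝ := fun t => if t.genus = β then ψ (eval t X Y) else 0

/-- The span of the matrix coefficients whose inputs have total content at most `(2, 1)`, the
range in which the axioms of a Lie bialgebra hold. -/
def coeffSpace (β : ℕ) (A B : Type) : Submodule ℝ (Composite A B → ℝ) :=
  Submodule.span ℝ {f | ∃ X Y ψ, totalContent X ≤ (2, 1) ∧ f = matrixCoeff β X Y ψ}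

theorem matrixCoeff_mem {β : ℕ} {A B : Type} {X : A → Letter} (Y : B → Letter) (ψ : Grass →+ ℝ)
    (h : totalContent X ≤ (2, 1)) : matrixCoeff β X Y ψ ∈ coeffSpace β A B :=
  Submodule.subset_span ⟨X, Y, ψ, h, rfl⟩

theorem isSubcoproperad_coeffSpace : IsSubcoproperad coeffSpace where
  le_cofree := by
    intro β A B
    refine Submodule.span_le.2 ?_
    rintro _ ⟨X, Y, ψ, -, rfl⟩
    refine ⟨fun ε s t h => ?_, fun t h => ?_⟩
    · simp only [matrixCoeff, h.genus_eq, eval_cong h]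
      split_ifs
      · rw [← zsmul_eq_mul, map_zsmul, zsmul_eq_mul]
      · simp
    · by_contra h'
      exact h (if_neg h')
  relabel_mem := by
    intro β A A' B B' e e' x hx
    have : coeffSpace β A B ≤
        (coeffSpace β A' B').comap (LinearMap.funLeft ℝ ℝ (Composite.relabel e e')) := by
      refine Submodule.span_le.2 ?_
      rintro _ ⟨X, Y, ψ, h, rfl⟩
      exact matrixCoeff_mem (Y ∘ e') ψ (by rwa [totalContent_comp_equiv])
    exact this hx
  lower_slice_mem := by
    intro β β₂ M₁ M₂ N₁ N₂ K _ x s hx hβ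
    classical
    have : coeffSpace β (M₁ ⊕ M₂) (N₁ ⊕ N₂) ≤ (coeffSpace β₂ M₂ (K ⊕ N₂)).comap
        (LinearMap.funLeft ℝ ℝ (Composite.comp (N₂ := N₂) s)) := by
      refine Submodule.span_le.2 ?_
      rintro _ ⟨X, Y, ψ, h, rfl⟩
      by_cases hM : Finite M₂
      · obtain ⟨_, _⟩ := finite_sum.1 s.finite.1
        have := Fintype.ofFinite K
        rw [totalContent_sum] at h
        have : (LinearMap.funLeft ℝ ℝ (Composite.comp s)) (matrixCoeff β X Y ψ) =
            ∑ z : K → Letter, matrixCoeff β₂ (X ∘ Sum.inr) (Sum.elim z (Y ∘ Sum.inr))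
              (ψ.comp (AddMonoidHom.mulLeft
                (eval s (Sum.elim (X ∘ Sum.inl) z) (Y ∘ Sum.inl)))) := by
          funext t
          have : (s.comp t).genus = β ↔ t.genus = β₂ := by
            rw [Composite.genus]; omega
          rw [Finset.sum_apply]
          simp only [matrixCoeff, LinearMap.funLeft_apply, this, eval_comp]
          split_ifs
          · rw [map_sum]; rfl
          · simp
        rw [SetLike.mem_coe, Submodule.mem_comap, this]
        exact Submodule.sum_mem _ fun z _ => matrixCoeff_mem _ _ (le_trans (by simp) h)
      · have : LinearMap.funLeft ℝ ℝ (Composite.comp (N₂ := N₂) s) (matrixCoeff β X Y ψ) = 0 := by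
          funext t
          exact absurd t.finite.1 hM
        rw [SetLike.mem_coe, Submodule.mem_comap, this]
        exact Submodule.zero_mem _
    exact this hx
  upper_slice_mem := by
    intro β β₁ M₁ M₂ N₁ N₂ K _ x t hx hβ
    classical
    have : coeffSpace β (M₁ ⊕ M₂) (N₁ ⊕ N₂) ≤ (coeffSpace β₁ (M₁ ⊕ K) N₁).comap
        (LinearMap.funLeft ℝ ℝ (fun s => Composite.comp (M₁ := M₁) s t)) := by
      refine Submodule.span_le.2 ?_
      rintro _ ⟨X, Y, ψ, h, rfl⟩
      by_cases hM : Finite M₁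
      · obtain ⟨_, _⟩ := finite_sum.1 t.finite.2
        have := t.finite.1
        have := Fintype.ofFinite K
        rw [totalContent_sum] at h
        have : (LinearMap.funLeft ℝ ℝ (fun s => Composite.comp s t)) (matrixCoeff β X Y ψ) =
            ∑ z : K → Letter, matrixCoeff β₁ (Sum.elim (X ∘ Sum.inl) z) (Y ∘ Sum.inl)
              (ψ.comp (AddMonoidHom.mulRight
                (eval t (X ∘ Sum.inr) (Sum.elim z (Y ∘ Sum.inr))))) := by
          funext s
          have : (s.comp t).genus = β ↔ s.genus = β₁ := by
            rw [Composite.genus]; omega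
          rw [Finset.sum_apply]
          simp only [matrixCoeff, LinearMap.funLeft_apply, this, eval_comp]
          split_ifs
          · rw [map_sum]; rfl
          · simp
        rw [SetLike.mem_coe, Submodule.mem_comap, this]
        refine Submodule.sum_mem _ fun z _ => ?_
        by_cases hz : totalContent (X ∘ Sum.inr) = totalContent (Sum.elim z (Y ∘ Sum.inr))
        · refine matrixCoeff_mem _ _ (le_trans ?_ h)
          rw [hz, totalContent_sum, totalContent_sum]
          simp only [Sum.elim_comp_inl, Sum.elim_comp_inr]
          exact add_le_add_right (by simp) _
        · convert Submodule.zero_mem _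
          funext s
          simp [matrixCoeff, eval_eq_zero t _ _ hz]
      · have : LinearMap.funLeft ℝ ℝ (fun s => Composite.comp (M₁ := M₁) s t)
            (matrixCoeff β X Y ψ) = 0 := by
          funext s
          exact absurd (finite_sum.1 s.finite.1).1 hM
        rw [SetLike.mem_coe, Submodule.mem_comap, this]
        exact Submodule.zero_mem _
    exact this hx

instance : DecidableEq Grass := fun _ _ => decidable_of_iff _ QuaternionAlgebra.ext_iff.symm

theorem eval_multMult (X : Fin 3 → Letter) (Y : Fin 1 → Letter) :
    eval multMult X Y = ∑ z, gmul (X 0) z (Y 0) * gmul (X 1) (X 2) z := by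
  rw [multMult, compFin, eval_relabel, eval_comp]
  exact Fintype.sum_equiv (Equiv.funUnique (Fin 1) Letter) _ _ fun z => rfl

theorem eval_comultComult (X : Fin 1 → Letter) (Y : Fin 3 → Letter) :
    eval comultComult X Y =
      ((∑ z, cobracket z (Y 0) (Y 1) * cobracket (X 0) z (Y 2) : ℤ) : Grass) := by
  rw [comultComult, compFin, eval_relabel, eval_comp]
  push_cast
  exact Fintype.sum_equiv (Equiv.funUnique (Fin 1) Letter) _ _ fun z => rfl

theorem eval_comultMult (X : Fin 2 → Letter) (Y : Fin 2 → Letter) :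
    eval comultMult X Y = ∑ z, (cobracket z (Y 0) (Y 1) : Grass) * gmul (X 0) (X 1) z := by
  rw [comultMult, compFin, eval_relabel, eval_comp]
  exact Fintype.sum_equiv (Equiv.funUnique (Fin 1) Letter) _ _ fun z => rfl

theorem eval_zigzag (X : Fin 2 → Letter) (Y : Fin 2 → Letter) :
    eval zigzag X Y = ∑ z, gmul (X 0) z (Y 0) * (cobracket (X 1) z (Y 1) : Grass) := by
  rw [zigzag, compFin, eval_relabel, eval_comp]
  exact Fintype.sum_equiv (Equiv.funUnique (Fin 1) Letter) _ _ fun z => rfl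

/-- The Jacobi identity for the odd bracket, in the range of contents that is used. -/
theorem gmul_jacobi : ∀ x₁ x₂ : Letter, content x₁ + content x₂ ≤ (2, 1) →
    ∀ x₃ : Letter, content x₁ + content x₂ + content x₃ ≤ (2, 1) → ∀ y₁ : Letter,
    ∑ z, gmul x₁ z y₁ * gmul x₂ x₃ z + ∑ z, gmul x₂ z y₁ * gmul x₃ x₁ z +
      ∑ z, gmul x₃ z y₁ * gmul x₁ x₂ z = 0 := by
  decide +kernel

/-- The dual Jacobi identity for the cobracket. -/
theorem cobracket_jacobi : ∀ x₁ y₁ : Letter, content y₁ ≤ content x₁ →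
    ∀ y₂ : Letter, content y₁ + content y₂ ≤ content x₁ →
    ∀ y₃ : Letter, content x₁ = content y₁ + content y₂ + content y₃ →
    ∑ z, cobracket z y₁ y₂ * cobracket x₁ z y₃ + ∑ z, cobracket z y₂ y₃ * cobracket x₁ z y₁ +
      ∑ z, cobracket z y₃ y₁ * cobracket x₁ z y₂ = 0 := by
  decide +kernel

/-- The cobracket is a derivation of the bracket, in the range of contents that is used. -/
theorem gmul_cobracket : ∀ x₁ x₂ : Letter, content x₁ + content x₂ ≤ (2, 1) →
    ∀ y₁ y₂ : Letter, content x₁ + content x₂ = content y₁ + content y₂ →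
    ∑ z, (cobracket z y₁ y₂ : Grass) * gmul x₁ x₂ z =
      ∑ z, gmul x₁ z y₁ * (cobracket x₂ z y₂ : Grass) +
        ∑ z, gmul x₂ z y₁ * (cobracket x₁ z y₂ : Grass) -
        ∑ z, gmul x₁ z y₂ * (cobracket x₂ z y₁ : Grass) -
        ∑ z, gmul x₂ z y₂ * (cobracket x₁ z y₁ : Grass) := by
  decide +kernel

theorem weightTwoInRelations_coeffSpace : WeightTwoInRelations coeffSpace where
  assoc := by
    intro f hf
    induction hf using Submodule.span_induction with
    | zero => simp [IsAssocRelation]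
    | add f g _ _ hf hg =>
      simp only [IsAssocRelation, Pi.add_apply] at *
      linarith
    | smul c f _ hf =>
      simp only [IsAssocRelation, Pi.smul_apply, smul_eq_mul] at *
      rw [← mul_add, ← mul_add, hf, mul_zero]
    | mem f hf =>
      obtain ⟨X, Y, ψ, h, rfl⟩ := hf
      have h0 : multMult.genus = 0 := by simp [multMult, compFin, genus]
      rw [totalContent_eq, Fin.sum_univ_three] at h
      simp only [IsAssocRelation, matrixCoeff, genus, h0, if_true, eval_relabel, eval_multMult]
      rw [← map_add, ← map_add]
      convert map_zero ψ
      exact gmul_jacobi _ _ (le_trans (by simp) h) _ h _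
  coassoc := by
    intro f hf
    induction hf using Submodule.span_induction with
    | zero => simp [IsCoassocRelation]
    | add f g _ _ hf hg =>
      simp only [IsCoassocRelation, Pi.add_apply] at *
      linarith
    | smul c f _ hf =>
      simp only [IsCoassocRelation, Pi.smul_apply, smul_eq_mul] at *
      rw [← mul_add, ← mul_add, hf, mul_zero]
    | mem f hf =>
      obtain ⟨X, Y, ψ, h, rfl⟩ := hf
      have h0 : comultComult.genus = 0 := by simp [comultComult, compFin, genus]
      simp only [IsCoassocRelation, matrixCoeff, genus, h0, if_true]
      rw [← map_add, ← map_add]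
      convert map_zero ψ
      by_cases hXY : totalContent X = totalContent Y
      · simp only [eval_relabel, eval_comultComult]
        rw [totalContent_eq, totalContent_eq, Fin.sum_univ_three, Fin.sum_univ_one] at hXY
        exact_mod_cast congrArg (Int.cast : ℤ → Grass)
          (cobracket_jacobi _ _ (by rw [hXY, add_assoc]; simp) _ (by rw [hXY]; simp) _ hXY)
      · rw [eval_relabel, eval_relabel, eval_eq_zero _ _ _ hXY, eval_eq_zero, eval_eq_zero]
        · simp
        · rwa [totalContent_comp_equiv, totalContent_comp_equiv]
        · rwa [totalContent_comp_equiv, totalContent_comp_equiv]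
  frob := by
    intro f hf
    induction hf using Submodule.span_induction with
    | zero => simp [IsFrobRelation]
    | add f g _ _ hf hg =>
      simp only [IsFrobRelation, Pi.add_apply] at *
      linarith
    | smul c f _ hf =>
      simp only [IsFrobRelation, Pi.smul_apply, smul_eq_mul] at *
      rw [hf]; ring
    | mem f hf =>
      obtain ⟨X, Y, ψ, h, rfl⟩ := hf
      have h0 : comultMult.genus = 0 := by simp [comultMult, compFin, genus]
      have h1 : zigzag.genus = 0 := by simp [zigzag, compFin, genus]
      simp only [IsFrobRelation, matrixCoeff, genus, h0, h1, if_true]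
      rw [← map_add, ← map_sub, ← map_sub]
      congr 1
      by_cases hXY : totalContent X = totalContent Y
      · simp only [eval_relabel, eval_comultMult, eval_zigzag]
        rw [totalContent_eq, totalContent_eq, Fin.sum_univ_two, Fin.sum_univ_two] at hXY
        rw [totalContent_eq, Fin.sum_univ_two] at h
        exact gmul_cobracket _ _ h _ _ hXY
      · simp only [eval_relabel]
        rw [eval_eq_zero, eval_eq_zero, eval_eq_zero, eval_eq_zero, eval_eq_zero]
        · simp
        all_goals simpa only [totalContent_comp_equiv]

/-- Matrix coefficients of a Lie bialgebra with odd bracket belong to the quadratic dual, since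
the axioms of such bialgebras are orthogonal to the relations of `Frob₁`. -/
theorem coeffSpace_le (β : ℕ) (A B : Type) : coeffSpace β A B ≤ quadraticDual β A B :=
  le_quadraticDual isSubcoproperad_coeffSpace weightTwoInRelations_coeffSpace β A B

/-- The coefficient of `1`, `i`, `j` or `k`. -/
def component (i : Fin 4) : Grass →+ ℝ :=
  (Int.castAddHom ℝ).comp
    { toFun := fun q => ![q.re, q.imI, q.imJ, q.imK] i
      map_zero' := by fin_cases i <;> rfl
      map_add' := fun p q => by fin_cases i <;> rfl }

theorem component_mul (p q : Grass) :
    component 3 (p * q) = component 0 p * component 3 q + component 3 p * component 0 q +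
      component 1 p * component 2 q - component 2 p * component 1 q := by
  simp [component]
  ring

/-- The sum, over the colourings of the internal edges, that evaluates `genusTwoGraph` between
`x` and `y`. -/
theorem eval_genusTwoGraph_aux :
    ∑ z₁ : Letter, ∑ z₂ : Letter, ∑ z₃ : Letter,
      (∑ z, gmul z₁ z .y * gmul z₂ z₃ z) *
        ((∑ z, cobracket z z₁ z₂ * cobracket .x z z₃ : ℤ) : Grass) = ⟨0, 0, 0, 3⟩ := by
  decide +kernel

end

/-! ### The genus-two generator -/

section

open ShFrob.Letter (content cobracket prod₁ prod₂)

theorem eval_compFin_two (σ : Fin (0 + 1) ≃ Fin 1) (τ : Fin (1 + 0) ≃ Fin 1)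
    (s : Composite (Fin (0 + (2 + 1))) (Fin 1)) (t : Composite (Fin 1) (Fin ((2 + 1) + 0)))
    (c d : Letter) :
    eval (relabel σ τ (compFin 2 s t)) (fun _ => c) (fun _ => d) =
      ∑ z : Fin 3 → Letter, eval s z (fun _ => d) * eval t (fun _ => c) z := by
  rw [compFin, eval_relabel, eval_relabel, eval_comp]
  refine Finset.sum_congr rfl fun z _ => congrArg₂ (· * ·)
    (congrArg₂ (eval s) ?_ rfl) (congrArg₂ (eval t) rfl ?_)
  · funext i; fin_cases i <;> rfl
  · funext i; fin_cases i <;> rfl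

theorem eval_genusTwoGraph : eval genusTwoGraph (fun _ => .x) (fun _ => .y) = ⟨0, 0, 0, 3⟩ := by
  rw [← eval_genusTwoGraph_aux]
  refine (eval_compFin_two (Equiv.refl _) (Equiv.refl _) multMult comultComult .x .y).trans ?_
  simp only [← Fintype.sum_prod_type']
  refine Fintype.sum_equiv ((Fin.consEquiv fun _ => Letter).symm.trans
    ((Equiv.refl _).prodCongr (finTwoArrowEquiv Letter))) _ _ fun z => ?_
  exact congrArg₂ (· * ·) (eval_multMult _ _) (eval_comultComult _ _)

theorem totalContent_x : totalContent (fun _ : Fin 1 => Letter.x) ≤ (2, 1) := by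
  classical
  rw [totalContent_eq]; decide

/-- The normalised genus-two generator with one input and one output: a third of the component along
`k = i * j` of the matrix coefficient between the letters `x` and `y`. -/
def genusTwo : Gen 2 1 1 :=
  (1 / 3 : ℝ) • ⟨matrixCoeff 2 (fun _ => .x) (fun _ => .y) (component 3),
    coeffSpace_le _ _ _ (matrixCoeff_mem _ _ totalContent_x)⟩

theorem coeff_genusTwo {t : Composite (Fin 1) (Fin 1)} (ht : t.genus = 2) :
    coeff t genusTwo = (1 / 3 : ℝ) * component 3 (eval t (fun _ => .x) (fun _ => .y)) := by
  rw [genusTwo, map_smul]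
  simp [coeff, matrixCoeff, ht]

theorem coeff_genusTwoGraph_genusTwo : coeff genusTwoGraph genusTwo = 1 := by
  have hg : genusTwoGraph.genus = 2 := by
    simp [genusTwoGraph, multMult, comultComult, compFin, genus]
  rw [coeff_genusTwo hg]
  simp [eval_genusTwoGraph, component]

open scoped Classical in
/-- The lower factors of the decomposition of `genusTwo` over three internal edges, indexed by the
letters on the edges and the components of the lower coefficient. -/
def lowerFactor (i : (Fin 3 → Letter) × Fin 4) : Gen 0 3 1 :=
  if h : totalContent i.1 ≤ (2, 1) then
    ⟨matrixCoeff 0 i.1 (fun _ => .y) (component i.2), coeffSpace_le _ _ _ (matrixCoeff_mem _ _ h)⟩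
  else 0

/-- The upper factors of the decomposition of `genusTwo` over three internal edges. Components are
paired with those of `lowerFactor` so as to give the component of a product along `k`. -/
def upperFactor (i : (Fin 3 → Letter) × Fin 4) : Gen 0 1 3 :=
  (![1 / 3, 1 / 3, -(1 / 3), 1 / 3] i.2 : ℝ) •
    ⟨matrixCoeff 0 (fun _ => .x) i.1 (component (![3, 2, 1, 0] i.2)),
      coeffSpace_le _ _ _ (matrixCoeff_mem _ _ totalContent_x)⟩

theorem sum_coeff_lowerFactor_mul_coeff_upperFactor
    (σ : Fin (0 + 1) ≃ Fin 1) (τ : Fin (1 + 0) ≃ Fin 1)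
    {s : Composite (Fin (0 + (2 + 1))) (Fin 1)} {t : Composite (Fin 1) (Fin ((2 + 1) + 0))}
    (hs : s.genus = 0) (ht : t.genus = 0) :
    ∑ i, coeff s (lowerFactor i) * coeff t (upperFactor i) =
      coeff (relabel σ τ (compFin 2 s t)) genusTwo := by
  have hg : (relabel σ τ (compFin 2 s t)).genus = 2 := by
    rw [genus, genus_compFin, hs, ht]
  rw [coeff_genusTwo hg, eval_compFin_two, map_sum, Finset.mul_sum, Fintype.sum_prod_type]
  refine Finset.sum_congr rfl fun z _ => ?_
  have h2 : ∀ j, coeff t (upperFactor (z, j)) = (![1 / 3, 1 / 3, -(1 / 3), 1 / 3] j : ℝ) *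
      component (![3, 2, 1, 0] j) (eval t (fun _ => .x) z) := by
    intro j
    simp only [upperFactor, map_smul, smul_eq_mul]
    simp [coeff, matrixCoeff, ht]
  simp only [h2]
  by_cases hz : totalContent (fun _ : Fin 1 => Letter.x) = totalContent z
  · have h3 : ∀ j, coeff s (lowerFactor (z, j)) = component j (eval s z (fun _ => .y)) := by
      intro j
      simp only [lowerFactor]
      rw [dif_pos (hz ▸ totalContent_x)]
      simp [coeff, matrixCoeff, hs]
    simp only [h3, component_mul, Fin.sum_univ_four]
    simp
    ring
  · rw [eval_eq_zero t _ _ hz]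
    simp

end

/-! ### Matrices between tensor powers -/

section

namespace Op

variable {N : ℕ} [NeZero N]

/-- The matrix product: first `f`, then `g`. -/
def mul {m n p : ℕ} (f : Op N m n) (g : Op N n p) : Op N m p := fun x y => ∑ z, f x z * g z y

infixl:70 " ⊙ " => Op.mul

section Mul
variable {m n p q : ℕ}

theorem mul_assoc (f : Op N m n) (g : Op N n p) (h : Op N p q) : f ⊙ g ⊙ h = f ⊙ (g ⊙ h) :=
  Matrix.mul_assoc (Matrix.of f) (Matrix.of g) (Matrix.of h)

theorem mul_add (f : Op N m n) (g h : Op N n p) : f ⊙ (g + h) = f ⊙ g + f ⊙ h :=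
  Matrix.mul_add (Matrix.of f) (Matrix.of g) (Matrix.of h)

theorem add_mul (f g : Op N m n) (h : Op N n p) : (f + g) ⊙ h = f ⊙ h + g ⊙ h :=
  Matrix.add_mul (Matrix.of f) (Matrix.of g) (Matrix.of h)

theorem mul_sub (f : Op N m n) (g h : Op N n p) : f ⊙ (g - h) = f ⊙ g - f ⊙ h :=
  Matrix.mul_sub (Matrix.of f) (Matrix.of g) (Matrix.of h)

theorem sub_mul (f g : Op N m n) (h : Op N n p) : (f - g) ⊙ h = f ⊙ h - g ⊙ h :=
  Matrix.sub_mul (Matrix.of f) (Matrix.of g) (Matrix.of h)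

theorem mul_neg (f : Op N m n) (g : Op N n p) : f ⊙ (-g) = -(f ⊙ g) :=
  Matrix.mul_neg (Matrix.of f) (Matrix.of g)

theorem neg_mul (f : Op N m n) (g : Op N n p) : (-f) ⊙ g = -(f ⊙ g) :=
  Matrix.neg_mul (Matrix.of f) (Matrix.of g)

theorem mul_smul (c : ℝ) (f : Op N m n) (g : Op N n p) : f ⊙ (c • g) = c • (f ⊙ g) :=
  Matrix.mul_smul (Matrix.of f) c (Matrix.of g)

theorem smul_mul (c : ℝ) (f : Op N m n) (g : Op N n p) : (c • f) ⊙ g = c • (f ⊙ g) :=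
  Matrix.smul_mul c (Matrix.of f) (Matrix.of g)

theorem zero_mul (g : Op N n p) : (0 : Op N m n) ⊙ g = 0 := Matrix.zero_mul (Matrix.of g)

theorem mul_sum {I : Type*} (S : Finset I) (f : Op N m n) (g : I → Op N n p) :
    f ⊙ (∑ i ∈ S, g i) = ∑ i ∈ S, f ⊙ g i :=
  Matrix.mul_sum S (fun i => Matrix.of (g i)) (Matrix.of f)

theorem sum_mul {I : Type*} (S : Finset I) (f : I → Op N m n) (g : Op N n p) :
    (∑ i ∈ S, f i) ⊙ g = ∑ i ∈ S, f i ⊙ g :=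
  Matrix.sum_mul S (fun i => Matrix.of (f i)) (Matrix.of g)

end Mul

/-- The differential of the `n`-th tensor power, as an operation. -/
def d {n : ℕ} : Op N n n := tensorD

theorem bracketD_of_even {m n : ℕ} {f : Op N m n} {r : ℤ} (hf : f.IsHomogeneous r) (hr : Even r) :
    f.bracketD = f ⊙ d - d ⊙ f := by
  funext x y
  simp only [bracketD, mul, d, Pi.sub_apply]
  congr 1
  refine Finset.sum_congr rfl fun z _ => ?_
  by_cases h : f z y = 0
  · simp [h]
  · have := hf z y h
    have h' : Even (tensorDeg z + tensorDeg y) := by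
      rw [← Int.even_coe_nat]; push_cast
      have : (tensorDeg z + tensorDeg y : ℤ) = r + 2 * tensorDeg z := by omega
      rw [this]; exact hr.add (even_two_mul _)
    simp [h'.neg_one_pow]

theorem bracketD_of_odd {m n : ℕ} {f : Op N m n} {r : ℤ} (hf : f.IsHomogeneous r) (hr : Odd r) :
    f.bracketD = f ⊙ d + d ⊙ f := by
  funext x y
  simp only [bracketD, mul, d, Pi.add_apply]
  rw [sub_eq_add_neg, ← Finset.sum_neg_distrib]
  congr 1
  refine Finset.sum_congr rfl fun z _ => ?_
  by_cases h : f z y = 0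
  · simp [h]
  · have := hf z y h
    have h' : Odd (tensorDeg z + tensorDeg y) := by
      rw [← Int.odd_coe_nat]; push_cast
      have : (tensorDeg z + tensorDeg y : ℤ) = r + 2 * tensorDeg z := by omega
      rw [this]; exact hr.add_even (even_two_mul _)
    simp [h'.neg_one_pow]

theorem IsHomogeneous.mul {m n p : ℕ} {f : Op N m n} {g : Op N n p} {r s : ℤ}
    (hf : f.IsHomogeneous r) (hg : g.IsHomogeneous s) : (f ⊙ g).IsHomogeneous (r + s) := by
  intro x y h
  obtain ⟨z, -, hz⟩ := Finset.exists_ne_zero_of_sum_ne_zero h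
  have h1 := hf x z (left_ne_zero_of_mul hz)
  have h2 := hg z y (right_ne_zero_of_mul hz)
  omega

/-! ### Koszul signs -/

/-- A product over ordered pairs, regrouped into unordered pairs. -/
theorem prod_pairs {n : ℕ} (g : Fin n → Fin n → ℝ) (h : ∀ i, g i i = 1) :
    ∏ i, ∏ j, g i j = ∏ i, ∏ j, if i < j then g i j * g j i else 1 := by
  have h1 : ∀ i j, g i j = (if i < j then g i j else 1) * (if j < i then g i j else 1) := by
    intro i j
    rcases lt_trichotomy i j with hij | rfl | hij
    · simp [hij, hij.not_gt]
    · simp [h]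
    · simp [hij, hij.not_gt]
  have h2 : ∀ i j, (if i < j then g i j * g j i else 1) =
      (if i < j then g i j else 1) * (if i < j then g j i else 1) := by
    intro i j; split_ifs <;> simp
  simp_rw [h2, Finset.prod_mul_distrib]
  rw [Finset.prod_comm (f := fun i j => if i < j then g j i else 1)]
  simp_rw [← Finset.prod_mul_distrib, ← h1]

theorem neg_one_pow_mul_self (n : ℕ) : (-1 : ℝ) ^ n * (-1) ^ n = 1 := by
  rw [← pow_add, Even.neg_one_pow ⟨n, rfl⟩]

theorem koszulSign_mul_self {m m' : ℕ} (e : Fin m ≃ Fin m') (x : Fin m → Cell N) :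
    koszulSign e x * koszulSign e x = 1 := by
  simp only [koszulSign, ← Finset.prod_mul_distrib]
  refine Finset.prod_eq_one fun i _ => Finset.prod_eq_one fun j _ => ?_
  split_ifs
  · exact neg_one_pow_mul_self _
  · simp

theorem koszulSign_trans {m m' m'' : ℕ} (e : Fin m ≃ Fin m') (e' : Fin m' ≃ Fin m'')
    (x : Fin m → Cell N) :
    koszulSign (e.trans e') x = koszulSign e x * koszulSign e' (x ∘ e.symm) := by
  have h2 : koszulSign e' (x ∘ e.symm) = ∏ i, ∏ j,
      if i < j then ((if e i < e j ∧ e' (e j) < e' (e i) then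
        (-1 : ℝ) ^ (cellDeg (x i) * cellDeg (x j)) else 1) *
        (if e j < e i ∧ e' (e i) < e' (e j) then
        (-1 : ℝ) ^ (cellDeg (x j) * cellDeg (x i)) else 1)) else 1 := by
    rw [← prod_pairs (fun i j => if e i < e j ∧ e' (e j) < e' (e i) then
        (-1 : ℝ) ^ (cellDeg (x i) * cellDeg (x j)) else 1) (by simp), koszulSign, ← e.prod_comp]
    refine Finset.prod_congr rfl fun i _ => ?_
    rw [← e.prod_comp]
    simp
  rw [h2]
  simp only [koszulSign, ← Finset.prod_mul_distrib, Equiv.trans_apply]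
  refine Finset.prod_congr rfl fun i _ => Finset.prod_congr rfl fun j _ => ?_
  by_cases hij : i < j
  · have hne : e i ≠ e j := fun h => hij.ne (e.injective h)
    have hne' : e' (e i) ≠ e' (e j) := fun h => hne (e'.injective h)
    rw [Nat.mul_comm (cellDeg (x j))]
    rcases hne.lt_or_gt with h | h <;> rcases hne'.lt_or_gt with h' | h' <;>
      simp [hij, h, h', h.not_gt, h'.not_gt, neg_one_pow_mul_self]
  · simp [hij]

@[simp] theorem koszulSign_refl {m : ℕ} (x : Fin m → Cell N) :
    koszulSign (Equiv.refl (Fin m)) x = 1 := by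
  refine Finset.prod_eq_one fun i _ => Finset.prod_eq_one fun j _ => ?_
  rw [if_neg]
  exact fun h => absurd h.1 h.2.not_gt

theorem koszulSign_of_tensorDeg_le_one {m m' : ℕ} (e : Fin m ≃ Fin m') {x : Fin m → Cell N}
    (hx : tensorDeg x ≤ 1) : koszulSign e x = 1 := by
  refine Finset.prod_eq_one fun i _ => Finset.prod_eq_one fun j _ => ?_
  split_ifs with h
  · have : cellDeg (x i) + cellDeg (x j) ≤ 1 := by
      refine le_trans ?_ hx
      rw [← Finset.sum_pair (f := fun i => cellDeg (x i)) h.1.ne]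
      exact Finset.sum_le_sum_of_subset (Finset.subset_univ _)
    have : cellDeg (x i) * cellDeg (x j) = 0 := by
      rcases Nat.eq_zero_or_pos (cellDeg (x i)) with h | h
      · simp [h]
      · rw [Nat.mul_eq_zero]; omega
    simp [this]
  · rfl

theorem tensorDeg_comp_equiv {m m' : ℕ} (e : Fin m ≃ Fin m') (x : Fin m' → Cell N) :
    tensorDeg (x ∘ e) = tensorDeg x := e.sum_comp fun i => cellDeg (x i)

section Relabel

variable {m n p m' n' p' m'' n'' : ℕ}

theorem relabel_mul (σ : Fin m ≃ Fin m') (τ : Fin n ≃ Fin n') (ρ : Fin p ≃ Fin p')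
    (f : Op N m n) (g : Op N n p) :
    relabel σ ρ (f ⊙ g) = relabel σ τ f ⊙ relabel τ ρ g := by
  funext x y
  simp only [relabel, mul, Finset.mul_sum]
  refine Fintype.sum_equiv (τ.arrowCongr (Equiv.refl _)) _ _ fun z => ?_
  have h : (τ.arrowCongr (Equiv.refl (Cell N))) z ∘ τ = z := by funext i; simp
  have h' := koszulSign_mul_self τ z
  simp only [h]
  linear_combination (-(koszulSign σ (x ∘ σ) * koszulSign ρ (y ∘ ρ) * f (x ∘ σ) z * g z (y ∘ ρ))) *
    h'

theorem relabel_relabel (σ : Fin m ≃ Fin m') (τ : Fin n ≃ Fin n') (σ' : Fin m' ≃ Fin m'')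
    (τ' : Fin n' ≃ Fin n'') (f : Op N m n) :
    relabel σ' τ' (relabel σ τ f) = relabel (σ.trans σ') (τ.trans τ') f := by
  funext x y
  simp only [relabel, koszulSign_trans]
  have h1 : (x ∘ ⇑(σ.trans σ')) ∘ ⇑σ.symm = x ∘ σ' := by funext i; simp
  have h2 : (y ∘ ⇑(τ.trans τ')) ∘ ⇑τ.symm = y ∘ τ' := by funext i; simp
  rw [h1, h2]
  simp only [Function.comp_assoc, Equiv.coe_trans]
  ring

@[simp] theorem relabel_refl (f : Op N m n) : relabel (Equiv.refl _) (Equiv.refl _) f = f := by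
  funext x y
  simp [relabel]

theorem relabel_add (σ : Fin m ≃ Fin m') (τ : Fin n ≃ Fin n') (f g : Op N m n) :
    relabel σ τ (f + g) = relabel σ τ f + relabel σ τ g := by
  funext x y; simp [relabel, _root_.mul_add]

theorem relabel_smul (σ : Fin m ≃ Fin m') (τ : Fin n ≃ Fin n') (c : ℝ) (f : Op N m n) :
    relabel σ τ (c • f) = c • relabel σ τ f := by
  funext x y; simp [relabel]; ring

theorem relabel_neg (σ : Fin m ≃ Fin m') (τ : Fin n ≃ Fin n') (f : Op N m n) :
    relabel σ τ (-f) = -relabel σ τ f := by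
  funext x y; simp [relabel]

theorem relabel_sub (σ : Fin m ≃ Fin m') (τ : Fin n ≃ Fin n') (f g : Op N m n) :
    relabel σ τ (f - g) = relabel σ τ f - relabel σ τ g := by
  rw [sub_eq_add_neg, relabel_add, relabel_neg, sub_eq_add_neg]

theorem relabel_zero (σ : Fin m ≃ Fin m') (τ : Fin n ≃ Fin n') :
    relabel σ τ (0 : Op N m n) = 0 := by
  funext x y; simp [relabel]

theorem relabel_sum {I : Type*} (S : Finset I) (σ : Fin m ≃ Fin m') (τ : Fin n ≃ Fin n')
    (f : I → Op N m n) : relabel σ τ (∑ i ∈ S, f i) = ∑ i ∈ S, relabel σ τ (f i) := by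
  classical
  induction S using Finset.induction_on with
  | empty => simp [relabel_zero]
  | insert i S hi ih => rw [Finset.sum_insert hi, Finset.sum_insert hi, relabel_add, ih]

/-- If basic tensors `a` and `b` differ in the factor `i` alone, of degrees zero and one, then
their Koszul signs differ by the signs of moving a differential to the factor `i` before and
after the permutation. -/
theorem koszulSign_mul_of_agree (τ : Fin n ≃ Fin n') {a b : Fin n → Cell N} (i : Fin n)
    (hab : ∀ j, j ≠ i → a j = b j) (ha : cellDeg (a i) = 0) (hb : cellDeg (b i) = 1) :
    koszulSign τ a * koszulSign τ b * (-1) ^ (∑ j ∈ Finset.univ.filter (· < i), cellDeg (a j)) =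
      (-1) ^ (∑ j ∈ Finset.univ.filter (· < τ i), cellDeg (a (τ.symm j))) := by
  let F : Fin n → Fin n → ℝ := fun p q => if p < q ∧ τ q < τ p then
    (-1) ^ (cellDeg (a p) * cellDeg (a q) + cellDeg (b p) * cellDeg (b q)) else 1
  have h1 : koszulSign τ a * koszulSign τ b = ∏ j, F j i * F i j := by
    have hF : ∀ p q, F p q = (if q = i then F p i else 1) * (if p = i then F i q else 1) := by
      intro p q
      by_cases hp : p = i <;> by_cases hq : q = i
      · subst hp hq; simp [F]
      · subst hp; simp [hq]
      · subst hq; simp [hp]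
      · simp only [hp, hq, if_false, _root_.mul_one, F, hab p hp, hab q hq, pow_add,
          neg_one_pow_mul_self, ite_self]
    have h2 : ∏ p, ∏ q, F p q = koszulSign τ a * koszulSign τ b := by
      simp only [koszulSign, ← Finset.prod_mul_distrib]
      refine Finset.prod_congr rfl fun p _ => Finset.prod_congr rfl fun q _ => ?_
      simp only [F]
      split_ifs
      · rw [pow_add]
      · simp
    rw [← h2, Finset.prod_congr rfl fun p _ => Finset.prod_congr rfl fun q _ => hF p q]
    simp only [Finset.prod_mul_distrib, Finset.prod_ite_eq', Finset.mem_univ, if_true]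
    congr 1
    rw [Finset.prod_comm]
    simp
  rw [h1, ← Finset.prod_pow_eq_pow_sum, ← Finset.prod_pow_eq_pow_sum, Finset.prod_filter,
    Finset.prod_filter, ← τ.prod_comp, ← Finset.prod_mul_distrib]
  refine Finset.prod_congr rfl fun j _ => ?_
  by_cases hj : j = i
  · subst hj
    simp only [F, lt_irrefl, false_and, if_false, _root_.mul_one]
  · have hne' : τ j ≠ τ i := fun h => hj (τ.injective h)
    simp only [F, ha, hb, MulZeroClass.mul_zero, MulZeroClass.zero_mul, _root_.mul_one,
      _root_.one_mul, zero_add, ← hab j hj, Equiv.symm_apply_apply]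
    rcases lt_or_gt_of_ne hj with h | h <;> rcases hne'.lt_or_gt with h' | h' <;>
      simp [h, h', h.not_gt, h'.not_gt, neg_one_pow_mul_self]

/-- The differential of the tensor powers is equivariant. -/
theorem relabel_d (τ : Fin n ≃ Fin n') : relabel τ τ (d : Op N n n) = d := by
  funext x y
  simp only [relabel, d, tensorD, Finset.mul_sum]
  refine Fintype.sum_equiv τ _ _ fun i => ?_
  have hc : (∀ j, j ≠ i → (x ∘ τ) j = (y ∘ τ) j) ↔ ∀ j, j ≠ τ i → x j = y j := by
    refine ⟨fun h j hj => ?_, fun h j hj => h _ fun h' => hj (τ.injective h')⟩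
    simpa using h (τ.symm j) fun h' => hj (by rw [← h', Equiv.apply_symm_apply])
  by_cases h : ∀ j, j ≠ i → (x ∘ τ) j = (y ∘ τ) j
  · rw [if_pos h, if_pos (hc.1 h), ← _root_.mul_assoc]
    by_cases hx : cellDeg (x (τ i)) = 0 ∧ cellDeg (y (τ i)) = 1
    · rw [koszulSign_mul_of_agree τ i h hx.1 hx.2]
      simp
    · have : cellD (x (τ i)) (y (τ i)) = 0 := by
        rcases hx' : x (τ i) with v | v <;> rcases hy' : y (τ i) with w | w <;>
          simp_all [cellD, cellDeg]
      simp [this]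
  · rw [if_neg h, if_neg fun h' => h (hc.2 h'), MulZeroClass.mul_zero]

end Relabel

end Op

end

/-! ### Tensoring with the identity -/

section

namespace Op

variable {N : ℕ} [NeZero N]

/-- The operation `f ⊗ id`; it carries no sign since the identity is even. -/
def tensorLeft {m n : ℕ} (f : Op N m n) : Op N (m + 1) (n + 1) := fun x y =>
  if x (Fin.last m) = y (Fin.last n) then f (Fin.init x) (Fin.init y) else 0

/-- The operation `id ⊗ f`, with the Koszul sign of moving `f` past the first tensor factor. -/
def tensorRight {m n : ℕ} (f : Op N m n) : Op N (m + 1) (n + 1) := fun x y =>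
  if x 0 = y 0 then (-1) ^ ((tensorDeg (Fin.tail y) + tensorDeg (Fin.tail x)) * cellDeg (x 0)) *
    f (Fin.tail x) (Fin.tail y) else 0

theorem mul_tensorLeft_apply {m k n : ℕ} (g : Op N m (k + 1)) (f : Op N k n) (x : Fin m → Cell N)
    (y : Fin (n + 1) → Cell N) :
    (g ⊙ tensorLeft f) x y =
      ∑ z : Fin k → Cell N, g x (Fin.snoc z (y (Fin.last n))) * f z (Fin.init y) := by
  rw [mul, ← (Fin.snocEquiv fun _ => Cell N).sum_comp, Fintype.sum_prod_type, Finset.sum_comm]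
  simp [tensorLeft, Fin.snocEquiv, Fin.init_snoc]

theorem tensorRight_mul_apply {m k n : ℕ} (f : Op N m k) (g : Op N (k + 1) n)
    (x : Fin (m + 1) → Cell N) (y : Fin n → Cell N) :
    (tensorRight f ⊙ g) x y =
      ∑ z : Fin k → Cell N, (-1) ^ ((tensorDeg z + tensorDeg (Fin.tail x)) * cellDeg (x 0)) *
        f (Fin.tail x) z * g (Fin.cons (x 0) z) y := by
  rw [mul, ← (Fin.consEquiv fun _ => Cell N).sum_comp, Fintype.sum_prod_type, Finset.sum_comm]
  simp [tensorRight, Fin.consEquiv, Fin.tail_cons]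

theorem mul_tensorRight_apply {m k n : ℕ} (g : Op N m (k + 1)) (f : Op N k n) (x : Fin m → Cell N)
    (y : Fin (n + 1) → Cell N) :
    (g ⊙ tensorRight f) x y =
      ∑ z : Fin k → Cell N, g x (Fin.cons (y 0) z) *
        ((-1) ^ ((tensorDeg (Fin.tail y) + tensorDeg z) * cellDeg (y 0)) * f z (Fin.tail y)) := by
  rw [mul, ← (Fin.consEquiv fun _ => Cell N).sum_comp, Fintype.sum_prod_type, Finset.sum_comm]
  simp [tensorRight, Fin.consEquiv, Fin.tail_cons]

theorem tensorDeg_fin_zero (x : Fin 0 → Cell N) : tensorDeg x = 0 := rfl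

theorem tensorDeg_fin_one (x : Fin 1 → Cell N) : tensorDeg x = cellDeg (x 0) := by
  simp [tensorDeg]

section Comp

theorem comp_mul_121 (f : Op N 2 1) (g : Op N 1 2) :
    (Op.comp (k := 2) (m₁ := 0) (m₂ := 1) (n₁ := 1) (n₂ := 0) f g : Op N 1 1) = g ⊙ f := by
  funext x y
  simp only [Op.comp, mul]
  refine Finset.sum_congr rfl fun z _ => ?_
  rw [tensorDeg_fin_zero (N := N) (x ∘ Fin.castAdd 1), MulZeroClass.mul_zero, pow_zero,
    _root_.one_mul, _root_.mul_comm]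
  refine congrArg₂ (· * ·) (congrArg₂ g ?_ ?_) (congrArg₂ f ?_ ?_) <;>
    (funext i; fin_cases i <;> rfl)

theorem comp_mul_131 (f : Op N 3 1) (g : Op N 1 3) :
    (Op.comp (k := 3) (m₁ := 0) (m₂ := 1) (n₁ := 1) (n₂ := 0) f g : Op N 1 1) = g ⊙ f := by
  funext x y
  simp only [Op.comp, mul]
  refine Finset.sum_congr rfl fun z _ => ?_
  rw [tensorDeg_fin_zero (N := N) (x ∘ Fin.castAdd 1), MulZeroClass.mul_zero, pow_zero,
    _root_.one_mul, _root_.mul_comm]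
  refine congrArg₂ (· * ·) (congrArg₂ g ?_ ?_) (congrArg₂ f ?_ ?_) <;>
    (funext i; fin_cases i <;> rfl)

theorem comp_mul_221 (f : Op N 2 1) (g : Op N 2 2) :
    (Op.comp (k := 2) (m₁ := 0) (m₂ := 2) (n₁ := 1) (n₂ := 0) f g : Op N 2 1) = g ⊙ f := by
  funext x y
  simp only [Op.comp, mul]
  refine Finset.sum_congr rfl fun z _ => ?_
  rw [tensorDeg_fin_zero (N := N) (x ∘ Fin.castAdd 2), MulZeroClass.mul_zero, pow_zero,
    _root_.one_mul, _root_.mul_comm]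
  refine congrArg₂ (· * ·) (congrArg₂ g ?_ ?_) (congrArg₂ f ?_ ?_) <;>
    (funext i; fin_cases i <;> rfl)

theorem comp_mul_122 (f : Op N 2 2) (g : Op N 1 2) :
    (Op.comp (k := 2) (m₁ := 0) (m₂ := 1) (n₁ := 2) (n₂ := 0) f g : Op N 1 2) = g ⊙ f := by
  funext x y
  simp only [Op.comp, mul]
  refine Finset.sum_congr rfl fun z _ => ?_
  rw [tensorDeg_fin_zero (N := N) (x ∘ Fin.castAdd 1), MulZeroClass.mul_zero, pow_zero,
    _root_.one_mul, _root_.mul_comm]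
  refine congrArg₂ (· * ·) (congrArg₂ g ?_ ?_) (congrArg₂ f ?_ ?_) <;>
    (funext i; fin_cases i <;> rfl)

theorem comp_mul_212 (f : Op N 1 2) (g : Op N 2 1) :
    (Op.comp (k := 1) (m₁ := 0) (m₂ := 2) (n₁ := 2) (n₂ := 0) f g : Op N 2 2) = g ⊙ f := by
  funext x y
  simp only [Op.comp, mul]
  refine Finset.sum_congr rfl fun z _ => ?_
  rw [tensorDeg_fin_zero (N := N) (x ∘ Fin.castAdd 2), MulZeroClass.mul_zero, pow_zero,
    _root_.one_mul, _root_.mul_comm]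
  refine congrArg₂ (· * ·) (congrArg₂ g ?_ ?_) (congrArg₂ f ?_ ?_) <;>
    (funext i; fin_cases i <;> rfl)

theorem comp_tensorLeft_13 (f : Op N 1 2) (g : Op N 1 2) :
    (Op.comp (k := 1) (m₁ := 0) (m₂ := 1) (n₁ := 2) (n₂ := 1) f g : Op N 1 3) =
      g ⊙ tensorLeft f := by
  funext x y
  rw [mul_tensorLeft_apply]
  simp only [Op.comp]
  refine Finset.sum_congr rfl fun z _ => ?_
  rw [tensorDeg_fin_zero (N := N) (x ∘ Fin.castAdd 1), MulZeroClass.mul_zero, pow_zero,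
    _root_.one_mul, _root_.mul_comm]
  refine congrArg₂ (· * ·) (congrArg₂ g ?_ ?_) (congrArg₂ f ?_ ?_) <;>
    (funext i; fin_cases i <;> rfl)

theorem comp_tensorLeft_12 (f : Op N 2 1) (g : Op N 1 3) :
    (Op.comp (k := 2) (m₁ := 0) (m₂ := 1) (n₁ := 1) (n₂ := 1) f g : Op N 1 2) =
      g ⊙ tensorLeft f := by
  funext x y
  rw [mul_tensorLeft_apply]
  simp only [Op.comp]
  refine Finset.sum_congr rfl fun z _ => ?_
  rw [tensorDeg_fin_zero (N := N) (x ∘ Fin.castAdd 1), MulZeroClass.mul_zero, pow_zero,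
    _root_.one_mul, _root_.mul_comm]
  refine congrArg₂ (· * ·) (congrArg₂ g ?_ ?_) (congrArg₂ f ?_ ?_) <;>
    (funext i; fin_cases i <;> rfl)

theorem comp_tensorRight_31 (f : Op N 2 1) (g : Op N 2 1) :
    (Op.comp (k := 1) (m₁ := 1) (m₂ := 2) (n₁ := 1) (n₂ := 0) f g : Op N 3 1) =
      tensorRight g ⊙ f := by
  funext x y
  rw [tensorRight_mul_apply]
  simp only [Op.comp]
  refine Finset.sum_congr rfl fun z _ => ?_
  rw [tensorDeg_fin_zero (N := N) (y ∘ Fin.natAdd 1), add_zero,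
    tensorDeg_fin_one (N := N) (x ∘ Fin.castAdd 2), _root_.mul_assoc, _root_.mul_comm (f _ _)]
  refine congrArg₂ (· * ·) ?_ (congrArg₂ (· * ·) (congrArg₂ g ?_ ?_) (congrArg₂ f ?_ ?_))
  · rfl
  all_goals (funext i; fin_cases i <;> rfl)

theorem comp_tensorRight_21 (f : Op N 3 1) (g : Op N 1 2) :
    (Op.comp (k := 2) (m₁ := 1) (m₂ := 1) (n₁ := 1) (n₂ := 0) f g : Op N 2 1) =
      tensorRight g ⊙ f := by
  funext x y
  rw [tensorRight_mul_apply]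
  simp only [Op.comp]
  refine Finset.sum_congr rfl fun z _ => ?_
  rw [tensorDeg_fin_zero (N := N) (y ∘ Fin.natAdd 1), add_zero,
    tensorDeg_fin_one (N := N) (x ∘ Fin.castAdd 1), _root_.mul_assoc, _root_.mul_comm (f _ _)]
  refine congrArg₂ (· * ·) ?_ (congrArg₂ (· * ·) (congrArg₂ g ?_ ?_) (congrArg₂ f ?_ ?_))
  · rfl
  all_goals (funext i; fin_cases i <;> rfl)

theorem comp_zigzag (f : Op N 2 1) (g : Op N 1 2) :
    (Op.comp (k := 1) (m₁ := 1) (m₂ := 1) (n₁ := 1) (n₂ := 1) f g : Op N 2 2) =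
      tensorRight g ⊙ tensorLeft f := by
  funext x y
  rw [mul_tensorLeft_apply (N := N) (k := 2) (n := 1), ← (Fin.consEquiv fun _ => Cell N).sum_comp,
    Fintype.sum_prod_type]
  rw [Finset.sum_comm]
  simp only [Op.comp]
  refine Finset.sum_congr rfl fun z _ => ?_
  rw [Finset.sum_eq_single (x 0)]
  · rw [tensorRight]
    rw [if_pos (by rfl), _root_.mul_assoc, _root_.mul_comm (f _ _)]
    refine congrArg₂ (· * ·) ?_ (congrArg₂ (· * ·) (congrArg₂ g ?_ ?_) (congrArg₂ f ?_ ?_))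
    · rw [tensorDeg_fin_one (N := N) (x ∘ Fin.castAdd 1)]
      refine congrArg₂ (· ^ ·) rfl (congrArg₂ (· * ·) (congrArg₂ (· + ·) ?_ rfl) rfl)
      simp [tensorDeg, Fin.sum_univ_two, Fin.consEquiv, Fin.tail, Fin.snoc]
    all_goals (funext i; fin_cases i <;> rfl)
  · intro w _ hw
    rw [tensorRight, if_neg, MulZeroClass.zero_mul]
    exact fun h => hw h.symm
  · simp

end Comp

end Op

end

/-! ### Vanishing in genus one and arity `(1, 1)` -/

section

theorem Composite.nonempty {A B : Type} (t : Composite A B) : Nonempty A ∧ Nonempty B := by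
  induction t with
  | mult => exact ⟨inferInstance, inferInstance⟩
  | comult => exact ⟨inferInstance, inferInstance⟩
  | relabel e e' t ih => exact ⟨ih.1.map e, ih.2.map e'⟩
  | comp s t ihs iht => exact ⟨iht.1.map Sum.inr, ihs.2.map Sum.inl⟩

/-- A comultiplication followed by a multiplication along two edges equals its own negative:
exchange the two edges and use commutativity and anticommutativity. -/
theorem Cong.neg_one_of_genus_one {A B : Type} (t : Composite A B) (h : t.genus = 1)
    (h₁ : t.numMult = 1) (h₂ : t.numComult = 1) : Cong (-1) t t := by
  induction t with
  | mult => simp [numComult] at h₂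
  | comult => simp [numMult] at h₁
  | relabel e e' t ih => exact Cong.relabel e e' (ih h h₁ h₂)
  | @comp M₁ M₂ N₁ N₂ K _ s t _ _ =>
    classical
    have hs := s.one_le_weight
    have ht := t.one_le_weight
    have hs1 := s.numMult_add_one
    have hs2 := s.numComult_add_one
    have ht1 := t.numMult_add_one
    have ht2 := t.numComult_add_one
    have := (finite_sum.1 s.finite.1).1
    have := (finite_sum.1 s.finite.1).2
    have := (finite_sum.1 t.finite.2).2
    have := t.finite.1
    have := s.finite.2
    have hc1 : 0 < Nat.card M₂ := @Nat.card_pos _ t.nonempty.1 _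
    have hc2 : 0 < Nat.card N₁ := @Nat.card_pos _ s.nonempty.2 _
    have hc3 : 0 < Nat.card K := Nat.card_pos
    simp only [numMult, numComult, genus] at h h₁ h₂
    rw [Nat.card_sum] at hs1 ht2
    have hK : Nat.card K = 2 := by omega
    have hM : Nat.card M₁ = 0 := by omega
    have hN : Nat.card N₂ = 0 := by omega
    have : IsEmpty M₁ := by
      rcases (Nat.card_eq_zero.1 hM) with h | h
      · exact h
      · exact absurd h (by simpa using ‹Finite M₁›)
    have : IsEmpty N₂ := by
      rcases (Nat.card_eq_zero.1 hN) with h | h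
      · exact h
      · exact absurd h (by simpa using ‹Finite N₂›)
    let κ₀ : Fin 2 ≃ K := (Finite.equivFinOfCardEq hK).symm
    let κ : K ≃ K := κ₀.symm.trans ((Equiv.swap 0 1).trans κ₀)
    have hsw : ∀ e : Fin 2 ≃ K, e.trans κ = (Equiv.swap 0 1).trans e := by
      intro e
      obtain ⟨p, rfl⟩ : ∃ p : Equiv.Perm (Fin 2), e = p.trans κ₀ := ⟨e.trans κ₀.symm, by ext; simp⟩
      rcases perm_fin_two p with rfl | rfl <;> ext <;> simp [κ]
    have hs' : Cong 1 (Composite.relabel ((Equiv.refl M₁).sumCongr κ) (Equiv.refl N₁) s) s := by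
      rcases Cong.of_weight_one s (by omega) with ⟨e, e', H⟩ | ⟨e, e', H⟩
      · have h1 : e.trans ((Equiv.refl M₁).sumCongr κ) = (Equiv.swap 0 1).trans e := by
          have := hsw (e.trans (Equiv.emptySum M₁ K))
          ext i
          have h2 := DFunLike.congr_fun this i
          simp only [Equiv.trans_apply] at h2 ⊢
          rcases h3 : e i with x | x
          · exact isEmptyElim x
          rcases h4 : e (Equiv.swap 0 1 i) with y | y
          · exact isEmptyElim y
          rw [h3, h4] at h2
          simpa using h2
        have H1 := (Cong.relabel ((Equiv.refl M₁).sumCongr κ) (Equiv.refl N₁) H).trans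
          (Cong.relabel_trans _ _ _ _ _)
        rw [h1] at H1
        have H2 := (Cong.relabel_trans (Equiv.swap 0 1) e (Equiv.refl _) e'
          Composite.mult).symm.trans
          (Cong.relabel e e' Cong.mult_comm)
        simpa using (H1.trans H2).trans H.symm
      · have := Nat.card_congr e
        simp [hK] at this
    have ht' : Cong (-1) (Composite.relabel (Equiv.refl M₂) (κ.sumCongr (Equiv.refl N₂)) t) t := by
      rcases Cong.of_weight_one t (by omega) with ⟨e, e', H⟩ | ⟨e, e', H⟩
      · have := Nat.card_congr e'
        simp [hK] at this
      · have h1 : e'.trans (κ.sumCongr (Equiv.refl N₂)) = (Equiv.swap 0 1).trans e' := by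
          have := hsw (e'.trans (Equiv.sumEmpty K N₂))
          ext i
          have h2 := DFunLike.congr_fun this i
          simp only [Equiv.trans_apply] at h2 ⊢
          rcases h3 : e' i with x | x
          swap
          · exact isEmptyElim x
          rcases h4 : e' (Equiv.swap 0 1 i) with y | y
          swap
          · exact isEmptyElim y
          rw [h3, h4] at h2
          simpa using h2
        have H1 := (Cong.relabel (Equiv.refl M₂) (κ.sumCongr (Equiv.refl N₂)) H).trans
          (Cong.relabel_trans _ _ _ _ _)
        rw [h1] at H1
        have H2 := (Cong.relabel_trans (Equiv.refl _) e (Equiv.swap 0 1) e'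
          Composite.comult).symm.trans
          (Cong.relabel e e' Cong.comult_anticomm)
        simpa using (H1.trans H2).trans H.symm
    have H := Cong.comp_relabel (Equiv.refl M₁) (Equiv.refl M₂) (Equiv.refl N₁) (Equiv.refl N₂) κ s
      t
    have H' := (Cong.comp hs' ht').symm.trans H
    rw [Equiv.sumCongr_refl, Equiv.sumCongr_refl] at H'
    simpa using H'.trans (Cong.relabel_refl _)

theorem Cong.neg_one_of_fin_one (t : Composite (Fin 1) (Fin 1)) (h : t.genus = 1) :
    Cong (-1) t t := by
  have h1 := t.numMult_add_one
  have h2 := t.numComult_add_one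
  simp only [Nat.card_eq_fintype_card, Fintype.card_fin] at h1 h2
  exact Cong.neg_one_of_genus_one t h (by omega) (by omega)

theorem coeff_eq_zero_of_cong_neg {β m n : ℕ} (q : Gen β m n) {t : Composite (Fin m) (Fin n)}
    (h : Cong (-1) t t) : coeff t q = 0 := by
  have := coeff_eq_of_cong q h
  simp at this
  linarith

end

/-! ### Derivatives of the homotopies for the relations -/

section

/-- The decompositions of the homotopy `q` for associativity: products of two multiplications. -/
def decAssoc (μ : Gen 0 2 1) (q : Gen 0 3 1) : Decomposition 3 1
  | 0, 0, 0, 1, 2, 1, 0, σ, τ => coeff (relabel σ τ multMult) q • (μ ⊗ₜ[ℝ] μ)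
  | _, _, _, _, _, _, _, _, _ => 0

theorem isDecomposition_decAssoc {μ : Gen 0 2 1} (hμ : coeff mult μ = 1) (q : Gen 0 3 1) :
    IsDecomposition q (decAssoc μ q) := by
  intro k β₁ β₂ m₁ m₂ n₁ n₂ σ τ hβ s t hs ht
  have h1 := s.numMult_add_one
  have h2 := s.numComult_add_one
  have h3 := t.numMult_add_one
  have h4 := t.numComult_add_one
  have h5 := s.one_le_weight
  have h6 := t.one_le_weight
  have h7 := Fintype.card_congr σ
  have h8 := Fintype.card_congr τ
  simp only [Nat.card_eq_fintype_card, Fintype.card_fin] at h1 h2 h3 h4 h7 h8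
  obtain ⟨rfl, rfl, rfl, rfl, rfl, rfl, rfl⟩ : k = 0 ∧ β₁ = 0 ∧ β₂ = 0 ∧ m₁ = 1 ∧ m₂ = 2 ∧ n₁ = 1 ∧
    n₂ = 0 := by omega
  have hs' := Cong.mult_of_genus_zero s hs
  have ht' := Cong.mult_of_genus_zero t ht
  rw [coeff_eq_of_cong_one q (Cong.relabel σ τ (by simpa using Cong.compFin hs' ht') )]
  simp [decAssoc, coeffPair, coeff_eq_of_cong_one μ hs', coeff_eq_of_cong_one μ ht', hμ]
  rfl

theorem imageOfDerivative_decAssoc {N : ℕ} [NeZero N] (η : GenMap N) (μ : Gen 0 2 1) (q : Gen 0 3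
    1) :
    imageOfDerivative η 0 (decAssoc μ q) = ∑ σ : Equiv.Perm (Fin 3),
      (-1 / 2 : ℝ) • coeff (relabel σ (Equiv.refl _) multMult) q •
        Op.relabel σ (Equiv.refl _) (Op.mul (Op.tensorRight (η 0 2 1 μ)) (η 0 2 1 μ)) := by
  rw [imageOfDerivative, ← Op.comp_tensorRight_31]
  simp [Finset.Nat.antidiagonal_succ, decAssoc, Op.relabel_smul, Op.relabel_zero, Nat.factorial]
  rfl

/-- The decompositions of the homotopy `q` for coassociativity: two comultiplications. -/
def decCoassoc (δ : Gen 0 1 2) (q : Gen 0 1 3) : Decomposition 1 3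
  | 0, 0, 0, 0, 1, 2, 1, σ, τ => coeff (relabel σ τ comultComult) q • (δ ⊗ₜ[ℝ] δ)
  | _, _, _, _, _, _, _, _, _ => 0

theorem isDecomposition_decCoassoc {δ : Gen 0 1 2} (hδ : coeff comult δ = 1) (q : Gen 0 1 3) :
    IsDecomposition q (decCoassoc δ q) := by
  intro k β₁ β₂ m₁ m₂ n₁ n₂ σ τ hβ s t hs ht
  have h1 := s.numMult_add_one
  have h2 := s.numComult_add_one
  have h3 := t.numMult_add_one
  have h4 := t.numComult_add_one
  have h5 := s.one_le_weight
  have h6 := t.one_le_weight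
  have h7 := Fintype.card_congr σ
  have h8 := Fintype.card_congr τ
  simp only [Nat.card_eq_fintype_card, Fintype.card_fin] at h1 h2 h3 h4 h7 h8
  obtain ⟨rfl, rfl, rfl, rfl, rfl, rfl, rfl⟩ : k = 0 ∧ β₁ = 0 ∧ β₂ = 0 ∧ m₁ = 0 ∧ m₂ = 1 ∧ n₁ = 2 ∧
    n₂ = 1 := by omega
  obtain ⟨ε, hs'⟩ := Cong.comult_of_genus_zero s hs
  obtain ⟨ε', ht'⟩ := Cong.comult_of_genus_zero t ht
  rw [coeff_eq_of_cong q (Cong.relabel σ τ (Cong.compFin hs' ht') )]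
  simp [decCoassoc, coeffPair, coeff_eq_of_cong δ hs', coeff_eq_of_cong δ ht', hδ]
  change _ = _ * coeff (relabel σ τ comultComult) q
  ring

theorem imageOfDerivative_decCoassoc {N : ℕ} [NeZero N] (η : GenMap N) (δ : Gen 0 1 2) (q : Gen 0 1
    3) :
    imageOfDerivative η 0 (decCoassoc δ q) = ∑ τ : Equiv.Perm (Fin 3),
      (2⁻¹ : ℝ) • coeff (relabel (Equiv.refl _) τ comultComult) q •
        Op.relabel (Equiv.refl _) τ (Op.mul (η 0 1 2 δ) (Op.tensorLeft (η 0 1 2 δ))) := by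
  rw [imageOfDerivative, ← Op.comp_tensorLeft_13]
  simp [Finset.Nat.antidiagonal_succ, decCoassoc, Op.relabel_smul, Op.relabel_zero, Nat.factorial]
  rfl

/-- The decompositions of the homotopy `q` for the Frobenius relation: a multiplication and a
comultiplication, in either order. -/
def decFrob (μ : Gen 0 2 1) (δ : Gen 0 1 2) (q : Gen 0 2 2) : Decomposition 2 2
  | 0, 0, 0, 0, 2, 2, 0, σ, τ => coeff (relabel σ τ comultMult) q • (δ ⊗ₜ[ℝ] μ)
  | 0, 0, 0, 1, 1, 1, 1, σ, τ => coeff (relabel σ τ zigzag) q • (μ ⊗ₜ[ℝ] δ)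
  | _, _, _, _, _, _, _, _, _ => 0

theorem isDecomposition_decFrob {μ : Gen 0 2 1} (hμ : coeff mult μ = 1) {δ : Gen 0 1 2}
    (hδ : coeff comult δ = 1) (q : Gen 0 2 2) :
    IsDecomposition q (decFrob μ δ q) := by
  intro k β₁ β₂ m₁ m₂ n₁ n₂ σ τ hβ s t hs ht
  have h1 := s.numMult_add_one
  have h2 := s.numComult_add_one
  have h3 := t.numMult_add_one
  have h4 := t.numComult_add_one
  have h5 := s.one_le_weight
  have h6 := t.one_le_weight
  have h7 := Fintype.card_congr σ
  have h8 := Fintype.card_congr τ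
  simp only [Nat.card_eq_fintype_card, Fintype.card_fin] at h1 h2 h3 h4 h7 h8
  obtain ⟨rfl, rfl, rfl, rfl, rfl, rfl, rfl⟩ | ⟨rfl, rfl, rfl, rfl, rfl, rfl, rfl⟩ :
    (k = 0 ∧ β₁ = 0 ∧ β₂ = 0 ∧ m₁ = 0 ∧ m₂ = 2 ∧ n₁ = 2 ∧ n₂ = 0) ∨
    (k = 0 ∧ β₁ = 0 ∧ β₂ = 0 ∧ m₁ = 1 ∧ m₂ = 1 ∧ n₁ = 1 ∧ n₂ = 1) := by omega
  · obtain ⟨ε, hs'⟩ := Cong.comult_of_genus_zero s hs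
    have ht' := Cong.mult_of_genus_zero t ht
    rw [coeff_eq_of_cong q (Cong.relabel σ τ (Cong.compFin hs' ht') )]
    simp [decFrob, coeffPair, coeff_eq_of_cong δ hs', coeff_eq_of_cong_one μ ht', hδ, hμ]
    change _ = _ * coeff (relabel σ τ comultMult) q
    ring
  · obtain ⟨ε, ht'⟩ := Cong.comult_of_genus_zero t ht
    have hs' := Cong.mult_of_genus_zero s hs
    rw [coeff_eq_of_cong q (Cong.relabel σ τ (Cong.compFin hs' ht') )]
    simp [decFrob, coeffPair, coeff_eq_of_cong δ ht', coeff_eq_of_cong_one μ hs', hδ, hμ]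
    change _ = _ * coeff (relabel σ τ zigzag) q
    ring

theorem imageOfDerivative_decFrob {N : ℕ} [NeZero N] (η : GenMap N) (μ : Gen 0 2 1) (δ : Gen 0 1 2)
    (q : Gen 0 2 2) :
    imageOfDerivative η 0 (decFrob μ δ q) = ∑ σ : Equiv.Perm (Fin 2), ∑ τ : Equiv.Perm (Fin 2),
      (4⁻¹ : ℝ) • coeff (relabel σ τ comultMult) q • Op.relabel σ τ (Op.mul (η 0 2 1 μ) (η 0 1 2
        δ)) -
      ∑ σ : Equiv.Perm (Fin 2), ∑ τ : Equiv.Perm (Fin 2), coeff (relabel σ τ zigzag) q •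
        Op.relabel σ τ (Op.mul (Op.tensorRight (η 0 1 2 δ)) (Op.tensorLeft (η 0 2 1 μ))) := by
  rw [imageOfDerivative, ← Op.comp_mul_212, ← Op.comp_zigzag]
  simp [Finset.Nat.antidiagonal_succ, decFrob, ← sub_eq_add_neg,
    show (2⁻¹ * 2⁻¹ : ℝ) = 4⁻¹ by norm_num, Op.relabel_smul, Op.relabel_zero, Nat.factorial]
  rfl

end

/-! ### Derivatives in genus one and genus two -/

section

variable {N : ℕ} [NeZero N]

/-- The decompositions of a genus-one generator with two inputs. Both have two internal edges;
those with a single edge would contain a genus-one factor of arity `(1, 1)`, and vanish. -/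
def decInput (μ : Gen 0 2 1) (δ : Gen 0 1 2) (q : Gen 1 2 1) : Decomposition 2 1
  | 1, 0, 0, 1, 1, 1, 0, σ, τ => sliceUpper q 1 0 σ τ comult rfl ⊗ₜ[ℝ] δ
  | 1, 0, 0, 0, 2, 1, 0, σ, τ => μ ⊗ₜ[ℝ] sliceLower q 1 0 σ τ mult rfl
  | _, _, _, _, _, _, _, _, _ => 0

theorem isDecomposition_decInput {μ : Gen 0 2 1} (hμ : coeff mult μ = 1) {δ : Gen 0 1 2}
    (hδ : coeff comult δ = 1) (q : Gen 1 2 1) :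
    IsDecomposition q (decInput μ δ q) := by
  intro k β₁ β₂ m₁ m₂ n₁ n₂ σ τ hβ s t hs ht
  have h1 := s.numMult_add_one
  have h2 := s.numComult_add_one
  have h3 := t.numMult_add_one
  have h4 := t.numComult_add_one
  have h5 := s.one_le_weight
  have h6 := t.one_le_weight
  have h7 := Fintype.card_congr σ
  have h8 := Fintype.card_congr τ
  have h9 : 0 < m₂ := Fin.pos_iff_nonempty.2 t.nonempty.1
  have h10 : 0 < n₁ := Fin.pos_iff_nonempty.2 s.nonempty.2
  simp only [Nat.card_eq_fintype_card, Fintype.card_fin] at h1 h2 h3 h4 h7 h8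
  obtain ⟨rfl, rfl, rfl, rfl, rfl, rfl, rfl⟩ | ⟨rfl, rfl, rfl, rfl, rfl, rfl, rfl⟩ |
      ⟨rfl, rfl, rfl, rfl, rfl, rfl, rfl⟩ | ⟨rfl, rfl, rfl, rfl, rfl, rfl, rfl⟩ :
    (k = 1 ∧ β₁ = 0 ∧ β₂ = 0 ∧ m₁ = 1 ∧ m₂ = 1 ∧ n₁ = 1 ∧ n₂ = 0) ∨
    (k = 1 ∧ β₁ = 0 ∧ β₂ = 0 ∧ m₁ = 0 ∧ m₂ = 2 ∧ n₁ = 1 ∧ n₂ = 0) ∨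
    (k = 0 ∧ β₁ = 1 ∧ β₂ = 0 ∧ m₁ = 0 ∧ m₂ = 2 ∧ n₁ = 1 ∧ n₂ = 0) ∨
    (k = 0 ∧ β₁ = 0 ∧ β₂ = 1 ∧ m₁ = 1 ∧ m₂ = 1 ∧ n₁ = 1 ∧ n₂ = 0) := by omega
  · obtain ⟨ε, ht'⟩ := Cong.comult_of_genus_zero t ht
    rw [coeff_eq_of_cong q (Cong.relabel σ τ (Cong.compFin (Cong.refl s) ht') )]
    simp [decInput, coeffPair, coeff_eq_of_cong δ ht', hδ, _root_.mul_comm]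
    rfl
  · have hs' := Cong.mult_of_genus_zero s hs
    rw [coeff_eq_of_cong q (Cong.relabel σ τ (Cong.compFin hs' (Cong.refl t)) )]
    simp [decInput, coeffPair, coeff_eq_of_cong_one μ hs', hμ]
    rfl
  · rw [coeff_eq_zero_of_cong_neg q (Cong.relabel σ τ (by
      simpa using Cong.compFin (Cong.neg_one_of_fin_one s hs) (Cong.refl t)))]
    simp [decInput]
  · rw [coeff_eq_zero_of_cong_neg q (Cong.relabel σ τ (by
      simpa using Cong.compFin (Cong.refl s) (Cong.neg_one_of_fin_one t ht)))]
    simp [decInput]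

theorem imageOfDerivative_decInput (η : GenMap N) (μ : Gen 0 2 1) (δ : Gen 0 1 2)
    (q : Gen 1 2 1) :
    imageOfDerivative η 1 (decInput μ δ q) =
      ∑ σ : Equiv.Perm (Fin 2), (-4⁻¹ : ℝ) • Op.relabel σ (Equiv.refl _) (Op.mul
        (η 0 2 2 (sliceLower q 1 0 (m₁ := 0) (m₂ := 2) (n₁ := 1) (n₂ := 0) σ (Equiv.refl _) mult
          rfl)) (η 0 2 1 μ)) +
      ∑ σ : Equiv.Perm (Fin 2), (2⁻¹ : ℝ) • Op.relabel σ (Equiv.refl _) (Op.mul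
        (Op.tensorRight (η 0 1 2 δ)) (η 0 3 1 (sliceUpper q 1 0 (m₁ := 1) (m₂ := 1) (n₁ := 1)
          (n₂ := 0) σ (Equiv.refl _) comult rfl))) := by
  rw [imageOfDerivative]
  simp only [← Op.comp_tensorRight_21, ← Op.comp_mul_221]
  simp [Finset.sum_range_succ, Finset.Nat.antidiagonal_succ, decInput,
    show (-1 / (2 * (1 + 1)) : ℝ) = -4⁻¹ by norm_num,
    show ((1 + 1)⁻¹ : ℝ) = 2⁻¹ by norm_num, -neg_smul, Op.relabel_zero, Nat.factorial]
  rfl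

/-- The decompositions of a genus-one generator with two outputs, along two internal edges. -/
def decOutput (μ : Gen 0 2 1) (δ : Gen 0 1 2) (q : Gen 1 1 2) : Decomposition 1 2
  | 1, 0, 0, 0, 1, 1, 1, σ, τ => μ ⊗ₜ[ℝ] sliceLower q 1 0 σ τ mult rfl
  | 1, 0, 0, 0, 1, 2, 0, σ, τ => sliceUpper q 1 0 σ τ comult rfl ⊗ₜ[ℝ] δ
  | _, _, _, _, _, _, _, _, _ => 0

theorem isDecomposition_decOutput {μ : Gen 0 2 1} (hμ : coeff mult μ = 1) {δ : Gen 0 1 2}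
    (hδ : coeff comult δ = 1) (q : Gen 1 1 2) :
    IsDecomposition q (decOutput μ δ q) := by
  intro k β₁ β₂ m₁ m₂ n₁ n₂ σ τ hβ s t hs ht
  have h1 := s.numMult_add_one
  have h2 := s.numComult_add_one
  have h3 := t.numMult_add_one
  have h4 := t.numComult_add_one
  have h5 := s.one_le_weight
  have h6 := t.one_le_weight
  have h7 := Fintype.card_congr σ
  have h8 := Fintype.card_congr τ
  have h9 : 0 < m₂ := Fin.pos_iff_nonempty.2 t.nonempty.1
  have h10 : 0 < n₁ := Fin.pos_iff_nonempty.2 s.nonempty.2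
  simp only [Nat.card_eq_fintype_card, Fintype.card_fin] at h1 h2 h3 h4 h7 h8
  obtain ⟨rfl, rfl, rfl, rfl, rfl, rfl, rfl⟩ | ⟨rfl, rfl, rfl, rfl, rfl, rfl, rfl⟩ |
      ⟨rfl, rfl, rfl, rfl, rfl, rfl, rfl⟩ | ⟨rfl, rfl, rfl, rfl, rfl, rfl, rfl⟩ :
    (k = 1 ∧ β₁ = 0 ∧ β₂ = 0 ∧ m₁ = 0 ∧ m₂ = 1 ∧ n₁ = 2 ∧ n₂ = 0) ∨
    (k = 1 ∧ β₁ = 0 ∧ β₂ = 0 ∧ m₁ = 0 ∧ m₂ = 1 ∧ n₁ = 1 ∧ n₂ = 1) ∨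
    (k = 0 ∧ β₁ = 1 ∧ β₂ = 0 ∧ m₁ = 0 ∧ m₂ = 1 ∧ n₁ = 1 ∧ n₂ = 1) ∨
    (k = 0 ∧ β₁ = 0 ∧ β₂ = 1 ∧ m₁ = 0 ∧ m₂ = 1 ∧ n₁ = 2 ∧ n₂ = 0) := by omega
  · obtain ⟨ε, ht'⟩ := Cong.comult_of_genus_zero t ht
    rw [coeff_eq_of_cong q (Cong.relabel σ τ (Cong.compFin (Cong.refl s) ht') )]
    simp [decOutput, coeffPair, coeff_eq_of_cong δ ht', hδ, _root_.mul_comm]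
    rfl
  · have hs' := Cong.mult_of_genus_zero s hs
    rw [coeff_eq_of_cong q (Cong.relabel σ τ (Cong.compFin hs' (Cong.refl t)) )]
    simp [decOutput, coeffPair, coeff_eq_of_cong_one μ hs', hμ]
    rfl
  · rw [coeff_eq_zero_of_cong_neg q (Cong.relabel σ τ (by
      simpa using Cong.compFin (Cong.neg_one_of_fin_one s hs) (Cong.refl t)))]
    simp [decOutput]
  · rw [coeff_eq_zero_of_cong_neg q (Cong.relabel σ τ (by
      simpa using Cong.compFin (Cong.refl s) (Cong.neg_one_of_fin_one t ht)))]
    simp [decOutput]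

theorem imageOfDerivative_decOutput (η : GenMap N) (μ : Gen 0 2 1) (δ : Gen 0 1 2)
    (q : Gen 1 1 2) :
    imageOfDerivative η 1 (decOutput μ δ q) =
      ∑ τ : Equiv.Perm (Fin 2), (-2⁻¹ : ℝ) • Op.relabel (Equiv.refl _) τ (Op.mul
        (η 0 1 3 (sliceLower q 1 0 (m₁ := 0) (m₂ := 1) (n₁ := 1) (n₂ := 1) (Equiv.refl _) τ mult
          rfl))
        (Op.tensorLeft (η 0 2 1 μ))) +
      ∑ τ : Equiv.Perm (Fin 2), (-4⁻¹ : ℝ) • Op.relabel (Equiv.refl _) τ (Op.mul (η 0 1 2 δ)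
        (η 0 2 2 (sliceUpper q 1 0 (m₁ := 0) (m₂ := 1) (n₁ := 2) (n₂ := 0) (Equiv.refl _) τ comult
          rfl))) := by
  rw [imageOfDerivative]
  simp only [← Op.comp_tensorLeft_12, ← Op.comp_mul_122]
  simp [Finset.sum_range_succ, Finset.Nat.antidiagonal_succ, decOutput,
    show (-1 / (2 * (1 + 1)) : ℝ) = -4⁻¹ by norm_num, show (-1 / (1 + 1) : ℝ) = -2⁻¹ by norm_num,
    -neg_smul, Op.relabel_zero, Nat.factorial]
  rfl

/-- The decompositions of a genus-two generator of arity `(1, 1)`: along two edges they are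
slices at a comultiplication or a multiplication, and along three edges they are given as
`∑ i, M i ⊗ X i`. -/
def decTwo (μ : Gen 0 2 1) (δ : Gen 0 1 2) (q : Gen 2 1 1) {I : Type} [Fintype I]
    (M : I → Gen 0 3 1) (X : I → Gen 0 1 3) : Decomposition 1 1
  | 1, 1, 0, 0, 1, 1, 0, σ, τ => sliceUpper q 1 1 σ τ comult rfl ⊗ₜ[ℝ] δ
  | 1, 0, 1, 0, 1, 1, 0, σ, τ => μ ⊗ₜ[ℝ] sliceLower q 1 1 σ τ mult rfl
  | 2, 0, 0, 0, 1, 1, 0, _, _ => ∑ i, M i ⊗ₜ[ℝ] X i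
  | _, _, _, _, _, _, _, _, _ => 0

theorem isDecomposition_decTwo {μ : Gen 0 2 1} (hμ : coeff mult μ = 1) {δ : Gen 0 1 2}
    (hδ : coeff comult δ = 1) (q : Gen 2 1 1) {I : Type} [Fintype I]
    (M : I → Gen 0 3 1) (X : I → Gen 0 1 3)
    (h : ∀ (σ : Fin (0 + 1) ≃ Fin 1) (τ : Fin (1 + 0) ≃ Fin 1) (s : Composite (Fin (0 + (2 + 1)))
      (Fin 1))
      (t : Composite (Fin 1) (Fin ((2 + 1) + 0))), s.genus = 0 → t.genus = 0 →
      ∑ i, coeff s (M i) * coeff t (X i) = coeff (relabel σ τ (compFin 2 s t)) q) :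
    IsDecomposition q (decTwo μ δ q M X) := by
  intro k β₁ β₂ m₁ m₂ n₁ n₂ σ τ hβ s t hs ht
  have h1 := s.numMult_add_one
  have h2 := s.numComult_add_one
  have h3 := t.numMult_add_one
  have h4 := t.numComult_add_one
  have h5 := s.one_le_weight
  have h6 := t.one_le_weight
  have h7 := Fintype.card_congr σ
  have h8 := Fintype.card_congr τ
  have h9 : 0 < m₂ := Fin.pos_iff_nonempty.2 t.nonempty.1
  have h10 : 0 < n₁ := Fin.pos_iff_nonempty.2 s.nonempty.2
  simp only [Nat.card_eq_fintype_card, Fintype.card_fin] at h1 h2 h3 h4 h7 h8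
  obtain ⟨rfl, rfl, rfl, rfl⟩ : m₁ = 0 ∧ m₂ = 1 ∧ n₁ = 1 ∧ n₂ = 0 := by omega
  obtain ⟨rfl, rfl, rfl⟩ | ⟨rfl, rfl, rfl⟩ | ⟨rfl, rfl, rfl⟩ | ⟨rfl, rfl, rfl⟩ :
    (k = 1 ∧ β₁ = 1 ∧ β₂ = 0) ∨ (k = 1 ∧ β₁ = 0 ∧ β₂ = 1) ∨ (k = 2 ∧ β₁ = 0 ∧ β₂ = 0) ∨
    (k = 0 ∧ β₁ = 1 ∧ β₂ = 1) := by omega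
  · obtain ⟨ε, ht'⟩ := Cong.comult_of_genus_zero t ht
    rw [coeff_eq_of_cong q (Cong.relabel σ τ (Cong.compFin (Cong.refl s) ht') )]
    simp [decTwo, coeffPair, coeff_eq_of_cong δ ht', hδ, _root_.mul_comm]
    rfl
  · have hs' := Cong.mult_of_genus_zero s hs
    rw [coeff_eq_of_cong q (Cong.relabel σ τ (Cong.compFin hs' (Cong.refl t)) )]
    simp [decTwo, coeffPair, coeff_eq_of_cong_one μ hs', hμ]
    rfl
  · rw [← h σ τ s t hs ht]
    simp [decTwo, coeffPair]
  · rw [coeff_eq_zero_of_cong_neg q (Cong.relabel σ τ (by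
      simpa using Cong.compFin (Cong.neg_one_of_fin_one s hs) (Cong.refl t)))]
    simp [decTwo]

theorem imageOfDerivative_decTwo (η : GenMap N) (μ : Gen 0 2 1) (δ : Gen 0 1 2)
    (q : Gen 2 1 1) {I : Type} [Fintype I] (M : I → Gen 0 3 1) (X : I → Gen 0 1 3) :
    imageOfDerivative η 2 (decTwo μ δ q M X) =
      (-2⁻¹ : ℝ) • Op.mul (η 1 1 2 (sliceLower q 1 1 (m₁ := 0) (m₂ := 1) (n₁ := 1) (n₂ := 0)
        (Equiv.refl _) (Equiv.refl _) mult rfl)) (η 0 2 1 μ) +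
      (2⁻¹ : ℝ) • Op.mul (η 0 1 2 δ) (η 1 2 1 (sliceUpper q 1 1 (m₁ := 0) (m₂ := 1) (n₁ := 1)
        (n₂ := 0) (Equiv.refl _) (Equiv.refl _) comult rfl)) +
      (6⁻¹ : ℝ) • ∑ i, Op.mul (η 0 1 3 (X i)) (η 0 3 1 (M i)) := by
  rw [imageOfDerivative]
  simp only [← Op.comp_mul_121, ← Op.comp_mul_131]
  simp [Finset.sum_range_succ, Finset.Nat.antidiagonal_succ, decTwo,
    show (-1 / (1 + 1) : ℝ) = -2⁻¹ by norm_num, show ((1 + 1)⁻¹ : ℝ) = 2⁻¹ by norm_num,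
    show (2⁻¹ * (2 + 1)⁻¹ : ℝ) = 6⁻¹ by norm_num, -neg_smul, Op.relabel_zero, Nat.factorial]
  exact congrArg₂ (· + ·) (congrArg₂ (· + ·) (congrArg _ (Op.relabel_refl _))
    (congrArg _ (Op.relabel_refl _))) (congrArg _ (Op.relabel_refl _))

end

/-! ### Evaluation of composites with two internal edges -/

section

open ShFrob.Letter (content cobracket prod₁ prod₂)

theorem eval_compFin {k m₁ m₂ n₁ n₂ : ℕ} (s : Composite (Fin (m₁ + (k + 1))) (Fin n₁))
    (t : Composite (Fin m₂) (Fin ((k + 1) + n₂))) (X : Fin (m₁ + m₂) → Letter)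
    (Y : Fin (n₁ + n₂) → Letter) :
    eval (compFin k s t) X Y = ∑ z : Fin (k + 1) → Letter,
      eval s (Fin.append (X ∘ Fin.castAdd m₂) z) (Y ∘ Fin.castAdd n₂) *
        eval t (X ∘ Fin.natAdd m₁) (Fin.append z (Y ∘ Fin.natAdd n₁)) := by
  rw [compFin, eval_relabel, eval_comp]
  refine Finset.sum_congr rfl fun z _ => ?_
  rw [eval_relabel, eval_relabel]
  refine congrArg₂ (· * ·) (congrArg₂ (eval s) ?_ ?_) (congrArg₂ (eval t) ?_ ?_)
  · funext i
    refine Fin.addCases (fun i => ?_) (fun i => ?_) i <;> simp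
  · funext i; simp
  · funext i; simp
  · funext i
    refine Fin.addCases (fun i => ?_) (fun i => ?_) i <;> simp

theorem sum_fin_two {M : Type*} [AddCommMonoid M] (f : (Fin 2 → Letter) → M) :
    ∑ z, f z = ∑ p, ∑ q, f ![p, q] := by
  rw [← (finTwoArrowEquiv Letter).symm.sum_comp, Fintype.sum_prod_type]
  rfl

theorem sum_fin_three {M : Type*} [AddCommMonoid M] (f : (Fin 3 → Letter) → M) :
    ∑ z, f z = ∑ p, ∑ q, ∑ r, f ![p, q, r] := by
  rw [← (Fin.consEquiv fun _ => Letter).sum_comp, Fintype.sum_prod_type]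
  refine Finset.sum_congr rfl fun p _ => ?_
  exact sum_fin_two fun z => f (Fin.cons p z)

theorem eval_relabel_compFin_121 (σ : Fin 1 ≃ Fin 1) (τ : Fin 1 ≃ Fin 1)
    (s : Composite (Fin 2) (Fin 1)) (t : Composite (Fin 1) (Fin 2)) (X Y : Fin 1 → Letter) :
    eval (relabel σ τ (compFin 1 (m₁ := 0) (m₂ := 1) (n₁ := 1) (n₂ := 0) s t)) X Y =
      ∑ p, ∑ q, eval s ![p, q] Y * eval t X ![p, q] := by
  obtain rfl := Subsingleton.elim σ (Equiv.refl _)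
  obtain rfl := Subsingleton.elim τ (Equiv.refl _)
  rw [eval_relabel, eval_compFin, sum_fin_two]
  refine Finset.sum_congr rfl fun p _ => Finset.sum_congr rfl fun q _ => ?_
  refine congrArg₂ (· * ·) (congrArg₂ (eval s) ?_ ?_) (congrArg₂ (eval t) ?_ ?_) <;>
    (funext i; fin_cases i <;> rfl)

theorem eval_relabel_compFin_comult (σ : Fin 2 ≃ Fin 2) (τ : Fin 1 ≃ Fin 1)
    (s : Composite (Fin 3) (Fin 1)) (X : Fin 2 → Letter) (Y : Fin 1 → Letter) :
    eval (relabel σ τ (compFin 1 (m₁ := 1) (m₂ := 1) (n₁ := 1) (n₂ := 0) s comult)) X Y =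
      ∑ p, ∑ q, eval s ![X (σ 0), p, q] Y * (cobracket (X (σ 1)) p q : Grass) := by
  obtain rfl := Subsingleton.elim τ (Equiv.refl _)
  rw [eval_relabel, eval_compFin, sum_fin_two]
  refine Finset.sum_congr rfl fun p _ => Finset.sum_congr rfl fun q _ => ?_
  refine congrArg₂ (· * ·) (congrArg₂ (eval s) ?_ ?_) rfl <;>
    (funext i; fin_cases i <;> rfl)

theorem eval_relabel_compFin_mult_left (σ : Fin 2 ≃ Fin 2) (τ : Fin 1 ≃ Fin 1)
    (t : Composite (Fin 2) (Fin 2)) (X : Fin 2 → Letter) (Y : Fin 1 → Letter) :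
    eval (relabel σ τ (compFin 1 (m₁ := 0) (m₂ := 2) (n₁ := 1) (n₂ := 0) mult t)) X Y =
      ∑ p, ∑ q, gmul p q (Y 0) * eval t (X ∘ σ) ![p, q] := by
  obtain rfl := Subsingleton.elim τ (Equiv.refl _)
  rw [eval_relabel, eval_compFin, sum_fin_two]
  refine Finset.sum_congr rfl fun p _ => Finset.sum_congr rfl fun q _ => ?_
  refine congrArg₂ (· * ·) rfl (congrArg₂ (eval t) ?_ ?_) <;>
    (funext i; fin_cases i <;> rfl)

theorem eval_relabel_compFin_mult (σ : Fin 1 ≃ Fin 1) (τ : Fin 2 ≃ Fin 2)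
    (t : Composite (Fin 1) (Fin 3)) (X : Fin 1 → Letter) (Y : Fin 2 → Letter) :
    eval (relabel σ τ (compFin 1 (m₁ := 0) (m₂ := 1) (n₁ := 1) (n₂ := 1) mult t)) X Y =
      ∑ p, ∑ q, gmul p q (Y (τ 0)) * eval t X ![p, q, Y (τ 1)] := by
  obtain rfl := Subsingleton.elim σ (Equiv.refl _)
  rw [eval_relabel, eval_compFin, sum_fin_two]
  refine Finset.sum_congr rfl fun p _ => Finset.sum_congr rfl fun q _ => ?_
  refine congrArg₂ (· * ·) rfl (congrArg₂ (eval t) ?_ ?_) <;>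
    (funext i; fin_cases i <;> rfl)

theorem eval_relabel_compFin_comult_right (σ : Fin 1 ≃ Fin 1) (τ : Fin 2 ≃ Fin 2)
    (s : Composite (Fin 2) (Fin 2)) (X : Fin 1 → Letter) (Y : Fin 2 → Letter) :
    eval (relabel σ τ (compFin 1 (m₁ := 0) (m₂ := 1) (n₁ := 2) (n₂ := 0) s comult)) X Y =
      ∑ p, ∑ q, eval s ![p, q] (Y ∘ τ) * (cobracket (X 0) p q : Grass) := by
  obtain rfl := Subsingleton.elim σ (Equiv.refl _)
  rw [eval_relabel, eval_compFin, sum_fin_two]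
  refine Finset.sum_congr rfl fun p _ => Finset.sum_congr rfl fun q _ => ?_
  refine congrArg₂ (· * ·) (congrArg₂ (eval s) ?_ ?_) rfl <;>
    (funext i; fin_cases i <;> rfl)

@[simp] theorem genus_multMult : multMult.genus = 0 := by simp [multMult, compFin, genus]

@[simp] theorem genus_comultComult : comultComult.genus = 0 := by
  simp [comultComult, compFin, genus]

@[simp] theorem genus_comultMult : comultMult.genus = 0 := by simp [comultMult, compFin, genus]

@[simp] theorem genus_zigzag : zigzag.genus = 0 := by simp [zigzag, compFin, genus]

/-! ### Slices of the genus-two generator -/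

/-- The genus-one generator cut off `genusTwo` above by a comultiplication at the input. -/
def genusTwoInput : Gen 1 2 1 :=
  sliceUpper genusTwo 1 1 (m₁ := 0) (m₂ := 1) (n₁ := 1) (n₂ := 0)
    (Equiv.refl _) (Equiv.refl _) comult rfl

/-- The genus-one generator cut off `genusTwo` below by a multiplication at the output. -/
def genusTwoOutput : Gen 1 1 2 :=
  sliceLower genusTwo 1 1 (m₁ := 0) (m₂ := 1) (n₁ := 1) (n₂ := 0)
    (Equiv.refl _) (Equiv.refl _) mult rfl

/-- The homotopy for associativity cut off `genusTwo` by a double comultiplication at the input,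
whose outputs are permuted by `τ`. -/
def genusTwoLower (τ : Equiv.Perm (Fin 3)) : Gen 0 3 1 :=
  sliceUpper genusTwo 2 0 (m₁ := 0) (m₂ := 1) (n₁ := 1) (n₂ := 0)
    (Equiv.refl _) (Equiv.refl _) (relabel (Equiv.refl _) τ comultComult) (by simp [genus])

/-- The homotopy for coassociativity cut off `genusTwo` by a double multiplication at the
output, whose inputs are permuted by `σ`. -/
def genusTwoUpper (σ : Equiv.Perm (Fin 3)) : Gen 0 1 3 :=
  sliceLower genusTwo 2 0 (m₁ := 0) (m₂ := 1) (n₁ := 1) (n₂ := 0)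
    (Equiv.refl _) (Equiv.refl _) (relabel σ (Equiv.refl _) multMult) (by simp [genus])

/-- The homotopy for the Frobenius relation cut off `genusTwo` by a comultiplication at the
input and a multiplication at the output. -/
def genusTwoMiddle : Gen 0 2 2 :=
  sliceLower genusTwoInput 1 0 (m₁ := 0) (m₂ := 2) (n₁ := 1) (n₂ := 0) (Equiv.refl _)
    (Equiv.refl _) mult rfl

theorem coeff_genusTwoInput {s : Composite (Fin 2) (Fin 1)} (hs : s.genus = 1) :
    coeff s genusTwoInput = (1 / 3 : ℝ) * component 3
      (∑ p, ∑ q, eval s ![p, q] (fun _ => .y) * (cobracket .x p q : Grass)) := by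
  have h := coeff_genusTwo (t := relabel (Equiv.refl _) (Equiv.refl _)
    (compFin 1 (m₁ := 0) (m₂ := 1) (n₁ := 1) (n₂ := 0) s comult))
    (by rw [genus, genus_compFin, hs]; rfl)
  rw [eval_relabel_compFin_121] at h
  exact h

theorem coeff_genusTwoOutput {t : Composite (Fin 1) (Fin 2)} (ht : t.genus = 1) :
    coeff t genusTwoOutput = (1 / 3 : ℝ) * component 3
      (∑ p, ∑ q, gmul p q .y * eval t (fun _ => .x) ![p, q]) := by
  have h := coeff_genusTwo (t := relabel (Equiv.refl _) (Equiv.refl _)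
    (compFin 1 (m₁ := 0) (m₂ := 1) (n₁ := 1) (n₂ := 0) mult t))
    (by rw [genus, genus_compFin, ht]; rfl)
  rw [eval_relabel_compFin_121] at h
  exact h

theorem coeff_genusTwoLower (τ : Equiv.Perm (Fin 3)) {s : Composite (Fin 3) (Fin 1)}
    (hs : s.genus = 0) :
    coeff s (genusTwoLower τ) = (1 / 3 : ℝ) * component 3
      (∑ z : Fin 3 → Letter, eval s z (fun _ => .y) * eval comultComult (fun _ => .x) (z ∘ τ)) := by
  have h := coeff_genusTwo (t := relabel (Equiv.refl _) (Equiv.refl _)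
    (compFin 2 (m₁ := 0) (m₂ := 1) (n₁ := 1) (n₂ := 0) s
      (relabel (Equiv.refl _) τ comultComult)))
    (by rw [genus, genus_compFin, hs]; simp [genus])
  rw [eval_compFin_two] at h
  simp only [eval_relabel] at h
  exact h

theorem coeff_genusTwoUpper (σ : Equiv.Perm (Fin 3)) {t : Composite (Fin 1) (Fin 3)}
    (ht : t.genus = 0) :
    coeff t (genusTwoUpper σ) = (1 / 3 : ℝ) * component 3
      (∑ z : Fin 3 → Letter, eval multMult (z ∘ σ) (fun _ => .y) * eval t (fun _ => .x) z) := by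
  have h := coeff_genusTwo (t := relabel (Equiv.refl _) (Equiv.refl _)
    (compFin 2 (m₁ := 0) (m₂ := 1) (n₁ := 1) (n₂ := 0)
      (relabel σ (Equiv.refl _) multMult) t))
    (by rw [genus, genus_compFin, ht]; simp [genus])
  rw [eval_compFin_two] at h
  simp only [eval_relabel] at h
  exact h

theorem coeff_genusTwoMiddle {s : Composite (Fin 2) (Fin 2)} (hs : s.genus = 0) :
    coeff s genusTwoMiddle = (1 / 3 : ℝ) * component 3
      (∑ p, ∑ q, ∑ r, ∑ t, gmul r t .y * eval s ![p, q] ![r, t] * (cobracket .x p q : Grass)) := by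
  have h := coeff_genusTwoInput (s := relabel (Equiv.refl _) (Equiv.refl _)
    (compFin 1 (m₁ := 0) (m₂ := 2) (n₁ := 1) (n₂ := 0) mult s))
    (by rw [genus, genus_compFin, hs]; rfl)
  simp only [eval_relabel_compFin_mult_left, Finset.sum_mul] at h
  exact h

theorem cast_cobracket_anticomm (z p q : Letter) :
    (cobracket z p q : Grass) = -(cobracket z q p : Grass) := by
  rw [cobracket_anticomm]; simp

theorem sum_mul_cobracket_swap (A : Letter → Letter → Grass) (z : Letter) :
    ∑ p, ∑ q, A q p * (cobracket z p q : Grass) = -∑ p, ∑ q, A p q * (cobracket z p q : Grass) := by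
  rw [Finset.sum_comm, ← Finset.sum_neg_distrib]
  refine Finset.sum_congr rfl fun p _ => ?_
  rw [← Finset.sum_neg_distrib]
  refine Finset.sum_congr rfl fun q _ => ?_
  rw [cast_cobracket_anticomm, mul_neg]

theorem sum_gmul_mul_swap (A : Letter → Letter → Grass) (z : Letter) :
    ∑ p, ∑ q, gmul p q z * A q p = ∑ p, ∑ q, gmul p q z * A p q := by
  rw [Finset.sum_comm]
  refine Finset.sum_congr rfl fun p _ => Finset.sum_congr rfl fun q _ => ?_
  rw [gmul_comm]

theorem sliceUpper_genusTwoInput (σ : Equiv.Perm (Fin 2)) :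
    sliceUpper genusTwoInput 1 0 (m₁ := 1) (m₂ := 1) (n₁ := 1) (n₂ := 0) σ (Equiv.refl _)
      comult rfl = -((Equiv.Perm.sign σ : ℤ) : ℝ) • genusTwoLower (finRotate 3) := by
  refine gen_ext fun s hs => ?_
  have h := coeff_genusTwoInput (s := relabel σ (Equiv.refl _)
    (compFin 1 (m₁ := 1) (m₂ := 1) (n₁ := 1) (n₂ := 0) s comult))
    (by rw [genus, genus_compFin, hs]; rfl)
  refine h.trans ?_
  rw [map_smul, coeff_genusTwoLower _ hs, sum_fin_three]
  simp only [eval_relabel_compFin_comult, eval_comultComult]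
  have h1 : ∑ p, ∑ q, (∑ p', ∑ q', eval s ![p, p', q'] (fun _ => .y) *
      (cobracket q p' q' : Grass)) * (cobracket .x p q : Grass) =
      - ∑ p, ∑ q, ∑ r, eval s ![p, q, r] (fun _ => .y) *
        ((∑ z, cobracket z q r * cobracket .x z p : ℤ) : Grass) := by
    rw [← Finset.sum_neg_distrib]
    refine Finset.sum_congr rfl fun p _ => ?_
    simp only [Finset.sum_mul]
    rw [Finset.sum_comm, ← Finset.sum_neg_distrib]
    refine Finset.sum_congr rfl fun q _ => ?_
    rw [Finset.sum_comm, ← Finset.sum_neg_distrib]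
    refine Finset.sum_congr rfl fun r _ => ?_
    push_cast
    rw [Finset.mul_sum, ← Finset.sum_neg_distrib]
    refine Finset.sum_congr rfl fun z _ => ?_
    rw [cast_cobracket_anticomm .x p z, mul_assoc, mul_neg, mul_neg]
  rcases perm_fin_two σ with rfl | rfl
  · have h2 := congrArg (component 3) h1
    rw [map_neg] at h2
    simp only [Equiv.refl_apply, Matrix.cons_val_zero, Matrix.cons_val_one]
    rw [h2]
    simp
  · have h2 := congrArg (component 3) ((sum_mul_cobracket_swap _ _).trans (congrArg Neg.neg h1))
    rw [neg_neg] at h2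
    simp only [Equiv.swap_apply_left, Equiv.swap_apply_right, Matrix.cons_val_zero,
      Matrix.cons_val_one]
    rw [h2]
    simp

theorem sliceLower_genusTwoInput (σ : Equiv.Perm (Fin 2)) :
    sliceLower genusTwoInput 1 0 (m₁ := 0) (m₂ := 2) (n₁ := 1) (n₂ := 0) σ (Equiv.refl _)
      mult rfl = ((Equiv.Perm.sign σ : ℤ) : ℝ) • genusTwoMiddle := by
  rcases perm_fin_two σ with rfl | rfl
  · simp
    rfl
  refine gen_ext fun s hs => ?_
  have h := coeff_genusTwoInput (s := relabel (Equiv.swap 0 1) (Equiv.refl _)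
    (compFin 1 (m₁ := 0) (m₂ := 2) (n₁ := 1) (n₂ := 0) mult s))
    (by rw [genus, genus_compFin, hs]; rfl)
  refine h.trans ?_
  rw [map_smul, coeff_genusTwoMiddle hs]
  have h2 := congrArg (component 3) (sum_mul_cobracket_swap
    (fun p q => ∑ r, ∑ t, gmul r t .y * eval s ![p, q] ![r, t]) .x)
  simp only [eval_relabel_compFin_mult_left]
  have h3 : ∀ p q : Letter, ![p, q] ∘ (Equiv.swap (0 : Fin 2) 1) = ![q, p] := by
    intro p q; funext i; fin_cases i <;> rfl
  simp only [h3]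
  rw [h2]
  simp [Finset.sum_mul]

theorem sliceLower_genusTwoOutput (τ : Equiv.Perm (Fin 2)) :
    sliceLower genusTwoOutput 1 0 (m₁ := 0) (m₂ := 1) (n₁ := 1) (n₂ := 1) (Equiv.refl _) τ
      mult rfl = genusTwoUpper (finRotate 3).symm := by
  refine gen_ext fun s hs => ?_
  have h := coeff_genusTwoOutput (t := relabel (Equiv.refl _) τ
    (compFin 1 (m₁ := 0) (m₂ := 1) (n₁ := 1) (n₂ := 1) mult s))
    (by rw [genus, genus_compFin, hs]; rfl)
  refine h.trans ?_
  rw [coeff_genusTwoUpper _ hs, sum_fin_three]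
  simp only [eval_relabel_compFin_mult, eval_multMult]
  have h1 : ∑ p, ∑ q, gmul p q .y * ∑ p', ∑ q', gmul p' q' p * eval s (fun _ => .x) ![p', q', q] =
      ∑ p, ∑ q, ∑ r, (∑ z, gmul r z .y * gmul p q z) * eval s (fun _ => .x) ![p, q, r] := by
    simp only [Finset.sum_mul, Finset.mul_sum]
    rw [Finset.sum_comm]
    simp only [← Fintype.sum_prod_type']
    refine Fintype.sum_equiv
      { toFun := fun z => (z.2.2.1, z.2.2.2, z.1, z.2.1)
        invFun := fun z => (z.2.2.1, z.2.2.2, z.1, z.2.1)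
        left_inv := fun z => rfl
        right_inv := fun z => rfl } _ _ fun z => ?_
    simp only [Equiv.coe_fn_mk]
    rw [gmul_comm, mul_assoc]
  rcases perm_fin_two τ with rfl | rfl
  · have h2 := congrArg (component 3) h1
    simp only [Equiv.refl_apply, Matrix.cons_val_zero, Matrix.cons_val_one]
    rw [h2]
    rfl
  · have h2 := congrArg (component 3) ((sum_gmul_mul_swap _ _).trans h1)
    simp only [Equiv.swap_apply_left, Equiv.swap_apply_right, Matrix.cons_val_zero,
      Matrix.cons_val_one]
    rw [h2]
    rfl

theorem sliceUpper_genusTwoOutput (τ : Equiv.Perm (Fin 2)) :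
    sliceUpper genusTwoOutput 1 0 (m₁ := 0) (m₂ := 1) (n₁ := 2) (n₂ := 0) (Equiv.refl _) τ
      comult rfl = genusTwoMiddle := by
  refine gen_ext fun s hs => ?_
  have h := coeff_genusTwoOutput (t := relabel (Equiv.refl _) τ
    (compFin 1 (m₁ := 0) (m₂ := 1) (n₁ := 2) (n₂ := 0) s comult))
    (by rw [genus, genus_compFin, hs]; rfl)
  refine h.trans ?_
  rw [coeff_genusTwoMiddle hs]
  simp only [eval_relabel_compFin_comult_right]
  have h1 : ∑ p, ∑ q, gmul p q .y * ∑ p', ∑ q', eval s ![p', q'] ![p, q] *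
        (cobracket .x p' q' : Grass) =
      ∑ p, ∑ q, ∑ r, ∑ t, gmul r t .y * eval s ![p, q] ![r, t] * (cobracket .x p q : Grass) := by
    simp only [Finset.mul_sum, ← Fintype.sum_prod_type']
    refine Fintype.sum_equiv
      { toFun := fun z => (z.2.2.1, z.2.2.2, z.1, z.2.1)
        invFun := fun z => (z.2.2.1, z.2.2.2, z.1, z.2.1)
        left_inv := fun z => rfl
        right_inv := fun z => rfl } _ _ fun z => ?_
    simp only [Equiv.coe_fn_mk]
    rw [mul_assoc]
  rcases perm_fin_two τ with rfl | rfl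
  · exact congrArg (fun g => (1 / 3 : ℝ) * component 3 g) h1
  · have h3 : ∀ p q : Letter, ![p, q] ∘ (Equiv.swap (0 : Fin 2) 1) = ![q, p] := by
      intro p q; funext i; fin_cases i <;> rfl
    simp only [h3]
    exact congrArg (fun g => (1 / 3 : ℝ) * component 3 g) ((sum_gmul_mul_swap
      (fun p q => ∑ p', ∑ q', eval s ![p', q'] ![p, q] *
        (cobracket .x p' q' : Grass)) _).trans h1)

theorem coeff_relabel_genusTwoLower (τ : Equiv.Perm (Fin 3)) (s : Composite (Fin 3) (Fin 1)) :
    coeff (relabel τ (Equiv.refl _) s) (genusTwoLower τ) =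
      coeff s (genusTwoLower (Equiv.refl _)) := by
  by_cases hs : s.genus = 0
  · rw [coeff_genusTwoLower _ hs, coeff_genusTwoLower τ (s := relabel τ (Equiv.refl _) s) hs]
    refine congrArg (fun g => (1 / 3 : ℝ) * component 3 g) ?_
    refine Fintype.sum_equiv (τ.symm.arrowCongr (Equiv.refl _)) _ _ fun z => ?_
    rw [eval_relabel]
    refine congrArg₂ (· * ·) (congrArg₂ (eval s) ?_ ?_) (congrArg (eval _ _) ?_) <;>
      (funext i; simp)
  · rw [coeff_eq_zero _ hs, coeff_eq_zero _ (t := relabel τ (Equiv.refl _) s) hs]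

theorem coeff_relabel_genusTwoUpper (σ τ : Equiv.Perm (Fin 3)) (t : Composite (Fin 1) (Fin 3)) :
    coeff (relabel (Equiv.refl _) τ t) (genusTwoUpper (σ.trans τ)) =
      coeff t (genusTwoUpper σ) := by
  by_cases hs : t.genus = 0
  · rw [coeff_genusTwoUpper _ hs, coeff_genusTwoUpper (σ.trans τ) (t := relabel (Equiv.refl _) τ t)
      hs]
    refine congrArg (fun g => (1 / 3 : ℝ) * component 3 g) ?_
    refine Fintype.sum_equiv (τ.symm.arrowCongr (Equiv.refl _)) _ _ fun z => ?_
    rw [eval_relabel]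
    refine congrArg₂ (· * ·) (congrArg (fun z => eval multMult z _) ?_)
      (congrArg₂ (eval t) ?_ ?_) <;>
      (funext i; simp)
  · rw [coeff_eq_zero _ hs, coeff_eq_zero _ (t := relabel (Equiv.refl _) τ t) hs]

theorem sum_coeff_upperFactor_smul_lowerFactor (τ : Equiv.Perm (Fin 3)) :
    ∑ i, coeff (relabel (Equiv.refl _) τ comultComult) (upperFactor i) • lowerFactor i =
      genusTwoLower τ := by
  refine gen_ext fun s hs => ?_
  rw [map_sum]
  simp only [map_smul, smul_eq_mul]
  rw [Finset.sum_congr rfl fun i _ => mul_comm _ _]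
  exact sum_coeff_lowerFactor_mul_coeff_upperFactor (Equiv.refl _) (Equiv.refl _)
    (t := relabel (Equiv.refl _) τ comultComult) hs (by simp [genus])

theorem sum_coeff_lowerFactor_smul_upperFactor (σ : Equiv.Perm (Fin 3)) :
    ∑ i, coeff (relabel σ (Equiv.refl _) multMult) (lowerFactor i) • upperFactor i =
      genusTwoUpper σ := by
  refine gen_ext fun t ht => ?_
  rw [map_sum]
  simp only [map_smul, smul_eq_mul]
  exact sum_coeff_lowerFactor_mul_coeff_upperFactor (Equiv.refl _) (Equiv.refl _)
    (s := relabel σ (Equiv.refl _) multMult) (by simp [genus]) ht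

/-- The generator with coefficient one on the multiplication, cut off `genusTwo`. -/
def multGen : Gen 0 2 1 :=
  sliceUpper (genusTwoLower (Equiv.refl _)) 0 0 (m₁ := 1) (m₂ := 2) (n₁ := 1) (n₂ := 0)
    (Equiv.refl _) (Equiv.refl _) mult rfl

/-- The generator with coefficient one on the comultiplication, cut off `genusTwo`. -/
def comultGen : Gen 0 1 2 :=
  sliceUpper (genusTwoUpper (Equiv.refl _)) 0 0 (m₁ := 0) (m₂ := 1) (n₁ := 2) (n₂ := 1)
    (Equiv.refl _) (Equiv.refl _) comult rfl

theorem coeff_comultComult_genusTwoUpper :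
    coeff comultComult (genusTwoUpper (Equiv.refl _)) = 1 := by
  rw [← coeff_genusTwoGraph_genusTwo]
  refine coeff_eq_of_cong_one genusTwo (t := genusTwoGraph)
    ((Cong.relabel_refl _).trans (ε' := 1) ?_)
  rw [← one_mul (1 : ℤˣ)]
  exact Cong.compFin (ε := 1) (ε' := 1) (k := 2) (m₁ := 0) (m₂ := 1) (n₁ := 1) (n₂ := 0)
    (Cong.relabel_refl multMult) (Cong.refl comultComult)

theorem coeff_mult_multGen : coeff mult multGen = 1 := by
  rw [← coeff_genusTwoGraph_genusTwo]
  refine coeff_eq_of_cong_one genusTwo (t := genusTwoGraph)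
    ((Cong.relabel_refl _).trans (ε' := 1) ?_)
  rw [← one_mul (1 : ℤˣ)]
  exact Cong.compFin (ε := 1) (ε' := 1) (k := 2) (m₁ := 0) (m₂ := 1) (n₁ := 1) (n₂ := 0)
    (Cong.relabel_refl multMult) (Cong.relabel_refl comultComult)

theorem coeff_comult_comultGen : coeff comult comultGen = 1 := by
  rw [← coeff_comultComult_genusTwoUpper]
  exact coeff_eq_of_cong_one (genusTwoUpper (Equiv.refl _)) (Cong.relabel_refl comultComult)

/-- The Frobenius homotopy `genusTwoMiddle` has no component along multiplying and then
comultiplying: the product is symmetric, whereas its two inputs come from a cobracket. -/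
theorem coeff_relabel_comultMult_genusTwoMiddle (σ τ : Equiv.Perm (Fin 2)) :
    coeff (relabel σ τ comultMult) genusTwoMiddle = 0 := by
  rw [coeff_genusTwoMiddle (s := relabel σ τ comultMult) (by simp [genus])]
  simp only [eval_relabel, eval_comultMult]
  have h := sum_mul_cobracket_swap (fun p q => ∑ r, ∑ t, gmul r t .y *
    (∑ z, (cobracket z ((![r, t] ∘ τ) 0) ((![r, t] ∘ τ) 1) : Grass) *
      gmul ((![p, q] ∘ σ) 0) ((![p, q] ∘ σ) 1) z)) .x
  simp only [Finset.sum_mul] at h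
  have h2 : ∀ p q z : Letter, gmul ((![p, q] ∘ σ) 0) ((![p, q] ∘ σ) 1) z =
      gmul ((![q, p] ∘ σ) 0) ((![q, p] ∘ σ) 1) z := by
    intro p q z
    rcases perm_fin_two σ with rfl | rfl <;> simp [gmul_comm p q]
  have h1 : component 3 (∑ p, ∑ q, ∑ r, ∑ t, gmul r t .y * (∑ z, (cobracket z ((![r, t] ∘ τ) 0)
      ((![r, t] ∘ τ) 1) : Grass) * gmul ((![p, q] ∘ σ) 0) ((![p, q] ∘ σ) 1) z) *
        (cobracket .x p q : Grass)) = 0 := by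
    have h3 := h
    simp only [fun p q z => h2 q p z] at h3
    have h4 := congrArg (component 3) h3
    rw [map_neg] at h4
    linarith
  rw [h1, mul_zero]

theorem sum_permute {M : Type*} [AddCommMonoid M] {I : Type*} [Fintype I]
    (f : I → I → I → I → I → M) :
    ∑ p, ∑ q, ∑ r, ∑ t, ∑ z, f p q r t z = ∑ t, ∑ z, ∑ p, ∑ r, ∑ q, f p q r t z := by
  simp only [← Fintype.sum_prod_type']
  exact Fintype.sum_equiv
    { toFun := fun i => (i.2.2.2.1, i.2.2.2.2, i.1, i.2.2.1, i.2.1)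
      invFun := fun i => (i.2.2.1, i.2.2.2.2, i.2.2.2.1, i.1, i.2.1)
      left_inv := fun i => rfl
      right_inv := fun i => rfl } _ _ fun i => rfl

/-- A zigzag between a comultiplication and a multiplication is the composite `genusTwoGraph`,
up to exchanges of inputs and outputs at its vertices. -/
theorem sum_zigzag : ∑ p, ∑ q, ∑ r, ∑ t, gmul r t .y * eval zigzag ![p, q] ![r, t] *
    (cobracket .x p q : Grass) = ⟨0, 0, 0, 3⟩ := by
  have h := sum_permute fun p q r t z => gmul r t .y * (gmul p z r * (cobracket q z t : Grass)) *
    (cobracket .x p q : Grass)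
  rw [← eval_genusTwoGraph_aux]
  refine Eq.trans ?_ (h.trans ?_)
  · refine Finset.sum_congr rfl fun p _ => Finset.sum_congr rfl fun q _ =>
      Finset.sum_congr rfl fun r _ => Finset.sum_congr rfl fun t _ => ?_
    rw [eval_zigzag, Finset.mul_sum, Finset.sum_mul]
    rfl
  · refine Finset.sum_congr rfl fun t _ => Finset.sum_congr rfl fun z _ =>
      Finset.sum_congr rfl fun p _ => ?_
    push_cast
    rw [Finset.sum_mul]
    refine Finset.sum_congr rfl fun r _ => ?_
    rw [Finset.mul_sum]
    refine Finset.sum_congr rfl fun q _ => ?_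
    rw [cast_cobracket_anticomm q z t, cast_cobracket_anticomm .x p q, gmul_comm r t, gmul_comm p z]
    simp only [mul_assoc, mul_neg, neg_mul, neg_neg]

theorem coeff_relabel_zigzag_genusTwoMiddle (σ τ : Equiv.Perm (Fin 2)) :
    coeff (relabel σ τ zigzag) genusTwoMiddle = ((Equiv.Perm.sign σ : ℤ) : ℝ) := by
  rw [coeff_genusTwoMiddle (s := relabel σ τ zigzag) (by simp [genus])]
  simp only [eval_relabel]
  have h : ∀ p q : Letter, ![p, q] ∘ (Equiv.swap (0 : Fin 2) 1) = ![q, p] := by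
    intro p q; funext i; fin_cases i <;> rfl
  have hτ : ∀ p q : Letter, ∑ r, ∑ t, gmul r t .y * eval zigzag (![p, q] ∘ σ) (![r, t] ∘ τ) =
      ∑ r, ∑ t, gmul r t .y * eval zigzag (![p, q] ∘ σ) ![r, t] := by
    intro p q
    rcases perm_fin_two τ with rfl | rfl
    · rfl
    · simp only [h]
      exact sum_gmul_mul_swap (fun r t => eval zigzag (![p, q] ∘ σ) ![r, t]) .y
  have h1 := sum_zigzag
  simp only [← Finset.sum_mul] at h1 ⊢
  simp only [hτ]
  rcases perm_fin_two σ with rfl | rfl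
  · refine (congrArg (fun g => (1 / 3 : ℝ) * component 3 g) h1).trans ?_
    simp [component]
  · simp only [h]
    refine (congrArg (fun g => (1 / 3 : ℝ) * component 3 g) ((sum_mul_cobracket_swap (fun p q =>
      ∑ r, ∑ t, gmul r t .y * eval zigzag ![p, q] ![r, t]) .x).trans (congrArg Neg.neg h1))).trans
        ?_
    simp [component]

theorem coeff_relabel_swap_genusTwoUpper (σ τ : Equiv.Perm (Fin 3)) :
    coeff (relabel (Equiv.refl _) ((Equiv.swap 0 1).trans τ) comultComult) (genusTwoUpper σ) =
      -coeff (relabel (Equiv.refl _) τ comultComult) (genusTwoUpper σ) := by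
  rw [coeff_genusTwoUpper _ (by simp [genus]), coeff_genusTwoUpper _ (by simp [genus]),
    ← mul_neg, ← map_neg, ← Finset.sum_neg_distrib]
  refine congrArg (fun g => (1 / 3 : ℝ) * component 3 g) ?_
  refine Finset.sum_congr rfl fun z _ => ?_
  rw [eval_relabel, eval_relabel, eval_comultComult, eval_comultComult, ← mul_neg]
  congr 1
  rw [← Int.cast_neg, ← Finset.sum_neg_distrib]
  congr 1
  refine Finset.sum_congr rfl fun p _ => ?_
  simp [cobracket_anticomm p (z (τ 1)), Equiv.swap_apply_of_ne_of_ne]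

theorem genusTwoUpper_swap_trans (σ : Equiv.Perm (Fin 3)) :
    genusTwoUpper ((Equiv.swap 1 2).trans σ) = genusTwoUpper σ := by
  refine gen_ext fun t ht => ?_
  rw [coeff_genusTwoUpper _ ht, coeff_genusTwoUpper _ ht]
  refine congrArg (fun g => (1 / 3 : ℝ) * component 3 g) ?_
  refine Finset.sum_congr rfl fun z _ => ?_
  congr 1
  rw [eval_multMult, eval_multMult]
  refine Finset.sum_congr rfl fun p _ => ?_
  rw [gmul_comm ((z ∘ σ) 1)]
  simp [Equiv.swap_apply_of_ne_of_ne]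

end

/-! ### Equivariance of tensoring with the identity -/

section

namespace Op

variable {N : ℕ} [NeZero N]

theorem koszulSign_finRotate {n : ℕ} (w : Fin (n + 1) → Cell N) :
    koszulSign (finRotate (n + 1)) w =
      (-1) ^ (cellDeg (w (Fin.last n)) * tensorDeg (Fin.init w)) := by
  rw [koszulSign, Fin.prod_univ_castSucc]
  have h1 : ∀ i j : Fin n, ¬(finRotate (n + 1) j.castSucc < finRotate (n + 1) i.castSucc ∧
      i.castSucc < j.castSucc) := by
    intro i j h
    rw [finRotate_apply, finRotate_apply, Fin.coeSucc_eq_succ, Fin.coeSucc_eq_succ] at h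
    simp at h
    omega
  simp only [Fin.prod_univ_castSucc]
  rw [tensorDeg, Finset.mul_sum, ← Finset.prod_pow_eq_pow_sum, Finset.prod_mul_distrib]
  have h2 : ∀ i j : Fin n, (if i.castSucc < j.castSucc ∧ finRotate (n + 1) j.castSucc <
      finRotate (n + 1) i.castSucc then (-1 : ℝ) ^ (cellDeg (w i.castSucc) * cellDeg (w j.castSucc))
      else 1) = 1 := by
    intro i j
    rw [if_neg]
    exact fun h => h1 i j h.symm
  have h3 : ∀ j : Fin n, (if Fin.last n < j.castSucc ∧ finRotate (n + 1) j.castSucc <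
      finRotate (n + 1) (Fin.last n) then
        (-1 : ℝ) ^ (cellDeg (w (Fin.last n)) * cellDeg (w j.castSucc)) else 1) = 1 := by
    intro j
    rw [if_neg]
    exact fun h => absurd h.1 (not_lt.2 (Fin.le_last _))
  simp only [h2, h3, Finset.prod_const_one, _root_.one_mul]
  rw [if_neg (by simp), _root_.mul_one]
  refine Finset.prod_congr rfl fun i _ => ?_
  rw [if_pos, _root_.mul_comm]
  · rfl
  · refine ⟨Fin.castSucc_lt_last i, ?_⟩
    rw [finRotate_apply, finRotate_apply, Fin.coeSucc_eq_succ]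
    simp

theorem tensorRight_eq {m n : ℕ} (f : Op N m n) :
    tensorRight f = relabel (finRotate (m + 1)) (finRotate (n + 1)) (tensorLeft f) := by
  funext x y
  have hi : ∀ {k : ℕ} (w : Fin (k + 1) → Cell N), Fin.init (w ∘ finRotate (k + 1)) = Fin.tail w :=
    by
    intro k w
    funext i
    simp [Fin.init, Fin.tail]
  have hl : ∀ {k : ℕ} (w : Fin (k + 1) → Cell N), (w ∘ finRotate (k + 1)) (Fin.last k) = w 0 := by
    intro k w
    simp
  rw [relabel, koszulSign_finRotate, koszulSign_finRotate, tensorLeft, tensorRight]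
  simp only [hi, hl]
  by_cases h : x 0 = y 0
  · rw [if_pos h, if_pos h, ← h, ← pow_add, _root_.add_mul, _root_.mul_comm (cellDeg _),
      _root_.mul_comm (cellDeg _),
      _root_.add_comm]
  · rw [if_neg h, if_neg h, MulZeroClass.mul_zero]

theorem tensorD_succ {n : ℕ} (x y : Fin (n + 1) → Cell N) :
    tensorD x y = (if x (Fin.last n) = y (Fin.last n) then tensorD (Fin.init x) (Fin.init y) else
      0) +
      if Fin.init x = Fin.init y then
        (-1) ^ tensorDeg (Fin.init x) * cellD (x (Fin.last n)) (y (Fin.last n)) else 0 := by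
  rw [tensorD, Fin.sum_univ_castSucc]
  congr 1
  · by_cases h : x (Fin.last n) = y (Fin.last n)
    · rw [if_pos h]
      refine Finset.sum_congr rfl fun i _ => ?_
      have h1 : (∀ j, j ≠ i.castSucc → x j = y j) ↔ ∀ j, j ≠ i → Fin.init x j = Fin.init y j := by
        constructor
        · intro H j hj
          exact H j.castSucc (by simpa using hj)
        · intro H j hj
          refine Fin.lastCases (fun _ => h) (fun j hj => ?_) j hj
          exact H j (by simpa using hj)
      simp only [h1]
      split_ifs
      · congr 2
        rw [Finset.sum_filter, Finset.sum_filter, Fin.sum_univ_castSucc, if_neg, add_zero]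
        · simp [Fin.init]
        · exact not_lt.2 (Fin.le_last _)
      · rfl
    · rw [if_neg h]
      refine Finset.sum_eq_zero fun i _ => if_neg fun H => h (H _ (Fin.castSucc_lt_last i).ne')
  · have h1 : (∀ j, j ≠ Fin.last n → x j = y j) ↔ Fin.init x = Fin.init y := by
      constructor
      · intro H
        funext j
        exact H j.castSucc (Fin.castSucc_lt_last j).ne
      · intro H j hj
        refine Fin.lastCases (fun h => absurd rfl h) (fun j _ => congrFun H j) j hj
    simp only [h1]
    split_ifs
    · congr 2
      rw [Finset.sum_filter, Fin.sum_univ_castSucc, if_neg (lt_irrefl _), add_zero, tensorDeg]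
      refine Finset.sum_congr rfl fun i _ => ?_
      rw [if_pos (Fin.castSucc_lt_last i)]
      rfl
    · rfl

theorem tensorLeft_mul_d_apply {m n : ℕ} (f : Op N m n) (x : Fin (m + 1) → Cell N)
    (y : Fin (n + 1) → Cell N) :
    (tensorLeft f ⊙ d) x y =
      (if x (Fin.last m) = y (Fin.last n) then (f ⊙ d) (Fin.init x) (Fin.init y) else 0) +
      f (Fin.init x) (Fin.init y) *
        ((-1) ^ tensorDeg (Fin.init y) * cellD (x (Fin.last m)) (y (Fin.last n))) := by
  rw [mul, ← (Fin.snocEquiv fun _ => Cell N).sum_comp, Fintype.sum_prod_type, Finset.sum_comm]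
  simp only [tensorLeft, Fin.snocEquiv, d, tensorD_succ, Equiv.coe_fn_mk, Fin.snoc_last,
    Fin.init_snoc, ite_mul, MulZeroClass.zero_mul, Finset.sum_ite_eq, Finset.mem_univ, if_true,
    _root_.mul_add, Finset.sum_add_distrib, mul_ite, MulZeroClass.mul_zero, Finset.sum_ite_eq']
  congr 1
  · split_ifs <;> simp [mul]
  · rw [Finset.sum_comm]
    simp

theorem d_mul_tensorLeft_apply {m n : ℕ} (f : Op N m n) (x : Fin (m + 1) → Cell N)
    (y : Fin (n + 1) → Cell N) :
    (d ⊙ tensorLeft f) x y =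
      (if x (Fin.last m) = y (Fin.last n) then (d ⊙ f) (Fin.init x) (Fin.init y) else 0) +
      f (Fin.init x) (Fin.init y) *
        ((-1) ^ tensorDeg (Fin.init x) * cellD (x (Fin.last m)) (y (Fin.last n))) := by
  rw [mul, ← (Fin.snocEquiv fun _ => Cell N).sum_comp, Fintype.sum_prod_type, Finset.sum_comm]
  simp only [tensorLeft, Fin.snocEquiv, d, tensorD_succ, Equiv.coe_fn_mk, Fin.snoc_last,
    Fin.init_snoc, ite_mul, MulZeroClass.zero_mul, Finset.sum_ite_eq, Finset.mem_univ, if_true,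
    _root_.add_mul, Finset.sum_add_distrib, mul_ite, MulZeroClass.mul_zero, Finset.sum_ite_eq']
  congr 1
  · split_ifs <;> simp [mul]
  · ring

/-- If `f` commutes with the differential up to the sign `c = (-1) ^ deg f`, so does `f ⊗ id`. -/
theorem tensorLeft_mul_d {m n : ℕ} {f : Op N m n} {r : ℤ} (hf : f.IsHomogeneous r) (c : ℝ)
    (hc : ∀ p q : ℕ, (p : ℤ) - q = r → (-1 : ℝ) ^ p = c * (-1) ^ q) (h : f ⊙ d = c • (d ⊙ f)) :
    tensorLeft f ⊙ d = c • (d ⊙ tensorLeft f) := by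
  funext x y
  rw [Pi.smul_apply, Pi.smul_apply, tensorLeft_mul_d_apply, d_mul_tensorLeft_apply, h, smul_eq_mul,
    _root_.mul_add]
  congr 1
  · split_ifs <;> simp
  · by_cases h0 : f (Fin.init x) (Fin.init y) = 0
    · simp [h0]
    · rw [hc _ _ (hf _ _ h0)]
      ring

theorem tensorLeft_mul_d_of_degree_zero {m n : ℕ} {f : Op N m n} (hf : f.IsHomogeneous 0)
    (h : f ⊙ d = d ⊙ f) : tensorLeft f ⊙ d = d ⊙ tensorLeft f := by
  simpa using tensorLeft_mul_d hf 1 (fun p q h => by rw [sub_eq_zero] at h; norm_cast at h; simp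
    [h])
    (by simpa using h)

theorem tensorLeft_mul_d_of_degree_one {m n : ℕ} {f : Op N m n} (hf : f.IsHomogeneous 1)
    (h : f ⊙ d = -(d ⊙ f)) : tensorLeft f ⊙ d = -(d ⊙ tensorLeft f) := by
  simpa using tensorLeft_mul_d hf (-1) (fun p q h => by
    obtain rfl : p = q + 1 := by omega
    rw [pow_succ]; ring) (by simpa using h)

theorem koszulSign_swap_three (w : Fin 3 → Cell N) :
    koszulSign (Equiv.swap (0 : Fin 3) 1) w = koszulSign (Equiv.swap (0 : Fin 2) 1) (Fin.init w) :=
      by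
  simp [koszulSign, Fin.prod_univ_three, Fin.prod_univ_two, Fin.init, Equiv.swap_apply_of_ne_of_ne]

theorem relabel_swap_tensorLeft (f : Op N 1 2) :
    relabel (Equiv.refl _) (Equiv.swap 0 1) (tensorLeft f) =
      tensorLeft (relabel (Equiv.refl _) (Equiv.swap 0 1) f) := by
  funext x y
  have h1 : Fin.init (y ∘ Equiv.swap (0 : Fin 3) 1) = Fin.init y ∘ Equiv.swap (0 : Fin 2) 1 := by
    funext i; fin_cases i <;> rfl
  have h2 : (y ∘ Equiv.swap (0 : Fin 3) 1) (Fin.last 2) = y (Fin.last 2) := rfl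
  have h3 := koszulSign_swap_three (y ∘ Equiv.swap (0 : Fin 3) 1)
  rw [h1] at h3
  simp only [relabel, tensorLeft, h1, h2, koszulSign_refl]
  split_ifs
  · exact congrArg₂ (· * ·) (congrArg _ h3) rfl
  · simp_all
  · simp_all
  · simp

theorem relabel_tensorLeft_swap (f : Op N 2 1) :
    relabel (Equiv.swap 0 1) (Equiv.refl _) (tensorLeft f) =
      tensorLeft (relabel (Equiv.swap 0 1) (Equiv.refl _) f) := by
  funext x y
  have h1 : Fin.init (x ∘ Equiv.swap (0 : Fin 3) 1) = Fin.init x ∘ Equiv.swap (0 : Fin 2) 1 := by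
    funext i; fin_cases i <;> rfl
  have h2 : (x ∘ Equiv.swap (0 : Fin 3) 1) (Fin.last 2) = x (Fin.last 2) := rfl
  have h3 := koszulSign_swap_three (x ∘ Equiv.swap (0 : Fin 3) 1)
  rw [h1] at h3
  simp only [relabel, tensorLeft, h1, h2, koszulSign_refl]
  split_ifs
  · exact congrArg₂ (· * ·) (congrArg (· * (1 : ℝ)) h3) rfl
  · simp_all
  · simp_all
  · simp

theorem sum_perm_fin_three {M : Type*} [AddCommMonoid M] (f : Equiv.Perm (Fin 3) → M) :
    ∑ τ, f τ = f (Equiv.refl _) + f (Equiv.swap 0 1) + f (finRotate 3) +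
      f ((Equiv.swap 0 1).trans (finRotate 3)) + f (finRotate 3).symm +
      f ((Equiv.swap 0 1).trans (finRotate 3).symm) := by
  have : (Finset.univ : Finset (Equiv.Perm (Fin 3))) = {Equiv.refl _, Equiv.swap 0 1, finRotate 3,
    (Equiv.swap 0 1).trans (finRotate 3), (finRotate 3).symm,
    (Equiv.swap 0 1).trans (finRotate 3).symm} := by decide
  rw [this, Finset.sum_insert (by decide), Finset.sum_insert (by decide),
    Finset.sum_insert (by decide), Finset.sum_insert (by decide), Finset.sum_insert (by decide),
    Finset.sum_singleton]
  simp only [add_assoc]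

theorem sum_perm_fin_two {M : Type*} [AddCommMonoid M] (f : Equiv.Perm (Fin 2) → M) :
    ∑ τ, f τ = f (Equiv.refl _) + f (Equiv.swap 0 1) := by
  have : (Finset.univ : Finset (Equiv.Perm (Fin 2))) = {Equiv.refl _, Equiv.swap 0 1} := by decide
  rw [this, Finset.sum_pair (by decide)]

end Op

end

/-! ### The operations of the first few generators -/

section

namespace Op

variable {N : ℕ} [NeZero N]

theorem mul_relabel_left {m n p : ℕ} (σ : Equiv.Perm (Fin n)) (A : Op N m n) (Z : Op N n p) :
    relabel (Equiv.refl _) σ A ⊙ relabel σ (Equiv.refl _) Z = A ⊙ Z := by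
  rw [← relabel_mul, relabel_refl]

theorem mul_relabel_swap {p q : ℕ} {A : Op N p 2}
    (hA : relabel (Equiv.refl _) (Equiv.swap 0 1) A = -A) (Z : Op N 2 q) :
    A ⊙ relabel (Equiv.swap 0 1) (Equiv.refl _) Z = -(A ⊙ Z) := by
  rw [← mul_relabel_left (Equiv.swap 0 1) A Z, hA, neg_mul, neg_neg]

theorem relabel_refl_mul {m n p p' : ℕ} (τ : Fin p ≃ Fin p') (f : Op N m n) (g : Op N n p) :
    relabel (Equiv.refl _) τ (f ⊙ g) = f ⊙ relabel (Equiv.refl _) τ g := by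
  rw [relabel_mul (Equiv.refl _) (Equiv.refl _) τ, relabel_refl]

theorem mul_tensorRight_eq {p q : ℕ} {A : Op N p 2}
    (hA : relabel (Equiv.refl _) (Equiv.swap 0 1) A = -A) (f : Op N 1 q) :
    A ⊙ tensorRight f = -relabel (Equiv.refl _) (finRotate (q + 1)) (A ⊙ tensorLeft f) := by
  have h : (finRotate (1 + 1) : Equiv.Perm (Fin 2)) = Equiv.swap 0 1 := by decide
  rw [tensorRight_eq, relabel_mul (Equiv.refl _) (Equiv.swap 0 1), hA, neg_mul, neg_neg]
  exact congrArg (fun e => A ⊙ relabel e (finRotate (q + 1)) (tensorLeft f)) h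

theorem tensorRight_mul_eq {p q : ℕ} {m : Op N 2 p}
    (hm : relabel (Equiv.swap 0 1) (Equiv.refl _) m = m) (f : Op N q 1) :
    tensorRight f ⊙ m = relabel (finRotate (q + 1)) (Equiv.refl _) (tensorLeft f ⊙ m) := by
  have h : (finRotate (1 + 1) : Equiv.Perm (Fin 2)) = Equiv.swap 0 1 := by decide
  rw [tensorRight_eq, relabel_mul (finRotate (q + 1)) (Equiv.swap 0 1), hm]
  exact congrArg (fun e => relabel (finRotate (q + 1)) e (tensorLeft f) ⊙ m) h

end Op

open Op

/-- The operations by which the first few generators act, with the relations between them that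
the derivatives of the generators impose. The operations `m` and `Δ` are the multiplication and
the comultiplication, `G` and `H` are of genus one, `F` is a homotopy for the Frobenius
relation, `B` and `M i` are homotopies for associativity, and `Y` and `X i` are homotopies for
coassociativity. All of them arise from decompositions of the genus-two generator; that along
three edges is `∑ i, M i ⊗ X i`.

The numbers `x i τ`, `c i τ` and `y τ` are the coefficients, on the permutations of a double
comultiplication or multiplication, of the generators that act by `X i`, `M i` and `Y`. The
relations for `G` and `F` are recorded after composition with an operation `A` that is
antisymmetric in its outputs, which combines the summands of the derivative. -/
structure FewOperations (N ℓ : ℕ) [NeZero N] where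
  m : Op N 2 1
  Δ : Op N 1 2
  G : Op N 2 1
  H : Op N 1 2
  F : Op N 2 2
  B : Op N 3 1
  Y : Op N 1 3
  ι : Type
  fintype : Fintype ι
  X : ι → Op N 1 3
  M : ι → Op N 3 1
  x : ι → Equiv.Perm (Fin 3) → ℝ
  c : ι → Equiv.Perm (Fin 3) → ℝ
  y : Equiv.Perm (Fin 3) → ℝ
  isHomogeneous_m : m.IsHomogeneous 0
  isHomogeneous_Δ : Δ.IsHomogeneous 1
  isHomogeneous_G : G.IsHomogeneous (-1)
  isHomogeneous_H : H.IsHomogeneous 0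
  isHomogeneous_F : F.IsHomogeneous 0
  isHomogeneous_X : ∀ i, (X i).IsHomogeneous 1
  isHomogeneous_M : ∀ i, (M i).IsHomogeneous (-1)
  isQuasilocal_m : m.IsQuasilocal ℓ
  isQuasilocal_Δ : Δ.IsQuasilocal ℓ
  isQuasilocal_G : G.IsQuasilocal ℓ
  isQuasilocal_H : H.IsQuasilocal ℓ
  isQuasilocal_F : F.IsQuasilocal ℓ
  isQuasilocal_Y : Y.IsQuasilocal ℓ
  isQuasilocal_X : ∀ i, (X i).IsQuasilocal ℓ
  isQuasilocal_M : ∀ i, (M i).IsQuasilocal ℓ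
  induces_m : m.Induces cohomMult
  induces_Δ : Δ.Induces cohomComult
  relabel_m : relabel (Equiv.swap 0 1) (Equiv.refl _) m = m
  relabel_Δ : relabel (Equiv.refl _) (Equiv.swap 0 1) Δ = -Δ
  mul_d_G : ∀ {p : ℕ} (A : Op N p 2), relabel (Equiv.refl _) (Equiv.swap 0 1) A = -A →
    A ⊙ (G ⊙ d + d ⊙ G) = A ⊙ tensorLeft Δ ⊙ B - (1 / 2 : ℝ) • (A ⊙ F ⊙ m)
  mul_d_F : ∀ {p : ℕ} (A : Op N p 2), relabel (Equiv.refl _) (Equiv.swap 0 1) A = -A →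
    A ⊙ (F ⊙ d - d ⊙ F) = (-2 : ℝ) • ∑ τ : Equiv.Perm (Fin 2),
      relabel (Equiv.refl _) τ (A ⊙ tensorRight Δ ⊙ tensorLeft m)
  d_H : H ⊙ d - d ⊙ H =
    -((1 / 2 : ℝ) • ∑ τ : Equiv.Perm (Fin 2), relabel (Equiv.refl _) τ (Y ⊙ tensorLeft m)) -
      (1 / 4 : ℝ) • ∑ τ : Equiv.Perm (Fin 2), relabel (Equiv.refl _) τ (Δ ⊙ F)
  d_X : ∀ i, X i ⊙ d + d ⊙ X i = (1 / 2 : ℝ) • ∑ τ : Equiv.Perm (Fin 3),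
    x i τ • relabel (Equiv.refl _) τ (Δ ⊙ tensorLeft Δ)
  d_M : ∀ i, M i ⊙ d + d ⊙ M i = -((1 / 2 : ℝ) • ∑ τ : Equiv.Perm (Fin 3),
    c i τ • relabel τ (Equiv.refl _) (tensorLeft m ⊙ m))
  sum_x : ∀ τ, ∑ i, x i τ • M i = relabel τ (Equiv.refl _) B
  sum_c : ∀ τ, ∑ i, c i τ • X i = relabel (Equiv.refl _) τ Y
  sum_mul : ∀ ρ τ, ∑ i, c i ρ * x i τ = y (τ.trans ρ.symm)
  y_refl : y (Equiv.refl _) = 0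
  y_rotate : y (finRotate 3) = -1
  y_rotate_symm : y (finRotate 3).symm = 1
  y_swap : ∀ τ, y ((Equiv.swap 0 1).trans τ) = -y τ

namespace FewOperations

attribute [instance] FewOperations.fintype

end FewOperations

section Construct

variable {N ℓ : ℕ} [NeZero N] {η : GenMap N} (hη : IsAction firstFewBefore η)

theorem mem_firstFewBefore {β m n : ℕ} (h : β + m + n ≤ 4) (h' : β ≠ 2) :
    (β, m, n) ∈ firstFewBefore := by
  simp [firstFewBefore, firstFew, h, h']

include hη

theorem map_multGen_swap :
    relabel (Equiv.swap 0 1) (Equiv.refl _) (η 0 2 1 multGen) = η 0 2 1 multGen := by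
  refine (hη.equivariant (mem_firstFewBefore (by norm_num) (by norm_num)) (Equiv.swap 0 1)
    (Equiv.refl _) multGen multGen fun t => ?_).symm
  by_cases ht : t.genus = 0
  · have h := Cong.mult_of_genus_zero t ht
    refine coeff_eq_of_cong_one _ ?_
    have h1 := Cong.relabel (Equiv.swap (0 : Fin 2) 1) (Equiv.refl (Fin 1)) h
    simpa using (h1.trans Cong.mult_comm).trans h.symm
  · rw [coeff_eq_zero _ ht, coeff_eq_zero _ (t := Composite.relabel (Equiv.swap 0 1) (Equiv.refl _)
      t)
      (by rwa [genus])]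

theorem map_comultGen_swap :
    relabel (Equiv.refl _) (Equiv.swap 0 1) (η 0 1 2 comultGen) = -η 0 1 2 comultGen := by
  rw [← map_neg]
  refine (hη.equivariant (mem_firstFewBefore (by norm_num) (by norm_num)) (Equiv.refl _)
    (Equiv.swap 0 1) comultGen (-comultGen) fun t => ?_).symm
  by_cases ht : t.genus = 0
  · obtain ⟨ε, h⟩ := Cong.comult_of_genus_zero t ht
    have h1 := Cong.relabel (Equiv.refl (Fin 1)) (Equiv.swap (0 : Fin 2) 1) h
    have h2 := coeff_eq_of_cong comultGen ((h1.trans Cong.comult_anticomm).trans h.symm)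
    rw [map_neg, h2]
    rcases Int.units_eq_one_or ε with rfl | rfl <;> simp
  · rw [coeff_eq_zero _ ht, coeff_eq_zero _ (t := Composite.relabel (Equiv.refl _) (Equiv.swap 0 1)
      t)
      (by rwa [genus])]

theorem map_genusTwoLower (τ : Equiv.Perm (Fin 3)) :
    η 0 3 1 (genusTwoLower τ) =
      relabel τ (Equiv.refl _) (η 0 3 1 (genusTwoLower (Equiv.refl _))) :=
  hη.equivariant (mem_firstFewBefore (by norm_num) (by norm_num)) τ (Equiv.refl _) _ _
    (coeff_relabel_genusTwoLower τ)

theorem map_genusTwoUpper (σ τ : Equiv.Perm (Fin 3)) :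
    η 0 1 3 (genusTwoUpper (σ.trans τ)) =
      relabel (Equiv.refl _) τ (η 0 1 3 (genusTwoUpper σ)) :=
  hη.equivariant (mem_firstFewBefore (by norm_num) (by norm_num)) (Equiv.refl _) τ _ _
    (coeff_relabel_genusTwoUpper σ τ)

theorem mul_bracketD_genusTwoInput {p : ℕ} {A : Op N p 2}
    (hA : relabel (Equiv.refl _) (Equiv.swap 0 1) A = -A) :
    A ⊙ (η 1 2 1 genusTwoInput).bracketD =
      A ⊙ tensorLeft (η 0 1 2 comultGen) ⊙ η 0 3 1 (genusTwoLower (Equiv.refl _)) -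
        (1 / 2 : ℝ) • (A ⊙ η 0 2 2 genusTwoMiddle ⊙ η 0 2 1 multGen) := by
  have h1 : A ⊙ tensorRight (η 0 1 2 comultGen) ⊙ η 0 3 1 (genusTwoLower (finRotate 3)) =
      -(A ⊙ tensorLeft (η 0 1 2 comultGen) ⊙ η 0 3 1 (genusTwoLower (Equiv.refl _))) := by
    rw [mul_tensorRight_eq hA, map_genusTwoLower hη, Op.neg_mul]
    exact congrArg Neg.neg (mul_relabel_left _ _ _)
  rw [hη.map_derivative (mem_firstFewBefore (by norm_num) (by norm_num)) _ _
    (isDecomposition_decInput coeff_mult_multGen coeff_comult_comultGen genusTwoInput),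
    imageOfDerivative_decInput]
  simp only [sliceUpper_genusTwoInput, sliceLower_genusTwoInput, sum_perm_fin_two,
    map_smul, Op.mul_smul, Op.smul_mul, relabel_smul, relabel_refl, Op.mul_add,
    mul_relabel_swap hA, ← Op.mul_assoc, h1]
  simp only [Equiv.Perm.sign_refl, Equiv.Perm.sign_swap (show (0 : Fin 2) ≠ 1 by decide)]
  push_cast
  module

theorem mul_bracketD_genusTwoMiddle {p : ℕ} {A : Op N p 2}
    (hA : relabel (Equiv.refl _) (Equiv.swap 0 1) A = -A) :
    A ⊙ (η 0 2 2 genusTwoMiddle).bracketD = (-2 : ℝ) • ∑ τ : Equiv.Perm (Fin 2),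
      relabel (Equiv.refl _) τ
        (A ⊙ tensorRight (η 0 1 2 comultGen) ⊙ tensorLeft (η 0 2 1 multGen)) := by
  have h : ∀ (τ : Equiv.Perm (Fin 2)) (Z : Op N 2 2), A ⊙ relabel (Equiv.swap 0 1) τ Z =
      -relabel (Equiv.refl _) τ (A ⊙ Z) := by
    intro τ Z
    rw [relabel_mul (Equiv.refl _) (Equiv.swap 0 1), hA, Op.neg_mul, neg_neg]
  rw [hη.map_derivative (mem_firstFewBefore (by norm_num) (by norm_num)) _ _
    (isDecomposition_decFrob coeff_mult_multGen coeff_comult_comultGen genusTwoMiddle),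
    imageOfDerivative_decFrob]
  simp only [coeff_relabel_comultMult_genusTwoMiddle, coeff_relabel_zigzag_genusTwoMiddle,
    sum_perm_fin_two, Op.mul_smul, Op.mul_add, Op.mul_sub, h, ← relabel_refl_mul, ← Op.mul_assoc,
    relabel_refl]
  simp only [Equiv.Perm.sign_refl, Equiv.Perm.sign_swap (show (0 : Fin 2) ≠ 1 by decide)]
  push_cast
  module

theorem bracketD_genusTwoOutput :
    (η 1 1 2 genusTwoOutput).bracketD =
      -((1 / 2 : ℝ) • ∑ τ : Equiv.Perm (Fin 2), relabel (Equiv.refl _) τ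
        (η 0 1 3 (genusTwoUpper (finRotate 3).symm) ⊙ tensorLeft (η 0 2 1 multGen))) -
      (1 / 4 : ℝ) • ∑ τ : Equiv.Perm (Fin 2), relabel (Equiv.refl _) τ
        (η 0 1 2 comultGen ⊙ η 0 2 2 genusTwoMiddle) := by
  rw [hη.map_derivative (mem_firstFewBefore (by norm_num) (by norm_num)) _ _
    (isDecomposition_decOutput coeff_mult_multGen coeff_comult_comultGen genusTwoOutput),
    imageOfDerivative_decOutput]
  simp only [sliceUpper_genusTwoOutput, sliceLower_genusTwoOutput, sum_perm_fin_two]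
  module

theorem bracketD_coassociator (q : Gen 0 1 3) :
    (η 0 1 3 q).bracketD = (1 / 2 : ℝ) • ∑ τ : Equiv.Perm (Fin 3),
      coeff (relabel (Equiv.refl _) τ comultComult) q • relabel (Equiv.refl _) τ
        (η 0 1 2 comultGen ⊙ tensorLeft (η 0 1 2 comultGen)) := by
  rw [hη.map_derivative (mem_firstFewBefore (by norm_num) (by norm_num)) _ _
    (isDecomposition_decCoassoc coeff_comult_comultGen q), imageOfDerivative_decCoassoc,
    Finset.smul_sum]
  norm_num

theorem bracketD_associator (q : Gen 0 3 1) :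
    (η 0 3 1 q).bracketD = -((1 / 2 : ℝ) • ∑ τ : Equiv.Perm (Fin 3),
      coeff (relabel ((finRotate 3).symm.trans τ) (Equiv.refl _) multMult) q •
        relabel τ (Equiv.refl _) (tensorLeft (η 0 2 1 multGen) ⊙ η 0 2 1 multGen)) := by
  rw [hη.map_derivative (mem_firstFewBefore (by norm_num) (by norm_num)) _ _
    (isDecomposition_decAssoc coeff_mult_multGen q), imageOfDerivative_decAssoc,
    Finset.smul_sum, ← Finset.sum_neg_distrib]
  refine Fintype.sum_equiv (Equiv.mulRight (finRotate 3)) _ _ fun τ => ?_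
  have h1 : (finRotate 3).symm.trans (Equiv.mulRight (finRotate 3) τ) = τ := by
    ext i; simp
  have h2 : Equiv.mulRight (finRotate 3) τ = (finRotate 3).trans τ := rfl
  rw [h1, tensorRight_mul_eq (map_multGen_swap hη), relabel_relabel, h2]
  norm_num

end Construct

variable {N ℓ : ℕ} [NeZero N]

theorem coeff_relabel_genusTwoUpper_of_trans (ρ τ : Equiv.Perm (Fin 3)) :
    coeff (relabel (Equiv.refl _) τ comultComult) (genusTwoUpper ((finRotate 3).symm.trans ρ)) =
      coeff (relabel (Equiv.refl _) (τ.trans ρ.symm) comultComult)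
        (genusTwoUpper (finRotate 3).symm) := by
  rw [← coeff_relabel_genusTwoUpper (finRotate 3).symm ρ]
  refine coeff_eq_of_cong_one _ ?_
  have h := Cong.relabel_trans (Equiv.refl _) (Equiv.refl _) (τ.trans ρ.symm) ρ comultComult
  simpa [Equiv.trans_assoc] using h.symm

theorem coeff_rotate_symm_genusTwoUpper :
    coeff (relabel (Equiv.refl _) (finRotate 3).symm comultComult)
      (genusTwoUpper (finRotate 3).symm) = 1 :=
  (coeff_relabel_genusTwoUpper (Equiv.refl _) (finRotate 3).symm comultComult).trans
    coeff_comultComult_genusTwoUpper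

theorem coeff_rotate_genusTwoUpper :
    coeff (relabel (Equiv.refl _) (finRotate 3) comultComult)
      (genusTwoUpper (finRotate 3).symm) = -1 := by
  have h1 := (coeff_relabel_genusTwoUpper (Equiv.refl _)
    ((Equiv.swap 1 2).trans (finRotate 3).symm) comultComult).trans coeff_comultComult_genusTwoUpper
  have h2 : (Equiv.swap (1 : Fin 3) 2).trans (finRotate 3).symm =
    (Equiv.swap 0 1).trans (finRotate 3) := by decide
  rw [Equiv.refl_trans, genusTwoUpper_swap_trans, h2, coeff_relabel_swap_genusTwoUpper] at h1
  linarith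

/-- The coefficients on the three rotations add up to zero, as for all elements of the shifted
relations. -/
theorem coeff_comultComult_genusTwoUpper_rotate :
    coeff comultComult (genusTwoUpper (finRotate 3).symm) = 0 := by
  have h := isCoassocRelation_of_mem (genusTwoUpper (finRotate 3).symm).2
  have h2 : (finRotate 3).trans (finRotate 3) = (finRotate 3).symm := by decide
  rw [IsCoassocRelation, h2] at h
  have h3 : (genusTwoUpper (finRotate 3).symm).1
      (Composite.relabel (Equiv.refl _) (finRotate 3).symm comultComult) = 1 :=
    coeff_rotate_symm_genusTwoUpper
  have h4 : (genusTwoUpper (finRotate 3).symm).1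
      (Composite.relabel (Equiv.refl _) (finRotate 3) comultComult) = -1 :=
    coeff_rotate_genusTwoUpper
  change (genusTwoUpper (finRotate 3).symm).1 comultComult = 0
  linarith

/-- The operations by which an action represents the generators cut off `genusTwo`. -/
def fewOperations {η : GenMap N} (hη : IsAction firstFewBefore η) (hF : LiftsFrobenius η)
    (hℓ : IsQuasilocalOn firstFewBefore ℓ η) : FewOperations N ℓ where
  m := η 0 2 1 multGen
  Δ := η 0 1 2 comultGen
  G := η 1 2 1 genusTwoInput
  H := η 1 1 2 genusTwoOutput
  F := η 0 2 2 genusTwoMiddle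
  B := η 0 3 1 (genusTwoLower (Equiv.refl _))
  Y := η 0 1 3 (genusTwoUpper (finRotate 3).symm)
  ι := (Fin 3 → Letter) × Fin 4
  fintype := inferInstance
  X i := η 0 1 3 (upperFactor i)
  M i := η 0 3 1 (lowerFactor i)
  x i τ := coeff (relabel (Equiv.refl _) τ comultComult) (upperFactor i)
  c i τ := coeff (relabel ((finRotate 3).symm.trans τ) (Equiv.refl _) multMult) (lowerFactor i)
  y τ := coeff (relabel (Equiv.refl _) τ comultComult) (genusTwoUpper (finRotate 3).symm)
  isHomogeneous_m := hη.homogeneous (mem_firstFewBefore (by norm_num) (by norm_num)) _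
  isHomogeneous_Δ := hη.homogeneous (mem_firstFewBefore (by norm_num) (by norm_num)) _
  isHomogeneous_G := hη.homogeneous (mem_firstFewBefore (by norm_num) (by norm_num)) _
  isHomogeneous_H := hη.homogeneous (mem_firstFewBefore (by norm_num) (by norm_num)) _
  isHomogeneous_F := hη.homogeneous (mem_firstFewBefore (by norm_num) (by norm_num)) _
  isHomogeneous_X i := hη.homogeneous (mem_firstFewBefore (by norm_num) (by norm_num)) _
  isHomogeneous_M i := hη.homogeneous (mem_firstFewBefore (by norm_num) (by norm_num)) _
  isQuasilocal_m := hℓ (mem_firstFewBefore (by norm_num) (by norm_num)) _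
  isQuasilocal_Δ := hℓ (mem_firstFewBefore (by norm_num) (by norm_num)) _
  isQuasilocal_G := hℓ (mem_firstFewBefore (by norm_num) (by norm_num)) _
  isQuasilocal_H := hℓ (mem_firstFewBefore (by norm_num) (by norm_num)) _
  isQuasilocal_F := hℓ (mem_firstFewBefore (by norm_num) (by norm_num)) _
  isQuasilocal_Y := hℓ (mem_firstFewBefore (by norm_num) (by norm_num)) _
  isQuasilocal_X i := hℓ (mem_firstFewBefore (by norm_num) (by norm_num)) _
  isQuasilocal_M i := hℓ (mem_firstFewBefore (by norm_num) (by norm_num)) _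
  induces_m := by simpa [coeff_mult_multGen] using hF.induces_mult multGen
  induces_Δ := by simpa [coeff_comult_comultGen] using hF.induces_comult comultGen
  relabel_m := map_multGen_swap hη
  relabel_Δ := map_comultGen_swap hη
  mul_d_G A hA := by
    rw [← bracketD_of_odd (hη.homogeneous (mem_firstFewBefore (by norm_num) (by norm_num)) _)
      (by decide)]
    exact mul_bracketD_genusTwoInput hη hA
  mul_d_F A hA := by
    rw [← bracketD_of_even (hη.homogeneous (mem_firstFewBefore (by norm_num) (by norm_num)) _)
      (by decide)]
    exact mul_bracketD_genusTwoMiddle hη hA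
  d_H := by
    rw [← bracketD_of_even (hη.homogeneous (mem_firstFewBefore (by norm_num) (by norm_num)) _)
      (by decide)]
    exact bracketD_genusTwoOutput hη
  d_X i := by
    rw [← bracketD_of_odd (hη.homogeneous (mem_firstFewBefore (by norm_num) (by norm_num)) _)
      (by decide)]
    exact bracketD_coassociator hη _
  d_M i := by
    rw [← bracketD_of_odd (hη.homogeneous (mem_firstFewBefore (by norm_num) (by norm_num)) _)
      (by decide)]
    exact bracketD_associator hη _
  sum_x τ := by
    rw [← map_genusTwoLower hη, ← sum_coeff_upperFactor_smul_lowerFactor, map_sum]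
    simp only [map_smul]
  sum_c τ := by
    rw [← map_genusTwoUpper hη, ← sum_coeff_lowerFactor_smul_upperFactor, map_sum]
    simp only [map_smul]
  sum_mul ρ τ := by
    rw [← coeff_relabel_genusTwoUpper_of_trans, ← sum_coeff_lowerFactor_smul_upperFactor, map_sum]
    simp only [map_smul, smul_eq_mul]
  y_refl := (coeff_eq_of_cong_one _ (Cong.relabel_refl comultComult)).trans
    coeff_comultComult_genusTwoUpper_rotate
  y_rotate := coeff_rotate_genusTwoUpper
  y_rotate_symm := coeff_rotate_symm_genusTwoUpper
  y_swap τ := coeff_relabel_swap_genusTwoUpper _ τ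

end

/-! ### The obstruction is closed -/

section

open Op

namespace FewOperations

variable {N ℓ : ℕ} [NeZero N] (S : FewOperations N ℓ)

/-- The image of the derivative of the genus-two generator, a sum over its decompositions. -/
def obstruction : Op N 1 1 :=
  (-2⁻¹ : ℝ) • (S.H ⊙ S.m) + (2⁻¹ : ℝ) • (S.Δ ⊙ S.G) + (6⁻¹ : ℝ) • ∑ i, S.X i ⊙ S.M i

theorem m_mul_d : S.m ⊙ d = d ⊙ S.m := by
  have h := S.induces_m.1
  rwa [bracketD_of_even S.isHomogeneous_m (by decide), sub_eq_zero] at h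

theorem Δ_mul_d : S.Δ ⊙ d = -(d ⊙ S.Δ) := by
  have h := S.induces_Δ.1
  rwa [bracketD_of_odd S.isHomogeneous_Δ (by decide), add_eq_zero_iff_eq_neg] at h

theorem tensorLeft_m_mul_d : tensorLeft S.m ⊙ d = d ⊙ tensorLeft S.m :=
  tensorLeft_mul_d_of_degree_zero S.isHomogeneous_m S.m_mul_d

theorem tensorLeft_Δ_mul_d : tensorLeft S.Δ ⊙ d = -(d ⊙ tensorLeft S.Δ) :=
  tensorLeft_mul_d_of_degree_one S.isHomogeneous_Δ S.Δ_mul_d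

theorem relabel_mul_m {p : ℕ} (τ : Equiv.Perm (Fin 2)) (Z : Op N p 2) :
    relabel (Equiv.refl _) τ Z ⊙ S.m = Z ⊙ S.m := by
  have h : relabel τ (Equiv.refl _) S.m = S.m := by
    rcases perm_fin_two τ with rfl | rfl
    · exact relabel_refl _
    · exact S.relabel_m
  conv_lhs => rw [← h]
  exact mul_relabel_left τ Z S.m

theorem sum_relabel_mul_m {p : ℕ} (Z : Op N p 2) :
    (∑ τ : Equiv.Perm (Fin 2), relabel (Equiv.refl _) τ Z) ⊙ S.m = (2 : ℝ) • (Z ⊙ S.m) := by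
  rw [Op.sum_mul]
  simp [relabel_mul_m, two_smul, Fintype.card_perm]

/-- The obstruction is closed: the terms through `F`, `Y` and `B` in the derivatives of its
three summands cancel. -/
theorem obstruction_mul_d : S.obstruction ⊙ d = d ⊙ S.obstruction := by
  have hG : S.Δ ⊙ S.G ⊙ d - d ⊙ (S.Δ ⊙ S.G) =
      S.Δ ⊙ tensorLeft S.Δ ⊙ S.B - (1 / 2 : ℝ) • (S.Δ ⊙ S.F ⊙ S.m) := by
    rw [← S.mul_d_G S.Δ S.relabel_Δ, Op.mul_add, ← Op.mul_assoc, ← Op.mul_assoc, ← Op.mul_assoc,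
      S.Δ_mul_d, Op.neg_mul, sub_eq_add_neg]
  have hH : S.H ⊙ S.m ⊙ d - d ⊙ (S.H ⊙ S.m) =
      -(S.Y ⊙ tensorLeft S.m ⊙ S.m) - (1 / 2 : ℝ) • (S.Δ ⊙ S.F ⊙ S.m) := by
    rw [Op.mul_assoc S.H, S.m_mul_d, ← Op.mul_assoc, ← Op.mul_assoc, ← Op.sub_mul, S.d_H,
      Op.sub_mul, Op.neg_mul, Op.smul_mul, Op.smul_mul, S.sum_relabel_mul_m, S.sum_relabel_mul_m]
    module
  have hX : ∀ i, S.X i ⊙ S.M i ⊙ d - d ⊙ (S.X i ⊙ S.M i) =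
      S.X i ⊙ (S.M i ⊙ d + d ⊙ S.M i) - (S.X i ⊙ d + d ⊙ S.X i) ⊙ S.M i := by
    intro i
    rw [Op.mul_add, Op.add_mul, Op.mul_assoc, Op.mul_assoc (S.X i), Op.mul_assoc d]
    abel
  have h1 : ∑ i, S.X i ⊙ (S.M i ⊙ d + d ⊙ S.M i) = (-3 : ℝ) • (S.Y ⊙ (tensorLeft S.m ⊙ S.m)) := by
    simp only [S.d_M, Op.mul_neg, Op.mul_smul, Op.mul_sum, Finset.sum_neg_distrib]
    rw [← Finset.smul_sum, Finset.sum_comm]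
    simp only [← Op.smul_mul, ← Op.sum_mul, S.sum_c, mul_relabel_left]
    rw [Finset.sum_const, Finset.card_univ, Fintype.card_perm, Fintype.card_fin]
    simp only [Op.smul_mul, Op.mul_smul, Nat.factorial, ← Nat.cast_smul_eq_nsmul ℝ, smul_smul,
      ← neg_smul]
    norm_num
  have h2 : ∑ i, (S.X i ⊙ d + d ⊙ S.X i) ⊙ S.M i =
      (3 : ℝ) • (S.Δ ⊙ tensorLeft S.Δ ⊙ S.B) := by
    simp only [S.d_X, Op.smul_mul, Op.sum_mul]
    rw [← Finset.smul_sum, Finset.sum_comm]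
    simp only [← Op.mul_smul, ← Op.mul_sum, S.sum_x, mul_relabel_left]
    rw [Finset.sum_const, Finset.card_univ, Fintype.card_perm, Fintype.card_fin]
    simp only [Op.smul_mul, Op.mul_smul, Nat.factorial, ← Nat.cast_smul_eq_nsmul ℝ, smul_smul,
      ← neg_smul]
    norm_num
  rw [← sub_eq_zero]
  have h3 : S.obstruction ⊙ d - d ⊙ S.obstruction =
      (-2⁻¹ : ℝ) • (S.H ⊙ S.m ⊙ d - d ⊙ (S.H ⊙ S.m)) +
      (2⁻¹ : ℝ) • (S.Δ ⊙ S.G ⊙ d - d ⊙ (S.Δ ⊙ S.G)) +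
      (6⁻¹ : ℝ) • ∑ i, (S.X i ⊙ S.M i ⊙ d - d ⊙ (S.X i ⊙ S.M i)) := by
    rw [obstruction, Op.add_mul, Op.add_mul, Op.mul_add, Op.mul_add, Op.smul_mul, Op.smul_mul,
      Op.smul_mul, Op.mul_smul, Op.mul_smul, Op.mul_smul, Op.sum_mul, Op.mul_sum,
      Finset.sum_sub_distrib]
    module
  rw [h3, hG, hH]
  rw [Finset.sum_congr rfl fun i _ => hX i, Finset.sum_sub_distrib, h1, h2, ← Op.mul_assoc]
  module

theorem isHomogeneous_obstruction : S.obstruction.IsHomogeneous 0 := by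
  intro x y h
  by_contra hne
  have h1 : (S.H ⊙ S.m) x y = 0 := by
    by_contra h0
    exact hne (by simpa using (S.isHomogeneous_H.mul S.isHomogeneous_m) x y h0)
  have h2 : (S.Δ ⊙ S.G) x y = 0 := by
    by_contra h0
    exact hne (by simpa using (S.isHomogeneous_Δ.mul S.isHomogeneous_G) x y h0)
  have h3 : ∀ i, (S.X i ⊙ S.M i) x y = 0 := by
    intro i
    by_contra h0
    exact hne (by simpa using ((S.isHomogeneous_X i).mul (S.isHomogeneous_M i)) x y h0)
  apply h
  simp [obstruction, h1, h2, h3]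

end FewOperations

end

section

namespace Op

variable {N : ℕ} [NeZero N]

/-! ### Agreement on an arc -/

/-- The cell lies in the arc from the vertex `a` to the vertex `b`, which does not pass from
`N - 1` to `0`. The edge after the vertex `x` is indexed by `x`. -/
def InArc (a b : ℕ) : Cell N → Prop
  | Sum.inl x => a ≤ x.val ∧ x.val ≤ b
  | Sum.inr x => a ≤ x.val ∧ x.val + 1 ≤ b

theorem InArc.mono {a b a' b' : ℕ} {c : Cell N} (h : InArc a b c) (ha : a' ≤ a) (hb : b ≤ b') :
    InArc a' b' c := by
  rcases c with x | x
  · exact ⟨ha.trans h.1, h.2.trans hb⟩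
  · exact ⟨ha.trans h.1, h.2.trans hb⟩

/-- The operations have the same matrix entries whose outputs are all in the arc. -/
def AgreeOn {m n : ℕ} (a b : ℕ) (v w : Op N m n) : Prop :=
  ∀ x y, (∀ j, InArc a b (y j)) → v x y = w x y

namespace AgreeOn

variable {m n p a b : ℕ} {v w u v' w' : Op N m n}

theorem refl (v : Op N m n) : AgreeOn a b v v := fun _ _ _ => rfl

theorem symm (h : AgreeOn a b v w) : AgreeOn a b w v := fun x y hy => (h x y hy).symm

theorem mono {a' b' : ℕ} (h : AgreeOn a b v w) (ha : a ≤ a') (hb : b' ≤ b) : AgreeOn a' b' v w :=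
  fun x y hy => h x y fun j => (hy j).mono ha hb

theorem add (h : AgreeOn a b v w) (h' : AgreeOn a b v' w') : AgreeOn a b (v + v') (w + w') :=
  fun x y hy => congrArg₂ (· + ·) (h x y hy) (h' x y hy)

theorem sub (h : AgreeOn a b v w) (h' : AgreeOn a b v' w') : AgreeOn a b (v - v') (w - w') :=
  fun x y hy => congrArg₂ (· - ·) (h x y hy) (h' x y hy)

theorem smul (c : ℝ) (h : AgreeOn a b v w) : AgreeOn a b (c • v) (c • w) :=
  fun x y hy => congrArg (c • ·) (h x y hy)

theorem sum {I : Type*} (s : Finset I) {f g : I → Op N m n} (h : ∀ i, AgreeOn a b (f i) (g i)) :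
    AgreeOn a b (∑ i ∈ s, f i) (∑ i ∈ s, g i) := by
  intro x y hy
  simp only [Finset.sum_apply]
  exact Finset.sum_congr rfl fun i _ => h i x y hy

theorem relabel (τ : Equiv.Perm (Fin n)) (h : AgreeOn a b v w) :
    AgreeOn a b (Op.relabel (Equiv.refl _) τ v) (Op.relabel (Equiv.refl _) τ w) := by
  intro x y hy
  simp only [Op.relabel]
  exact congrArg _ (h _ _ fun j => hy _)

end AgreeOn

/-- The inputs of nonzero matrix entries of `f` lie in the `ℓ`-neighbourhood of any arc that
contains the outputs. -/
def Spreads {m n : ℕ} (ℓ : ℕ) (f : Op N m n) : Prop :=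
  ∀ a b, b + ℓ + 1 < N → ∀ x y, f x y ≠ 0 → (∀ j, InArc (a + ℓ) b (y j)) →
    ∀ i, InArc a (b + ℓ) (x i)

theorem AgreeOn.mul {m n p a b ℓ : ℕ} {v w : Op N m n} (h : AgreeOn a (b + ℓ) v w) {f : Op N n p}
    (hf : f.Spreads ℓ) (hN : b + ℓ + 1 < N) : AgreeOn (a + ℓ) b (v ⊙ f) (w ⊙ f) := by
  intro x y hy
  refine Finset.sum_congr rfl fun z _ => ?_
  by_cases hz : f z y = 0
  · simp [hz]
  · rw [h x z (hf a b hN z y hz hy)]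

theorem val_of_vertexDist_le {p q : ZMod N} {a b ℓ : ℕ} (hN : b + ℓ < N) (h : vertexDist p q ≤ ℓ)
    (h1 : a + ℓ ≤ q.val) (h2 : q.val ≤ b) : a ≤ p.val ∧ p.val ≤ b + ℓ := by
  have h3 : p = (((q.val : ℤ) - (q - p).valMinAbs : ℤ) : ZMod N) := by
    push_cast
    rw [ZMod.natCast_zmod_val]
    ring
  have h4 : ((q - p).valMinAbs).natAbs ≤ ℓ := h
  obtain ⟨k, hk⟩ : ∃ k : ℕ, (k : ℤ) = (q.val : ℤ) - (q - p).valMinAbs :=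
    ⟨((q.val : ℤ) - (q - p).valMinAbs).toNat, by omega⟩
  have h5 : p.val = k := by
    rw [h3, ← hk, Int.cast_natCast, ZMod.val_cast_of_lt (by omega)]
  omega

theorem val_add_one {x : ZMod N} (h : x.val + 1 < N) : (x + 1).val = x.val + 1 := by
  rcases Nat.lt_or_ge 1 N with h1 | h1
  · have : Fact (1 < N) := ⟨h1⟩
    rw [ZMod.val_add_of_lt] <;> rw [ZMod.val_one]
    exact h
  · omega

theorem IsQuasilocal.spreads {m n ℓ : ℕ} {f : Op N m (n + 1)} (hf : f.IsQuasilocal ℓ) :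
    f.Spreads ℓ := by
  intro a b hN x y hxy hy i
  have h1 := hf x y hxy i 0
  have h2 : ∀ p ∈ cellVerts (x i), a ≤ p.val ∧ p.val ≤ b + ℓ := by
    intro p hp
    have h3 := (Finset.sup'_le_iff _ _).1 h1 p hp
    obtain ⟨q, hq, h4⟩ := (Finset.inf'_le_iff _).1 h3
    have h5 : a + ℓ ≤ q.val ∧ q.val ≤ b := by
      have h6 := hy 0
      rcases h7 : y 0 with k | k
      · rw [h7] at h6 hq
        rw [cellVerts, Finset.mem_singleton] at hq
        exact hq ▸ h6
      · rw [h7] at h6 hq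
        simp only [cellVerts, Finset.mem_insert, Finset.mem_singleton] at hq
        rcases hq with rfl | rfl
        · exact ⟨h6.1, le_trans (Nat.le_succ _) h6.2⟩
        · have h8 := h6.2
          rw [val_add_one (by omega)]
          exact ⟨h6.1.trans (Nat.le_succ _), h8⟩
    exact val_of_vertexDist_le (by omega) h4 h5.1 h5.2
  rcases h3 : x i with k | k
  · rw [h3] at h2
    exact h2 k (by simp [cellVerts])
  · rw [h3] at h2
    have h4 := h2 k (by simp [cellVerts])
    have h5 := h2 (k + 1) (by simp [cellVerts])
    rw [val_add_one (by omega)] at h5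
    exact ⟨h4.1, h5.2⟩

theorem Spreads.tensorLeft {m n ℓ : ℕ} {f : Op N m n} (hf : f.Spreads ℓ) :
    (tensorLeft f).Spreads ℓ := by
  intro a b hN x y hxy hy i
  rw [Op.tensorLeft] at hxy
  split_ifs at hxy with h
  · refine Fin.lastCases ?_ (fun i => ?_) i
    · rw [h]
      exact (hy _).mono (by omega) (by omega)
    · exact hf a b hN _ _ hxy (fun j => hy j.castSucc) i
  · exact absurd rfl hxy

/-! ### The differential on vertices, edges and squares -/

theorem sum_ite_update {n : ℕ} (y : Fin n → Cell N) (i : Fin n) (F : (Fin n → Cell N) → ℝ) :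
    ∑ z, (if ∀ j, j ≠ i → z j = y j then F z else 0) = ∑ c, F (Function.update y i c) := by
  rw [← Finset.sum_filter]
  refine Finset.sum_nbij' (fun z => z i) (fun c => Function.update y i c) (by simp) ?_ ?_ (by simp)
    ?_
  · intro c _
    simp only [Finset.mem_filter, Finset.mem_univ, true_and]
    intro j hj
    simp [hj]
  · intro z hz
    simp only [Finset.mem_filter, Finset.mem_univ, true_and] at hz
    funext j
    by_cases hj : j = i
    · subst hj; simp
    · simp [hj, hz j hj]
  · intro z hz
    simp only [Finset.mem_filter, Finset.mem_univ, true_and] at hz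
    congr 1
    funext j
    by_cases hj : j = i
    · subst hj; simp
    · simp [hj, hz j hj]

theorem mul_d_apply {m n : ℕ} (v : Op N m n) (x : Fin m → Cell N) (y : Fin n → Cell N) :
    (v ⊙ d) x y = ∑ i, (-1) ^ (∑ j ∈ Finset.univ.filter (· < i), cellDeg (y j)) *
      Sum.elim (fun _ => (0 : ℝ)) (fun k => v x (Function.update y i (Sum.inl (k + 1))) -
        v x (Function.update y i (Sum.inl k))) (y i) := by
  rw [mul]
  simp only [d, tensorD, Finset.mul_sum]
  rw [Finset.sum_comm]
  refine Finset.sum_congr rfl fun i _ => ?_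
  simp only [mul_ite, MulZeroClass.mul_zero]
  rw [sum_ite_update y i fun z => v x z *
    ((-1) ^ (∑ j ∈ Finset.univ.filter (· < i), cellDeg (z j)) * cellD (z i) (y i))]
  have h1 : ∀ c, ∑ j ∈ Finset.univ.filter (· < i), cellDeg (Function.update y i c j) =
      ∑ j ∈ Finset.univ.filter (· < i), cellDeg (y j) := by
    intro c
    refine Finset.sum_congr rfl fun j hj => ?_
    rw [Function.update_of_ne (ne_of_lt (Finset.mem_filter.1 hj).2)]
  simp only [h1, Function.update_self]
  rw [Fintype.sum_sum_type]
  rcases y i with k | k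
  · simp [cellD]
  · have h2 : ∀ x : ZMod N, k = x - 1 ↔ x = k + 1 := by
      intro x
      rw [eq_sub_iff_add_eq, eq_comm]
    simp only [cellD, h2, MulZeroClass.mul_zero, Finset.sum_const_zero, add_zero, Sum.elim_inr]
    simp only [_root_.mul_sub, mul_ite, _root_.mul_one, MulZeroClass.mul_zero,
      Finset.sum_sub_distrib]
    simp [_root_.mul_comm]

/-- The basic tensor of the vertex cochains with indices `k i`. -/
def vtx {n : ℕ} (k : Fin n → ℕ) : Fin n → Cell N := fun i => Sum.inl (k i : ZMod N)

/-- The basic tensor of the vertex cochains with indices `k j`, except for the edge after `k i`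
in the factor `i`. -/
def edg {n : ℕ} (k : Fin n → ℕ) (i : Fin n) : Fin n → Cell N :=
  Function.update (vtx k) i (Sum.inr (k i : ZMod N))

theorem vtx_update {n : ℕ} (k : Fin n → ℕ) (i : Fin n) (t : ℕ) :
    (vtx (Function.update k i t) : Fin n → Cell N) =
      Function.update (vtx k) i (Sum.inl (t : ZMod N)) := by
  funext j
  by_cases hj : j = i
  · subst hj; simp [vtx]
  · simp [vtx, hj]

/-- On an edge, the differential is the difference of the values at its ends. -/
theorem mul_d_edg {m n : ℕ} (v : Op N m n) (x : Fin m → Cell N) (k : Fin n → ℕ) (i : Fin n) :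
    (v ⊙ d) x (edg k i) = v x (vtx (Function.update k i (k i + 1))) - v x (vtx k) := by
  rw [mul_d_apply, Finset.sum_eq_single i]
  · rw [Finset.sum_eq_zero, pow_zero, _root_.one_mul]
    · rw [vtx_update]
      simp [edg]
      congr 2
      funext j
      by_cases hj : j = i
      · subst hj; simp [vtx]
      · simp [hj]
    · intro j hj
      rw [edg, Function.update_of_ne (ne_of_lt (Finset.mem_filter.1 hj).2)]
      rfl
  · intro j _ hj
    rw [edg, Function.update_of_ne hj]
    simp [vtx]
  · simp

/-- On a square, the differential is the circulation along its boundary. -/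
theorem mul_d_edg_edg {m n : ℕ} (v : Op N m n) (x : Fin m → Cell N) (k : Fin n → ℕ) {i j : Fin n}
    (hij : i < j) :
    (v ⊙ d) x (Function.update (edg k i) j (Sum.inr (k j : ZMod N))) =
      (v x (edg (Function.update k i (k i + 1)) j) - v x (edg k j)) -
        (v x (edg (Function.update k j (k j + 1)) i) - v x (edg k i)) := by
  rw [mul_d_apply, ← Finset.sum_subset (Finset.subset_univ {i, j}), Finset.sum_pair hij.ne]
  · have h1 : ∑ l ∈ Finset.univ.filter (· < i),
        cellDeg (Function.update (edg k i) j (Sum.inr (k j : ZMod N)) l) = 0 := by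
      refine Finset.sum_eq_zero fun l hl => ?_
      have hl := (Finset.mem_filter.1 hl).2
      rw [Function.update_of_ne (hl.trans hij).ne, edg, Function.update_of_ne hl.ne]
      rfl
    have h2 : ∑ l ∈ Finset.univ.filter (· < j),
        cellDeg (Function.update (edg k i) j (Sum.inr (k j : ZMod N)) l) = 1 := by
      rw [Finset.sum_eq_single i]
      · rw [Function.update_of_ne hij.ne, edg, Function.update_self]
        rfl
      · intro l hl hli
        have hl := (Finset.mem_filter.1 hl).2
        rw [Function.update_of_ne hl.ne, edg, Function.update_of_ne hli]
        rfl
      · simp [hij]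
    rw [h1, h2, pow_zero, _root_.one_mul, pow_one, neg_one_mul, ← sub_eq_add_neg]
    rw [Function.update_of_ne hij.ne, Function.update_self]
    rw [show edg k i i = (Sum.inr (k i : ZMod N) : Cell N) by simp [edg]]
    simp only [Sum.elim_inr]
    congr 2
    · congr 1
      funext l
      by_cases hli : l = i
      · subst hli; simp [edg, vtx, hij.ne]
      · by_cases hlj : l = j
        · subst hlj; simp [edg, hli]
        · simp [edg, vtx, hli, hlj]
    · congr 1
      funext l
      by_cases hli : l = i
      · subst hli; simp [edg, vtx, hij.ne]
      · by_cases hlj : l = j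
        · subst hlj; simp [edg, hli]
        · simp [edg, vtx, hli, hlj]
    · congr 1
      funext l
      by_cases hli : l = i
      · subst hli; simp [edg, hij.ne]
      · by_cases hlj : l = j
        · subst hlj; simp [edg, vtx, hli]
        · simp [edg, vtx, hli, hlj]
    · congr 1
      funext l
      by_cases hli : l = i
      · subst hli; simp [edg, hij.ne]
      · by_cases hlj : l = j
        · subst hlj; simp [edg, vtx, hli]
        · simp [edg, vtx, hli, hlj]
  · intro l _ hl
    simp only [Finset.mem_insert, Finset.mem_singleton, not_or] at hl
    rw [Function.update_of_ne hl.2, edg, Function.update_of_ne hl.1]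
    simp [vtx]

end Op

end

section

namespace Op

variable {N : ℕ} [NeZero N]

/-! ### The Poincaré lemma on a box -/

/-- All coordinates lie between `a` and `b`. -/
def InBox {n : ℕ} (a b : ℕ) (k : Fin n → ℕ) : Prop := ∀ l, a ≤ k l ∧ k l ≤ b

theorem InBox.update {n a b : ℕ} {k : Fin n → ℕ} (h : InBox a b k) (i : Fin n) {t : ℕ} (h1 : a ≤ t)
    (h2 : t ≤ b) : InBox a b (Function.update k i t) := by
  intro l
  by_cases hl : l = i
  · subst hl; simp [h1, h2]
  · simpa [hl] using h l

/-- The discrete Poincaré lemma for one-forms on a box, by induction on the set of directions in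
which the form may be nonzero. -/
theorem exists_potential_of_support {n a b : ℕ} (s : Finset (Fin n)) :
    ∀ ψ : Fin n → (Fin n → ℕ) → ℝ,
      (∀ i j k, i ≠ j → InBox a b k → k i + 1 ≤ b → k j + 1 ≤ b →
        ψ j (Function.update k i (k i + 1)) - ψ j k =
          ψ i (Function.update k j (k j + 1)) - ψ i k) →
      (∀ i ∉ s, ∀ k, InBox a b k → k i + 1 ≤ b → ψ i k = 0) →
      ∃ f : (Fin n → ℕ) → ℝ, ∀ i k, InBox a b k → k i + 1 ≤ b →
        f (Function.update k i (k i + 1)) - f k = ψ i k := by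
  induction s using Finset.induction_on with
  | empty =>
    intro ψ _ h0
    exact ⟨0, fun i k hk hi => by simp [h0 i (Finset.notMem_empty i) k hk hi]⟩
  | insert i s hi ih =>
    intro ψ hψ h0
    -- Integrate in the direction `i` to remove the component `ψ i`.
    set g : (Fin n → ℕ) → ℝ := fun k => ∑ t ∈ Finset.Ico a (k i),
      ψ i (Function.update k i t) with hg
    have hgi : ∀ k, InBox a b k → k i + 1 ≤ b →
        g (Function.update k i (k i + 1)) - g k = ψ i k := by
      intro k hk _
      simp only [hg, Function.update_self, Function.update_idem]
      rw [Finset.sum_Ico_succ_top (hk i).1, Function.update_eq_self]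
      ring
    have hgj : ∀ j, j ≠ i → ∀ k, InBox a b k → k j + 1 ≤ b →
        g (Function.update k j (k j + 1)) - g k = ψ j k - ψ j (Function.update k i a) := by
      intro j hj k hk hkj
      simp only [hg, Function.update_of_ne hj.symm]
      rw [← Finset.sum_sub_distrib]
      have h1 : ∀ t ∈ Finset.Ico a (k i),
          ψ i (Function.update (Function.update k j (k j + 1)) i t) - ψ i (Function.update k i t) =
          ψ j (Function.update k i (t + 1)) - ψ j (Function.update k i t) := by
        intro t ht
        rw [Finset.mem_Ico] at ht
        have h2 := hψ j i (Function.update k i t) hj (hk.update i ht.1 (ht.2.le.trans (hk i).2))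
          (by simpa [hj] using hkj) (by simpa using ht.2.trans_le (hk i).2)
        rw [Function.update_of_ne hj, Function.update_self, Function.update_idem,
          Function.update_comm hj.symm] at h2
        exact h2
      rw [Finset.sum_congr rfl h1, Finset.sum_Ico_sub (fun t => ψ j (Function.update k i t)) (hk
        i).1,
        Function.update_eq_self]
    obtain ⟨f, hf⟩ := ih (fun j k => ψ j k - (g (Function.update k j (k j + 1)) - g k)) (by
      intro p q k hpq hk hp hq
      have h1 := hψ p q k hpq hk hp hq
      simp only [Function.update_of_ne hpq, Function.update_of_ne hpq.symm,
        Function.update_comm hpq]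
      linarith) (by
      intro j hj k hk hkj
      by_cases hji : j = i
      · subst hji
        simp [hgi k hk hkj]
      · rw [hgj j hji k hk hkj, sub_sub_cancel]
        refine h0 j (by simp [hji, hj]) _ (hk.update i le_rfl ((hk i).1.trans (hk i).2)) ?_
        rwa [Function.update_of_ne hji])
    refine ⟨f + g, fun j k hk hkj => ?_⟩
    have h1 := hf j k hk hkj
    simp only [Pi.add_apply]
    linarith

theorem inArc_vtx {n a b : ℕ} {k : Fin n → ℕ} (hk : InBox a b k) (hb : b < N) (j : Fin n) :
    InArc (N := N) a b (vtx k j) := by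
  rw [vtx, InArc, ZMod.val_cast_of_lt ((hk j).2.trans_lt hb)]
  exact hk j

theorem inArc_update_inr {n a b : ℕ} {k : Fin n → ℕ} (hk : InBox a b k) (hb : b < N) {i : Fin n}
    (hi : k i + 1 ≤ b) {y : Fin n → Cell N} (hy : ∀ j, InArc a b (y j)) (j : Fin n) :
    InArc a b (Function.update y i (Sum.inr (k i : ZMod N)) j) := by
  by_cases hj : j = i
  · subst hj
    rw [Function.update_self, InArc, ZMod.val_cast_of_lt ((hk j).2.trans_lt hb)]
    exact ⟨(hk j).1, hi⟩
  · rw [Function.update_of_ne hj]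
    exact hy j

theorem inArc_edg {n a b : ℕ} {k : Fin n → ℕ} (hk : InBox a b k) (hb : b < N) {i : Fin n}
    (hi : k i + 1 ≤ b) (j : Fin n) : InArc (N := N) a b (edg k i j) :=
  inArc_update_inr hk hb hi (inArc_vtx hk hb) j

/-- The index of a cell, as a natural number: for an edge, that of the vertex before it. -/
def cellVal : Cell N → ℕ
  | Sum.inl x => x.val
  | Sum.inr x => x.val

theorem inBox_cellVal {n a b : ℕ} {y : Fin n → Cell N} (hy : ∀ j, InArc a b (y j)) :
    InBox a b fun j => cellVal (y j) := by
  intro j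
  have h := hy j
  change a ≤ cellVal (y j) ∧ cellVal (y j) ≤ b
  revert h
  rcases y j with k | k <;> intro h
  · exact h
  · exact ⟨h.1, (Nat.le_succ _).trans h.2⟩

theorem eq_vtx_of_tensorDeg_eq_zero {n : ℕ} {y : Fin n → Cell N} (h : tensorDeg y = 0) :
    y = vtx fun j => cellVal (y j) := by
  rw [tensorDeg, Finset.sum_eq_zero_iff] at h
  funext j
  have h1 := h j (Finset.mem_univ j)
  cases h2 : y j with
  | inl k => simp [vtx, h2, cellVal]
  | inr k => rw [h2] at h1; exact absurd h1 one_ne_zero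

theorem exists_eq_edg_of_tensorDeg_eq_one {n : ℕ} {y : Fin n → Cell N} (h : tensorDeg y = 1) :
    ∃ i, y = edg (fun j => cellVal (y j)) i ∧ ∃ k, y i = Sum.inr k := by
  obtain ⟨i, hi⟩ : ∃ i, cellDeg (y i) ≠ 0 := by
    by_contra! hne
    rw [tensorDeg, Finset.sum_eq_zero fun j _ => hne j] at h
    exact zero_ne_one h
  have h1 : ∀ j, j ≠ i → cellDeg (y j) = 0 := by
    intro j hj
    rw [tensorDeg, ← Finset.add_sum_erase _ _ (Finset.mem_univ i)] at h
    have h2 := Finset.single_le_sum (f := fun j => cellDeg (y j)) (fun _ _ => Nat.zero_le _)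
      (Finset.mem_erase.2 ⟨hj, Finset.mem_univ j⟩)
    omega
  cases h3 : y i with
  | inl k => rw [h3] at hi; exact absurd rfl hi
  | inr k =>
    refine ⟨i, ?_, k, h3⟩
    funext j
    by_cases hj : j = i
    · subst hj; simp [edg, h3, cellVal]
    · cases h4 : y j with
      | inl l => simp [edg, hj, vtx, h4, cellVal]
      | inr l => have := h1 j hj; rw [h4] at this; exact absurd this one_ne_zero

theorem isHomogeneous_d {n : ℕ} : (d : Op N n n).IsHomogeneous 1 := by
  intro x y h
  have h' : tensorD x y ≠ 0 := h
  rw [tensorD] at h'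
  obtain ⟨i, -, hi⟩ := Finset.exists_ne_zero_of_sum_ne_zero h'
  split_ifs at hi with h1
  · have h2 := right_ne_zero_of_mul hi
    rw [tensorDeg, tensorDeg, ← Finset.add_sum_erase _ _ (Finset.mem_univ i),
      ← Finset.add_sum_erase (a := i) _ (fun i => cellDeg (x i)) (Finset.mem_univ i)]
    have h3 : ∑ j ∈ Finset.univ.erase i, cellDeg (x j) = ∑ j ∈ Finset.univ.erase i, cellDeg (y j) :=
      Finset.sum_congr rfl fun j hj => by rw [h1 j (Finset.mem_erase.1 hj).1]
    rw [h3]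
    cases h4 : x i <;> cases h5 : y i <;> rw [h4, h5] at h2 <;> simp_all [cellD, cellDeg]
  · exact absurd rfl hi

theorem IsHomogeneous.eq_zero {m n : ℕ} {f : Op N m n} {r : ℤ} (hf : f.IsHomogeneous r)
    {x : Fin m → Cell N} {y : Fin n → Cell N} (h : (tensorDeg y : ℤ) - tensorDeg x ≠ r) :
    f x y = 0 := by
  by_contra h0
  exact h (hf x y h0)

/-- A degree-one element of a tensor power that is closed on an arc is exact there. -/
theorem exists_agreeOn_mul_d {n a b : ℕ} (hb : b < N) {v : Op N 0 n} (hv : v.IsHomogeneous 1)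
    (h : AgreeOn a b (v ⊙ d) 0) :
    ∃ L : Op N 0 n, L.IsHomogeneous 0 ∧ AgreeOn a b (L ⊙ d) v := by
  obtain ⟨f, hf⟩ := exists_potential_of_support (a := a) (b := b) Finset.univ
    (fun i k => v default (edg k i)) (by
      intro i j k hij hk hi hj
      wlog hlt : i < j generalizing i j
      · exact (this j i hij.symm hj hi (lt_of_le_of_ne (not_lt.1 hlt) hij.symm)).symm
      have h1 := h default _ (inArc_update_inr hk hb hj (inArc_edg hk hb hi))
      rw [mul_d_edg_edg v _ k hlt, Pi.zero_apply, Pi.zero_apply] at h1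
      linarith) (fun i hi => absurd (Finset.mem_univ i) hi)
  refine ⟨fun _ y => if tensorDeg y = 0 then f fun j => cellVal (y j) else 0, ?_, ?_⟩
  · intro x y hxy
    simp only [ne_eq, ite_eq_right_iff, not_forall] at hxy
    simp [hxy.1, tensorDeg_fin_zero]
  set L : Op N 0 n := fun _ y => if tensorDeg y = 0 then f fun j => cellVal (y j) else 0 with hL
  have hL0 : L.IsHomogeneous 0 := by
    intro x y hxy
    simp only [hL, ne_eq, ite_eq_right_iff, not_forall] at hxy
    simp [hxy.1, tensorDeg_fin_zero]
  have hLk : ∀ k, InBox a b k → L default (vtx k) = f k := by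
    intro k hk
    rw [hL]
    simp only
    rw [if_pos (by simp [tensorDeg, vtx, cellDeg])]
    congr 1
    funext j
    simp only [vtx, cellVal, ZMod.val_cast_of_lt ((hk j).2.trans_lt hb)]
  intro x y hy
  rw [Subsingleton.elim x default]
  by_cases hd : tensorDeg y = 1
  · obtain ⟨i, h1, k, hk⟩ := exists_eq_edg_of_tensorDeg_eq_one hd
    have hbox := inBox_cellVal hy
    have hi : cellVal (y i) + 1 ≤ b := by
      have := hy i
      rw [hk] at this ⊢
      exact this.2
    rw [h1, mul_d_edg, hLk _ hbox, hLk _ (hbox.update i ((hbox i).1.trans (Nat.le_succ _)) hi)]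
    exact hf i _ hbox hi
  · rw [hv.eq_zero (by rw [tensorDeg_fin_zero]; omega), (hL0.mul isHomogeneous_d).eq_zero
      (by rw [tensorDeg_fin_zero]; omega)]

/-- The fundamental theorem of calculus in the direction `i`. -/
theorem AgreeOn.apply_update {m n a b : ℕ} (hb : b < N) {v w : Op N m n}
    (h : AgreeOn a b (v ⊙ d) w) (x : Fin m → Cell N) {k : Fin n → ℕ} (hk : InBox a b k) (i : Fin n)
    {s t : ℕ} (hs : a ≤ s) (hst : s ≤ t) (ht : t ≤ b) :
    v x (vtx (Function.update k i t)) - v x (vtx (Function.update k i s)) =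
      ∑ r ∈ Finset.Ico s t, w x (edg (Function.update k i r) i) := by
  rw [← Finset.sum_Ico_sub (fun r => v x (vtx (Function.update k i r))) hst]
  refine Finset.sum_congr rfl fun r hr => ?_
  rw [Finset.mem_Ico] at hr
  rw [← h x _ (inArc_edg (hk.update i (hs.trans hr.1) (by omega)) hb (by simp; omega)), mul_d_edg]
  simp

/-- A degree-zero element that is closed on an arc is constant there. -/
theorem AgreeOn.apply_eq_of_mul_d {m n a b : ℕ} (hb : b < N) {v : Op N m n}
    (h : AgreeOn a b (v ⊙ d) 0) (x : Fin m → Cell N) {k l : Fin n → ℕ} (hk : InBox a b k)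
    (hl : InBox a b l) : v x (vtx k) = v x (vtx l) := by
  have h1 : ∀ s : Finset (Fin n), v x (vtx (s.piecewise l k)) = v x (vtx k) := by
    intro s
    induction s using Finset.induction_on with
    | empty => simp
    | insert i s hi ih =>
      rw [← ih, Finset.piecewise_insert]
      have hbox : InBox a b (s.piecewise l k) := by
        intro j
        by_cases hj : j ∈ s
        · simpa [hj] using hl j
        · simpa [hj] using hk j
      rcases le_total (l i) (s.piecewise l k i) with hle | hle
      · have h2 := h.apply_update hb x hbox i (hl i).1 hle (hbox i).2
        rw [Function.update_eq_self] at h2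
        simp at h2
        linarith
      · have h2 := h.apply_update hb x hbox i (hbox i).1 hle (hl i).2
        rw [Function.update_eq_self] at h2
        simp at h2
        linarith
  simpa using (h1 Finset.univ).symm

end Op

end

section

namespace Op

variable {N : ℕ} [NeZero N]

/-! ### Quasilocal operations near a point -/

theorem vertexDist_comm (p q : ZMod N) : vertexDist p q = vertexDist q p := by
  rw [vertexDist, vertexDist, ← neg_sub, ZMod.natAbs_valMinAbs_neg]

theorem val_mem_of_mem_cellVerts {a b : ℕ} {c : Cell N} (h : InArc a b c) (hb : b < N) {p : ZMod N}
    (hp : p ∈ cellVerts c) : cellVal c ≤ p.val ∧ p.val ≤ cellVal c + 1 ∧ a ≤ p.val ∧ p.val ≤ b := by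
  rcases c with x | x
  · rw [cellVerts, Finset.mem_singleton] at hp
    subst hp
    exact ⟨le_rfl, Nat.le_succ _, h.1, h.2⟩
  · have h1 := h.1
    have h2 := h.2
    simp only [cellVerts, Finset.mem_insert, Finset.mem_singleton] at hp
    rcases hp with rfl | rfl
    · exact ⟨le_rfl, Nat.le_succ _, h1, by omega⟩
    · rw [val_add_one (by omega)]
      exact ⟨Nat.le_succ _, le_rfl, by omega, h2⟩

theorem exists_mem_cellVerts (c : Cell N) : ∃ p ∈ cellVerts c, p.val = cellVal c := by
  rcases c with x | x <;> exact ⟨x, by simp [cellVerts], rfl⟩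

theorem cellVal_of_mem_cellVerts {c : Cell N} {p : ZMod N} (hp : p ∈ cellVerts c)
    (h : 1 ≤ p.val) : cellVal c ≤ p.val ∧ p.val ≤ cellVal c + 1 := by
  rcases c with k | k
  · rw [cellVerts, Finset.mem_singleton] at hp
    subst hp
    exact ⟨le_rfl, Nat.le_succ _⟩
  · simp only [cellVerts, Finset.mem_insert, Finset.mem_singleton] at hp
    rcases hp with rfl | hp
    · exact ⟨le_rfl, Nat.le_succ _⟩
    · have h6 : k = p - 1 := by rw [hp]; ring
      have h7 : (1 : ZMod N).val = 1 := by
        have : Fact (1 < N) := ⟨h.trans_lt (ZMod.val_lt p)⟩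
        exact ZMod.val_one N
      have h8 : k.val = p.val - 1 := by
        rw [h6, ZMod.val_sub (by omega), h7]
      change k.val ≤ _ ∧ _ ≤ k.val + 1
      omega

/-- Inputs of a quasilocal operation are close to each output. -/
theorem IsQuasilocal.cellVal_input {m n ℓ a b : ℕ} {f : Op N m n} (hf : f.IsQuasilocal ℓ)
    {x : Fin m → Cell N} {y : Fin n → Cell N} (h : f x y ≠ 0) (i : Fin m) (j : Fin n)
    (hy : InArc (a + ℓ) b (y j)) (hb : b + ℓ < N) :
    cellVal (x i) ≤ cellVal (y j) + 1 + ℓ ∧ cellVal (y j) ≤ cellVal (x i) + ℓ ∧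
      a ≤ cellVal (x i) := by
  obtain ⟨p, hp, hpx⟩ := exists_mem_cellVerts (x i)
  obtain ⟨q, hq, hpq⟩ := (Finset.inf'_le_iff _).1 ((Finset.sup'_le_iff _ _).1 (hf x y h i j) p hp)
  have h1 := val_mem_of_mem_cellVerts hy (by omega) hq
  have h2 := val_of_vertexDist_le (a := q.val - ℓ) (b := q.val) (by omega) hpq (by omega) le_rfl
  omega

/-- Outputs of a quasilocal operation are close to each other. -/
theorem IsQuasilocal.cellVal_output {m n ℓ b : ℕ} {f : Op N (m + 1) n} (hf : f.IsQuasilocal ℓ)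
    {x : Fin (m + 1) → Cell N} {y : Fin n → Cell N} (h : f x y ≠ 0) (j j' : Fin n)
    (hy : InArc (2 * ℓ + 2) b (y j)) (hb : b + 2 * ℓ + 2 < N) :
    cellVal (y j') ≤ cellVal (y j) + 2 * ℓ + 2 ∧ cellVal (y j) ≤ cellVal (y j') + 2 * ℓ + 2 := by
  obtain ⟨p, hp, hpx⟩ := exists_mem_cellVerts (x 0)
  obtain ⟨q, hq, hpq⟩ := (Finset.inf'_le_iff _).1 ((Finset.sup'_le_iff _ _).1 (hf x y h 0 j) p hp)
  have h1 := val_mem_of_mem_cellVerts hy (by omega) hq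
  have h2 := val_of_vertexDist_le (a := q.val - ℓ) (b := q.val) (by omega) hpq (by omega) le_rfl
  obtain ⟨q', hq', hpq'⟩ :=
    (Finset.inf'_le_iff _).1 ((Finset.sup'_le_iff _ _).1 (hf x y h 0 j') p hp)
  rw [vertexDist_comm] at hpq'
  have h3 := val_of_vertexDist_le (a := p.val - ℓ) (b := p.val) (by omega) hpq' (by omega) le_rfl
  have h4 := cellVal_of_mem_cellVerts hq' (by omega)
  omega

/-! ### Tensor powers of the unit -/

/-- The `n`-th tensor power of the constant cochain `∑ x, f_x`, as an operation without inputs. -/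
def unit (n : ℕ) : Op N 0 n := fun _ y => if tensorDeg y = 0 then 1 else 0

theorem isHomogeneous_unit (n : ℕ) : (unit n : Op N 0 n).IsHomogeneous 0 := by
  intro x y h
  simp only [unit, ne_eq, ite_eq_right_iff, not_forall] at h
  simp [h.1, tensorDeg_fin_zero]

theorem unit_vtx {n : ℕ} (x : Fin 0 → Cell N) (k : Fin n → ℕ) : unit n x (vtx k) = 1 := by
  simp [unit, vtx, tensorDeg, cellDeg]

theorem tensorDeg_update_inl {n : ℕ} (y : Fin n → Cell N) (i : Fin n) (k k' : ZMod N) :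
    tensorDeg (Function.update y i (Sum.inl k)) = tensorDeg (Function.update y i (Sum.inl k')) := by
  refine Finset.sum_congr rfl fun j _ => ?_
  by_cases hj : j = i
  · subst hj; simp [cellDeg]
  · simp [hj]

theorem unit_mul_d (n : ℕ) : (unit n : Op N 0 n) ⊙ d = 0 := by
  funext x y
  rw [mul_d_apply]
  refine Finset.sum_eq_zero fun i _ => ?_
  rcases y i with k | k
  · simp
  · simp only [unit, Sum.elim_inr]
    rw [tensorDeg_update_inl y i (k + 1) k, sub_self, MulZeroClass.mul_zero]

theorem prod_representative_zero {n : ℕ} (y : Fin n → Cell N) :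
    ∏ j, representative 0 (y j) = if tensorDeg y = 0 then 1 else 0 := by
  have h : ∀ c : Cell N, representative 0 c = if cellDeg c = 0 then 1 else 0 := by
    rintro (x | x) <;> simp [representative, cellDeg]
  simp only [h, Finset.prod_ite_zero, Finset.prod_const_one, tensorDeg, Finset.sum_eq_zero_iff]

theorem unit_mul_apply {n p : ℕ} (f : Op N n p) (x : Fin 0 → Cell N) (y : Fin p → Cell N) :
    (unit n ⊙ f) x y = ∑ z : Fin n → Cell N, (∏ i, representative 0 (z i)) * f z y := by
  refine Finset.sum_congr rfl fun z _ => ?_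
  rw [prod_representative_zero, unit]

/-- The constant cochain is a unit for the multiplication on itself, not only up to exact terms,
since there are no exact cochains in degree zero. -/
theorem unit_mul_of_induces_mult {m : Op N 2 1} (hm : m.IsHomogeneous 0)
    (h : m.Induces cohomMult) : unit 2 ⊙ m = unit 1 := by
  funext x y
  by_cases hy : tensorDeg y = 0
  · obtain ⟨E, hE⟩ := h.2
    have h1 := hE (fun _ => 0) y
    rw [← unit_mul_apply m x y, Finset.sum_eq_zero (s := Finset.univ) (f := fun z => E _ z *
      tensorD z y),
      Fintype.sum_eq_single (fun _ => 0)] at h1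
    · rw [prod_representative_zero, if_pos hy] at h1
      rw [unit, if_pos hy]
      simp [cohomMult] at h1
      linarith
    · intro k hk
      have h2 : k 0 ≠ 0 := fun h0 => hk (funext fun i => by rw [Subsingleton.elim i 0, h0])
      rw [cohomMult, if_neg, MulZeroClass.zero_mul]
      intro h3
      exact h2 (Fin.ext (by simpa using h3.symm))
    · intro z _
      have h2 : tensorD z y = 0 := isHomogeneous_d.eq_zero (f := d) (by rw [hy]; omega)
      rw [h2, MulZeroClass.mul_zero]
  · rw [((isHomogeneous_unit 2).mul hm).eq_zero, (isHomogeneous_unit 1).eq_zero] <;>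
      rw [tensorDeg_fin_zero] <;> omega

theorem sum_mul_d_inr_inl (E : Op N 0 2) (x : Fin 0 → Cell N) (q : ZMod N) :
    ∑ t : ZMod N, (E ⊙ d) x ![Sum.inr t, Sum.inl q] = 0 := by
  have h : ∀ t : ZMod N, (E ⊙ d) x ![Sum.inr t, Sum.inl q] =
      E x ![Sum.inl (t + 1), Sum.inl q] - E x ![Sum.inl t, Sum.inl q] := by
    intro t
    rw [mul_d_apply, Fin.sum_univ_two]
    have h1 : ∀ c c' c'' : Cell N, Function.update ![c, c'] 0 c'' = ![c'', c'] := by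
      intro c c' c''
      funext i
      fin_cases i <;> simp
    simp [h1]
  simp only [h, Finset.sum_sub_distrib]
  rw [sub_eq_zero]
  exact Equiv.sum_comp (Equiv.addRight (1 : ZMod N)) fun t => E x ![Sum.inl t, Sum.inl q]

/-- Integration over the first factor at a fixed vertex in the second is the coefficient of
`ω ⊗ 1` in `Δ(1)`, whatever operation represents `Δ`. -/
theorem sum_unit_mul_of_induces_comult {Δ : Op N 1 2} (h : Δ.Induces cohomComult)
    (x : Fin 0 → Cell N) (q : ZMod N) :
    ∑ t : ZMod N, (unit 1 ⊙ Δ) x ![Sum.inr t, Sum.inl q] = 1 := by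
  obtain ⟨E, hE⟩ := h.2
  have h1 : ∀ t : ZMod N, (unit 1 ⊙ Δ) x ![Sum.inr t, Sum.inl q] = (if t = 0 then 1 else 0) +
      ((fun _ z => E (fun _ => 0) z : Op N 0 2) ⊙ d) x ![Sum.inr t, Sum.inl q] := by
    intro t
    have h2 := hE (fun _ => 0) ![Sum.inr t, Sum.inl q]
    rw [← unit_mul_apply Δ x] at h2
    rw [sub_eq_iff_eq_add, _root_.add_comm] at h2
    rw [h2]
    refine congrArg₂ (· + ·) ?_ rfl
    rw [← (finTwoArrowEquiv (Fin 2)).symm.sum_comp, Fintype.sum_prod_type]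
    simp [Fin.sum_univ_two, cohomComult, representative, finTwoArrowEquiv]
  simp only [h1, Finset.sum_add_distrib, sum_mul_d_inr_inl, add_zero]
  simp

theorem sum_zmod (f : ZMod N → ℝ) : ∑ t, f t = ∑ r ∈ Finset.range N, f (r : ZMod N) := by
  refine Finset.sum_nbij' (fun t => t.val) (fun r => (r : ZMod N)) ?_ ?_ ?_ ?_ ?_
  · intro t _
    exact Finset.mem_range.2 (ZMod.val_lt t)
  · simp
  · simp
  · intro r hr
    exact ZMod.val_cast_of_lt (Finset.mem_range.1 hr)
  · simp

end Op

end

/-! ### Primitives on an arc -/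

section

namespace Op

variable {N : ℕ} [NeZero N]

namespace IsHomogeneous

variable {m n : ℕ} {f g : Op N m n} {r : ℤ}

theorem add (hf : f.IsHomogeneous r) (hg : g.IsHomogeneous r) : (f + g).IsHomogeneous r := by
  intro x y h
  by_contra hne
  exact h (by rw [Pi.add_apply, Pi.add_apply, hf.eq_zero hne, hg.eq_zero hne, add_zero])

theorem smul (c : ℝ) (hf : f.IsHomogeneous r) : (c • f).IsHomogeneous r := by
  intro x y h
  by_contra hne
  exact h (by rw [Pi.smul_apply, Pi.smul_apply, hf.eq_zero hne, smul_zero])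

theorem sub (hf : f.IsHomogeneous r) (hg : g.IsHomogeneous r) : (f - g).IsHomogeneous r := by
  intro x y h
  by_contra hne
  exact h (by rw [Pi.sub_apply, Pi.sub_apply, hf.eq_zero hne, hg.eq_zero hne, sub_zero])

theorem sum {I : Type*} (s : Finset I) {f : I → Op N m n} (hf : ∀ i, (f i).IsHomogeneous r) :
    (∑ i ∈ s, f i).IsHomogeneous r := by
  intro x y h
  by_contra hne
  exact h (by simp only [Finset.sum_apply, (hf _).eq_zero hne, Finset.sum_const_zero])

theorem relabel (τ : Equiv.Perm (Fin n)) (hf : f.IsHomogeneous r) :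
    (Op.relabel (Equiv.refl _) τ f).IsHomogeneous r := by
  intro x y h
  have h1 := hf _ _ (right_ne_zero_of_mul h)
  rwa [tensorDeg_comp_equiv, tensorDeg_comp_equiv] at h1

theorem tensorLeft (hf : f.IsHomogeneous r) : (Op.tensorLeft f).IsHomogeneous r := by
  intro x y h
  rw [Op.tensorLeft] at h
  split_ifs at h with h1
  · have h2 := hf _ _ h
    rw [tensorDeg, tensorDeg, Fin.sum_univ_castSucc, Fin.sum_univ_castSucc, h1]
    change ((tensorDeg (Fin.init y) + _ : ℕ) : ℤ) - ((tensorDeg (Fin.init x) + _ : ℕ) : ℤ) = r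
    push_cast
    linarith
  · exact absurd rfl h

/-- There are no cochains of negative degree. -/
theorem eq_zero_of_neg {f : Op N 0 n} (hf : f.IsHomogeneous r) (hr : r < 0) : f = 0 := by
  funext x y
  exact hf.eq_zero (by rw [tensorDeg_fin_zero]; omega)

end IsHomogeneous

theorem AgreeOn.of_eq {m n a b : ℕ} {v w : Op N m n} (h : v = w) : AgreeOn a b v w :=
  h ▸ AgreeOn.refl v

/-- Agreement may be rewritten on both sides along equalities. -/
theorem AgreeOn.trans' {m n a b : ℕ} {v w v' w' : Op N m n} (h : AgreeOn a b v w) (hv : v' = v)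
    (hw : w' = w) : AgreeOn a b v' w' := by
  rwa [hv, hw]

theorem relabel_mul_d {m n : ℕ} (τ : Equiv.Perm (Fin n)) (f : Op N m n) :
    relabel (Equiv.refl _) τ f ⊙ d = relabel (Equiv.refl _) τ (f ⊙ d) := by
  rw [relabel_mul (Equiv.refl _) τ τ, relabel_d]

theorem relabel_relabel_refl {m n : ℕ} (σ τ : Equiv.Perm (Fin n)) (f : Op N m n) :
    relabel (Equiv.refl _) τ (relabel (Equiv.refl _) σ f) =
      relabel (Equiv.refl _) (σ.trans τ) f := by
  rw [relabel_relabel, Equiv.refl_trans]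

theorem relabel_vtx {n : ℕ} (τ : Equiv.Perm (Fin n)) (f : Op N 0 n) (k : Fin n → ℕ) :
    relabel (Equiv.refl _) τ f default (vtx k) = f default (vtx (k ∘ τ)) := by
  rw [relabel, koszulSign_refl, koszulSign_of_tensorDeg_le_one, _root_.one_mul, _root_.one_mul]
  · exact congrArg₂ f (Subsingleton.elim _ _) rfl
  · simp [tensorDeg, vtx, cellDeg]

/-- The operations have the same matrix entries whose outputs are all at distance at least `k * ℓ`
from the ends of the arc of all vertices other than `N - 1`. -/
def DeepAgree {m n : ℕ} (ℓ k : ℕ) (v w : Op N m n) : Prop :=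
  AgreeOn (k * ℓ) (N - 2 - k * ℓ) v w

theorem DeepAgree.mono {m n ℓ k k' : ℕ} {v w : Op N m n} (h : DeepAgree ℓ k v w) (hk : k ≤ k') :
    DeepAgree ℓ k' v w :=
  AgreeOn.mono h (Nat.mul_le_mul_right _ hk) (Nat.sub_le_sub_left (Nat.mul_le_mul_right _ hk) _)

theorem DeepAgree.mul {m n p ℓ k : ℕ} {v w : Op N m n} (h : DeepAgree ℓ k v w) {f : Op N n p}
    (hf : f.Spreads ℓ) (hN : (k + 1) * ℓ + 2 ≤ N) : DeepAgree ℓ (k + 1) (v ⊙ f) (w ⊙ f) := by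
  rw [Nat.succ_mul] at hN
  rw [DeepAgree, Nat.succ_mul]
  refine AgreeOn.mul (AgreeOn.mono h le_rfl ?_) hf ?_ <;> omega

/-- The sum of the values of `f` at all permutations of a triple of vertices. -/
def permSum (p : Fin 3 → ℕ) (f : Op N 0 3) : ℝ :=
  ∑ τ : Equiv.Perm (Fin 3), f default (vtx (p ∘ τ))

theorem permSum_relabel (p : Fin 3 → ℕ) (σ : Equiv.Perm (Fin 3)) (f : Op N 0 3) :
    permSum p (relabel (Equiv.refl _) σ f) = permSum p f := by
  refine Eq.trans ?_ (Equiv.sum_comp (Equiv.mulRight σ) fun τ => f default (vtx (p ∘ τ)))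
  exact Finset.sum_congr rfl fun τ _ => relabel_vtx σ f _

theorem permSum_sub (p : Fin 3 → ℕ) (f g : Op N 0 3) :
    permSum p (f - g) = permSum p f - permSum p g := by
  simp [permSum, Finset.sum_sub_distrib]

theorem permSum_smul (p : Fin 3 → ℕ) (c : ℝ) (f : Op N 0 3) :
    permSum p (c • f) = c * permSum p f := by
  simp [permSum, Finset.mul_sum]

theorem permSum_sum {I : Type*} (s : Finset I) (p : Fin 3 → ℕ) (f : I → Op N 0 3) :
    permSum p (∑ i ∈ s, f i) = ∑ i ∈ s, permSum p (f i) := by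
  simp only [permSum, Finset.sum_apply]
  exact Finset.sum_comm

theorem permSum_unit (p : Fin 3 → ℕ) : permSum p (unit 3 : Op N 0 3) = 6 := by
  simp [permSum, unit_vtx, Fintype.card_perm, Nat.factorial]

end Op

open Op

namespace FewOperations

variable {N ℓ : ℕ} [NeZero N] (S : FewOperations N ℓ)

/-- Three vertices that are far from each other on the scale `ℓ + 1`, and far from the ends of
an arc of length `100 * (ℓ + 1)`. -/
def points (ℓ : ℕ) : Fin 3 → ℕ := ![20 * (ℓ + 1), 40 * (ℓ + 1), 60 * (ℓ + 1)]

/-- Primitives on the arc of all vertices other than `N - 1`: an antisymmetric kernel `K` for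
the coproduct of the unit, and primitives `L i` for the values of `X i` on the unit, corrected
by `K` so as to be closed. The constants of integration of the `L i` are fixed by `permSum_L`. -/
structure Primitives where
  K : Op N 0 2
  isHomogeneous_K : K.IsHomogeneous 0
  relabel_K : relabel (Equiv.refl _) (Equiv.swap 0 1) K = -K
  K_mul_d : DeepAgree ℓ 0 (K ⊙ d) (unit 1 ⊙ S.Δ)
  L : S.ι → Op N 0 3
  isHomogeneous_L : ∀ i, (L i).IsHomogeneous 0
  L_mul_d : ∀ i, DeepAgree ℓ 1 (L i ⊙ d) (unit 1 ⊙ S.X i + (1 / 2 : ℝ) •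
    ∑ τ : Equiv.Perm (Fin 3), S.x i τ • relabel (Equiv.refl _) τ (K ⊙ tensorLeft S.Δ))
  permSum_L : ∀ i, permSum (points ℓ) (L i) = 0

theorem exists_K (hN : 100 * (ℓ + 1) ≤ N) : ∃ K : Op N 0 2, K.IsHomogeneous 0 ∧
    relabel (Equiv.refl _) (Equiv.swap 0 1) K = -K ∧ DeepAgree ℓ 0 (K ⊙ d) (unit 1 ⊙ S.Δ) := by
  have h1 : (unit 1 : Op N 0 1) ⊙ S.Δ ⊙ d = 0 := by
    rw [Op.mul_assoc, S.Δ_mul_d, Op.mul_neg, ← Op.mul_assoc, unit_mul_d, Op.zero_mul, neg_zero]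
  obtain ⟨K, hK, hKd⟩ := exists_agreeOn_mul_d (a := 0 * ℓ) (b := N - 2 - 0 * ℓ) (by omega)
    ((isHomogeneous_unit 1).mul S.isHomogeneous_Δ) (AgreeOn.of_eq h1)
  -- Antisymmetrise the primitive; the coproduct is already antisymmetric.
  refine ⟨(1 / 2 : ℝ) • (K - relabel (Equiv.refl _) (Equiv.swap 0 1) K),
    (hK.sub (hK.relabel _)).smul _, ?_, ?_⟩
  · have h2 : (Equiv.swap (0 : Fin 2) 1).trans (Equiv.swap 0 1) = Equiv.refl _ := by decide
    rw [relabel_smul, relabel_sub, relabel_relabel_refl, h2, relabel_refl]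
    module
  · refine ((hKd.sub (hKd.relabel (Equiv.swap 0 1))).smul (1 / 2)).trans' ?_ ?_
    · rw [Op.smul_mul, Op.sub_mul, relabel_mul_d]
    · rw [relabel_refl_mul, S.relabel_Δ, Op.mul_neg]
      module

theorem exists_L (hN : 100 * (ℓ + 1) ≤ N) {K : Op N 0 2} (hK : K.IsHomogeneous 0)
    (hKd : DeepAgree ℓ 0 (K ⊙ d) (unit 1 ⊙ S.Δ)) (i : S.ι) :
    ∃ L : Op N 0 3, L.IsHomogeneous 0 ∧ DeepAgree ℓ 1 (L ⊙ d) (unit 1 ⊙ S.X i + (1 / 2 : ℝ) •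
      ∑ τ : Equiv.Perm (Fin 3), S.x i τ • relabel (Equiv.refl _) τ (K ⊙ tensorLeft S.Δ)) ∧
      permSum (points ℓ) L = 0 := by
  set U : Op N 0 3 := unit 1 ⊙ S.X i + (1 / 2 : ℝ) •
    ∑ τ : Equiv.Perm (Fin 3), S.x i τ • relabel (Equiv.refl _) τ (K ⊙ tensorLeft S.Δ) with hU
  -- The coassociativity defect of `X i` is cancelled by the derivative of `K` on the arc.
  have h1 : U ⊙ d = (1 / 2 : ℝ) • ∑ τ : Equiv.Perm (Fin 3), S.x i τ •
      relabel (Equiv.refl _) τ (unit 1 ⊙ S.Δ ⊙ tensorLeft S.Δ) -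
      (1 / 2 : ℝ) • ∑ τ : Equiv.Perm (Fin 3), S.x i τ •
        relabel (Equiv.refl _) τ (K ⊙ d ⊙ tensorLeft S.Δ) := by
    have h2 : (unit 1 : Op N 0 1) ⊙ S.X i ⊙ d = unit 1 ⊙ (S.X i ⊙ d + d ⊙ S.X i) := by
      rw [Op.mul_add, ← Op.mul_assoc, ← Op.mul_assoc, unit_mul_d, Op.zero_mul, add_zero]
    have h3 : K ⊙ tensorLeft S.Δ ⊙ d = -(K ⊙ d ⊙ tensorLeft S.Δ) := by
      rw [Op.mul_assoc, S.tensorLeft_Δ_mul_d, Op.mul_neg, Op.mul_assoc]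
    rw [hU, Op.add_mul, h2, S.d_X]
    simp only [Op.mul_smul, Op.mul_sum, Op.smul_mul, Op.sum_mul, relabel_mul_d, h3,
      ← relabel_refl_mul, relabel_neg, smul_neg, Finset.sum_neg_distrib, ← Op.mul_assoc,
      sub_eq_add_neg]
  have h4 : DeepAgree ℓ 1 (K ⊙ d ⊙ tensorLeft S.Δ) (unit 1 ⊙ S.Δ ⊙ tensorLeft S.Δ) :=
    hKd.mul S.isQuasilocal_Δ.spreads.tensorLeft (by omega)
  have h5 : AgreeOn (1 * ℓ) (N - 2 - 1 * ℓ) (U ⊙ d) 0 := by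
    have h6 := (AgreeOn.sum Finset.univ fun τ => ((AgreeOn.relabel τ h4).smul
      (S.x i τ))).smul (1 / 2 : ℝ)
    intro x y hy
    rw [h1, Pi.sub_apply, Pi.sub_apply, h6 x y hy, sub_self]
    rfl
  have hUh : U.IsHomogeneous 1 := by
    refine ((isHomogeneous_unit 1).mul (S.isHomogeneous_X i)).add ((IsHomogeneous.sum _ fun τ =>
      IsHomogeneous.smul _ (IsHomogeneous.relabel τ ?_)).smul _)
    exact hK.mul S.isHomogeneous_Δ.tensorLeft
  obtain ⟨L, hL, hLd⟩ := exists_agreeOn_mul_d (by omega) hUh h5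
  -- Subtract a constant to make the sum over the six permutations of `points ℓ` zero.
  refine ⟨L - (permSum (points ℓ) L / 6) • unit 3, hL.sub ((isHomogeneous_unit 3).smul _), ?_, ?_⟩
  · rw [Op.sub_mul, Op.smul_mul, unit_mul_d, smul_zero, sub_zero]
    exact hLd
  · rw [permSum_sub, permSum_smul, permSum_unit]
    ring

theorem nonempty_primitives (hN : 100 * (ℓ + 1) ≤ N) : Nonempty S.Primitives := by
  obtain ⟨K, h1, h2, h3⟩ := S.exists_K hN
  choose L h4 h5 h6 using S.exists_L hN h1 h3
  exact ⟨⟨K, h1, h2, h3, L, h4, h5, h6⟩⟩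

end FewOperations

end

/-! ### The obstruction on the unit, in terms of primitives -/

section

open Op

theorem Op.mul_relabel_eq {N : ℕ} [NeZero N] {m n p : ℕ} (τ : Equiv.Perm (Fin n)) (A : Op N m n)
    (Z : Op N n p) : A ⊙ Op.relabel τ (Equiv.refl _) Z =
      Op.relabel (Equiv.refl _) τ.symm A ⊙ Z := by
  rw [← mul_relabel_left τ (Op.relabel (Equiv.refl _) τ.symm A) Z, relabel_relabel_refl,
    Equiv.symm_trans_self, relabel_refl]

namespace FewOperations

variable {N ℓ : ℕ} [NeZero N] {S : FewOperations N ℓ}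

namespace Primitives

variable (P : S.Primitives)

/-- The mean over all permutations of the combination of the primitives `L i` that is a
primitive for `Y` on the unit. -/
def mean : Op N 0 3 :=
  (1 / 6 : ℝ) • ∑ ρ : Equiv.Perm (Fin 3),
    relabel (Equiv.refl _) ρ.symm (∑ i, S.c i ρ • P.L i)

theorem isHomogeneous_mean : P.mean.IsHomogeneous 0 := by
  rw [mean]
  refine IsHomogeneous.smul _ (IsHomogeneous.sum _ fun ρ => IsHomogeneous.relabel _
    (IsHomogeneous.sum _ fun i => IsHomogeneous.smul _ (P.isHomogeneous_L i)))

theorem permSum_mean : permSum (points ℓ) P.mean = 0 := by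
  simp only [mean, permSum_smul, permSum_sum, permSum_relabel, P.permSum_L, MulZeroClass.mul_zero,
    Finset.sum_const_zero]

/-- The correction of `Y` by the kernel, written out with the known coefficients `y`. -/
theorem sum_y : (1 / 2 : ℝ) • ∑ τ : Equiv.Perm (Fin 3),
      S.y τ • relabel (Equiv.refl _) τ (P.K ⊙ tensorLeft S.Δ) =
    P.K ⊙ tensorRight S.Δ + relabel (Equiv.refl _) (Equiv.swap 0 1) (P.K ⊙ tensorRight S.Δ) := by
  have h1 : ∀ τ : Equiv.Perm (Fin 3),
      relabel (Equiv.refl _) ((Equiv.swap 0 1).trans τ) (P.K ⊙ tensorLeft S.Δ) =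
        -relabel (Equiv.refl _) τ (P.K ⊙ tensorLeft S.Δ) := by
    intro τ
    rw [← relabel_relabel_refl, relabel_refl_mul (Equiv.swap 0 1), relabel_swap_tensorLeft,
      S.relabel_Δ]
    have h2 : tensorLeft (-S.Δ) = -tensorLeft S.Δ := by
      funext x y
      simp only [tensorLeft, Pi.neg_apply]
      split_ifs <;> simp
    rw [h2, Op.mul_neg, relabel_neg]
  have h3 : P.K ⊙ tensorRight S.Δ =
      -relabel (Equiv.refl _) (finRotate 3) (P.K ⊙ tensorLeft S.Δ) :=
    mul_tensorRight_eq P.relabel_K S.Δ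
  have h4 : (finRotate 3).trans (Equiv.swap 0 1) = (Equiv.swap 0 1).trans (finRotate 3).symm := by
    decide
  have h5 : S.y (Equiv.swap 0 1) = 0 := by
    have h := S.y_swap (Equiv.refl _)
    rwa [Equiv.trans_refl, S.y_refl, neg_zero] at h
  rw [h3, relabel_neg, relabel_relabel_refl, h4, h1, sum_perm_fin_three, h1, h1, S.y_swap, S.y_swap,
    S.y_refl, h5, S.y_rotate, S.y_rotate_symm]
  module

theorem mean_mul_d : DeepAgree ℓ 1 (P.mean ⊙ d) (unit 1 ⊙ S.Y + (P.K ⊙ tensorRight S.Δ +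
    relabel (Equiv.refl _) (Equiv.swap 0 1) (P.K ⊙ tensorRight S.Δ))) := by
  refine ((AgreeOn.sum Finset.univ fun ρ => ((AgreeOn.sum Finset.univ fun i =>
    (AgreeOn.smul (S.c i ρ) (P.L_mul_d i))).relabel ρ.symm)).smul (1 / 6)).trans' ?_ ?_
  · simp only [mean, Op.smul_mul, Op.sum_mul, relabel_mul_d]
  · rw [← P.sum_y]
    have h1 : ∀ ρ : Equiv.Perm (Fin 3), relabel (Equiv.refl _) ρ.symm
        (∑ i, S.c i ρ • (unit 1 ⊙ S.X i + (1 / 2 : ℝ) • ∑ τ : Equiv.Perm (Fin 3),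
          S.x i τ • relabel (Equiv.refl _) τ (P.K ⊙ tensorLeft S.Δ))) =
        unit 1 ⊙ S.Y + (1 / 2 : ℝ) • ∑ τ : Equiv.Perm (Fin 3),
          S.y τ • relabel (Equiv.refl _) τ (P.K ⊙ tensorLeft S.Δ) := by
      intro ρ
      have h2 : ∑ i, S.c i ρ • ((unit 1 : Op N 0 1) ⊙ S.X i) =
          relabel (Equiv.refl _) ρ (unit 1 ⊙ S.Y) := by
        rw [relabel_refl_mul, ← S.sum_c, Op.mul_sum]
        simp only [Op.mul_smul]
      have h3 : ∑ i, S.c i ρ • (1 / 2 : ℝ) • ∑ τ : Equiv.Perm (Fin 3),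
          S.x i τ • relabel (Equiv.refl _) τ (P.K ⊙ tensorLeft S.Δ) =
          (1 / 2 : ℝ) • ∑ τ : Equiv.Perm (Fin 3), S.y (τ.trans ρ.symm) •
            relabel (Equiv.refl _) τ (P.K ⊙ tensorLeft S.Δ) := by
        simp only [← S.sum_mul, Finset.smul_sum, Finset.sum_smul, smul_smul]
        rw [Finset.sum_comm]
        refine Finset.sum_congr rfl fun τ _ => Finset.sum_congr rfl fun i _ => ?_
        congr 1
        ring
      simp only [smul_add, Finset.sum_add_distrib]
      rw [h2, h3, relabel_add, relabel_relabel_refl, Equiv.self_trans_symm, relabel_refl,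
        relabel_smul, relabel_sum]
      congr 2
      refine Fintype.sum_equiv (Equiv.mulLeft ρ⁻¹) _ _ fun τ => ?_
      rw [relabel_smul, relabel_relabel_refl]
      rfl
    simp only [h1]
    rw [Finset.sum_const, Finset.card_univ, Fintype.card_perm, Fintype.card_fin]
    simp only [Nat.factorial, ← Nat.cast_smul_eq_nsmul ℝ, smul_smul]
    norm_num

/-- The value of `H` on the unit, corrected by primitives so as to be closed on an arc. -/
def correction : Op N 0 2 :=
  unit 1 ⊙ S.H + (1 / 2 : ℝ) • ∑ τ : Equiv.Perm (Fin 2),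
    relabel (Equiv.refl _) τ (P.mean ⊙ tensorLeft S.m) + (1 / 4 : ℝ) •
      ∑ τ : Equiv.Perm (Fin 2), relabel (Equiv.refl _) τ (P.K ⊙ S.F)

theorem isHomogeneous_correction : P.correction.IsHomogeneous 0 := by
  rw [correction]
  refine (((isHomogeneous_unit 1).mul S.isHomogeneous_H).add ((IsHomogeneous.sum _ fun τ =>
    IsHomogeneous.relabel τ ?_).smul _)).add ((IsHomogeneous.sum _ fun τ =>
    IsHomogeneous.relabel τ ?_).smul _)
  · exact P.isHomogeneous_mean.mul S.isHomogeneous_m.tensorLeft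
  · exact P.isHomogeneous_K.mul S.isHomogeneous_F

/-- The terms through `Y` and `F` in the derivative of `H` are cancelled by the derivatives of
`mean` and of `K`, and the remaining terms, through `tensorRight Δ`, cancel each other. -/
theorem correction_mul_d (hN : 100 * (ℓ + 1) ≤ N) : DeepAgree ℓ 2 (P.correction ⊙ d) 0 := by
  have hH : (unit 1 : Op N 0 1) ⊙ S.H ⊙ d =
      -((1 / 2 : ℝ) • ∑ τ : Equiv.Perm (Fin 2),
        relabel (Equiv.refl _) τ (unit 1 ⊙ S.Y ⊙ tensorLeft S.m)) -
      (1 / 4 : ℝ) • ∑ τ : Equiv.Perm (Fin 2), relabel (Equiv.refl _) τ (unit 1 ⊙ S.Δ ⊙ S.F) := by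
    have h : (unit 1 : Op N 0 1) ⊙ S.H ⊙ d = unit 1 ⊙ (S.H ⊙ d - d ⊙ S.H) := by
      rw [Op.mul_sub, ← Op.mul_assoc, ← Op.mul_assoc, unit_mul_d, Op.zero_mul, sub_zero]
    rw [h, S.d_H]
    simp only [Op.mul_sub, Op.mul_neg, Op.mul_smul, Op.mul_sum, ← relabel_refl_mul, ← Op.mul_assoc]
  have hm : DeepAgree ℓ 2 (P.mean ⊙ tensorLeft S.m ⊙ d) (unit 1 ⊙ S.Y ⊙ tensorLeft S.m +
      (2 : ℝ) • (P.K ⊙ tensorRight S.Δ ⊙ tensorLeft S.m)) := by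
    refine (P.mean_mul_d.mul S.isQuasilocal_m.spreads.tensorLeft (by omega)).trans' ?_ ?_
    · rw [Op.mul_assoc, S.tensorLeft_m_mul_d, Op.mul_assoc]
    · have h : relabel (Equiv.refl _) (Equiv.swap 0 1) (P.K ⊙ tensorRight S.Δ) ⊙ tensorLeft S.m =
          P.K ⊙ tensorRight S.Δ ⊙ tensorLeft S.m := by
        conv_lhs => rw [← S.relabel_m, ← relabel_tensorLeft_swap]
        exact mul_relabel_left _ _ _
      rw [Op.add_mul, Op.add_mul, h]
      module
  have hF : DeepAgree ℓ 1 (P.K ⊙ S.F ⊙ d) (unit 1 ⊙ S.Δ ⊙ S.F - (2 : ℝ) •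
      ∑ τ : Equiv.Perm (Fin 2),
        relabel (Equiv.refl _) τ (P.K ⊙ tensorRight S.Δ ⊙ tensorLeft S.m)) := by
    refine ((P.K_mul_d.mul S.isQuasilocal_F.spreads (by omega)).add (AgreeOn.refl
      (P.K ⊙ (S.F ⊙ d - d ⊙ S.F)))).trans' ?_ ?_
    · rw [Op.mul_sub, ← Op.mul_assoc, ← Op.mul_assoc]
      abel
    · rw [S.mul_d_F P.K P.relabel_K]
      module
  have hF' : DeepAgree ℓ 2 _ _ := hF.mono (by norm_num)
  refine (((AgreeOn.refl (unit 1 ⊙ S.H ⊙ d)).add ((AgreeOn.sum (Finset.univ : Finset (Equiv.Perm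
    (Fin 2))) fun τ =>
    AgreeOn.relabel τ hm).smul (1 / 2))).add ((AgreeOn.sum Finset.univ fun τ =>
    AgreeOn.relabel τ hF').smul (1 / 4))).trans' ?_ ?_
  · simp only [correction, Op.add_mul, Op.smul_mul, Op.sum_mul, relabel_mul_d]
  · rw [hH]
    have hs : (Equiv.swap (0 : Fin 2) 1).trans (Equiv.swap 0 1) = Equiv.refl _ := by decide
    simp only [sum_perm_fin_two, relabel_add, relabel_sub, relabel_smul, relabel_refl,
      relabel_relabel_refl, Equiv.trans_refl, hs]
    module

/-- By closedness, `correction` is constant; `κ` is its value at any pair of vertices of the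
arc. -/
theorem correction_agree (hN : 100 * (ℓ + 1) ≤ N) {κ : ℝ} {p : Fin 2 → ℕ}
    (hp : InBox (2 * ℓ) (N - 2 - 2 * ℓ) p) (h : P.correction default (vtx p) = κ) :
    DeepAgree ℓ 2 P.correction (κ • unit 2) := by
  intro x y hy
  rw [Subsingleton.elim x default]
  by_cases hd : tensorDeg y = 0
  · have h1 := AgreeOn.apply_eq_of_mul_d (by omega) (P.correction_mul_d hN) default
      (inBox_cellVal hy) hp
    rw [← eq_vtx_of_tensorDeg_eq_zero hd] at h1
    rw [h1, h, Pi.smul_apply, Pi.smul_apply, unit, if_pos hd, smul_eq_mul, _root_.mul_one]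
  · have h2 : ((tensorDeg y : ℕ) : ℤ) - (tensorDeg (default : Fin 0 → Cell N) : ℕ) ≠ 0 := by
      rw [tensorDeg_fin_zero]; omega
    rw [IsHomogeneous.eq_zero P.isHomogeneous_correction h2, ((isHomogeneous_unit 2).smul
      κ).eq_zero h2]

/-- On the arc, the obstruction multiplies the unit by `-κ / 2`. In each summand of the
obstruction the factor applied first is replaced by the derivative of its primitive. The
operations `G` and `M i` have degree `-1` and annihilate the primitives, which have degree zero,
so that only their derivatives remain; all terms but that of the constant `κ` cancel. -/
theorem unit_mul_obstruction (hN : 100 * (ℓ + 1) ≤ N) {κ : ℝ}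
    (h : DeepAgree ℓ 2 P.correction (κ • unit 2)) :
    DeepAgree ℓ 3 (unit 1 ⊙ S.obstruction) ((-κ / 2) • unit 1) := by
  have hH : DeepAgree ℓ 3 (unit 1 ⊙ S.H ⊙ S.m) (κ • unit 1 - P.mean ⊙ (tensorLeft S.m ⊙ S.m) -
      (1 / 2 : ℝ) • (P.K ⊙ S.F ⊙ S.m)) := by
    refine ((h.mul S.isQuasilocal_m.spreads (by omega)).sub (AgreeOn.refl
      (P.mean ⊙ (tensorLeft S.m ⊙ S.m) + (1 / 2 : ℝ) • (P.K ⊙ S.F ⊙ S.m)))).trans' ?_ ?_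
    · rw [correction, Op.add_mul, Op.add_mul, Op.smul_mul, Op.smul_mul, S.sum_relabel_mul_m,
        S.sum_relabel_mul_m, Op.mul_assoc P.mean]
      module
    · rw [Op.smul_mul, unit_mul_of_induces_mult S.isHomogeneous_m S.induces_m]
      module
  have hG : DeepAgree ℓ 1 (unit 1 ⊙ S.Δ ⊙ S.G)
      (P.K ⊙ tensorLeft S.Δ ⊙ S.B - (1 / 2 : ℝ) • (P.K ⊙ S.F ⊙ S.m)) := by
    have h0 : P.K ⊙ S.G = 0 :=
      (P.isHomogeneous_K.mul S.isHomogeneous_G).eq_zero_of_neg (by norm_num)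
    have h1 : P.K ⊙ d ⊙ S.G = P.K ⊙ (S.G ⊙ d + d ⊙ S.G) := by
      rw [Op.mul_add, ← Op.mul_assoc, ← Op.mul_assoc, h0, Op.zero_mul, zero_add]
    rw [← S.mul_d_G P.K P.relabel_K, ← h1]
    exact AgreeOn.symm (P.K_mul_d.mul S.isQuasilocal_G.spreads (by omega))
  have hX : DeepAgree ℓ 2 (∑ i, unit 1 ⊙ S.X i ⊙ S.M i)
      ((-3 : ℝ) • (P.mean ⊙ (tensorLeft S.m ⊙ S.m)) -
        (3 : ℝ) • (P.K ⊙ tensorLeft S.Δ ⊙ S.B)) := by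
    have h1 : ∀ i, DeepAgree ℓ 2 (unit 1 ⊙ S.X i ⊙ S.M i)
        (P.L i ⊙ (S.M i ⊙ d + d ⊙ S.M i) - (1 / 2 : ℝ) • ∑ τ : Equiv.Perm (Fin 3),
          S.x i τ • relabel (Equiv.refl _) τ (P.K ⊙ tensorLeft S.Δ) ⊙ S.M i) := by
      intro i
      have h0 : P.L i ⊙ S.M i = 0 :=
        ((P.isHomogeneous_L i).mul (S.isHomogeneous_M i)).eq_zero_of_neg (by norm_num)
      refine ((AgreeOn.symm ((P.L_mul_d i).mul (S.isQuasilocal_M i).spreads (by omega))).sub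
        (AgreeOn.refl (((1 / 2 : ℝ) • ∑ τ : Equiv.Perm (Fin 3),
          S.x i τ • relabel (Equiv.refl _) τ (P.K ⊙ tensorLeft S.Δ)) ⊙ S.M i))).trans' ?_ ?_
      · rw [Op.add_mul, add_sub_cancel_right]
      · rw [Op.mul_add, ← Op.mul_assoc, ← Op.mul_assoc, h0]
        simp only [Op.smul_mul, Op.sum_mul, Op.zero_mul, zero_add]
    have h2 : ∑ i, P.L i ⊙ (S.M i ⊙ d + d ⊙ S.M i) =
        (-3 : ℝ) • (P.mean ⊙ (tensorLeft S.m ⊙ S.m)) := by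
      simp only [S.d_M, Op.mul_neg, Op.mul_smul, Op.mul_sum, Finset.sum_neg_distrib]
      rw [← Finset.smul_sum, Finset.sum_comm]
      simp only [← Op.smul_mul, ← Op.sum_mul, mul_relabel_eq]
      simp only [mean, relabel_sum, relabel_smul, Op.smul_mul]
      module
    have h3 : ∑ i, (1 / 2 : ℝ) • ∑ τ : Equiv.Perm (Fin 3),
        S.x i τ • relabel (Equiv.refl _) τ (P.K ⊙ tensorLeft S.Δ) ⊙ S.M i =
        (3 : ℝ) • (P.K ⊙ tensorLeft S.Δ ⊙ S.B) := by
      rw [← Finset.smul_sum, Finset.sum_comm]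
      simp only [Op.smul_mul]
      simp only [← Op.mul_smul, ← Op.mul_sum, S.sum_x, mul_relabel_left]
      rw [Finset.sum_const, Finset.card_univ, Fintype.card_perm, Fintype.card_fin]
      simp only [Nat.factorial, ← Nat.cast_smul_eq_nsmul ℝ, smul_smul]
      norm_num
    rw [← h2, ← h3, ← Finset.sum_sub_distrib]
    exact AgreeOn.sum _ h1
  have hG' : DeepAgree ℓ 3 _ _ := hG.mono (by norm_num)
  have hX' : DeepAgree ℓ 3 _ _ := hX.mono (by norm_num)
  refine (((AgreeOn.smul (-2⁻¹) hH).add (AgreeOn.smul 2⁻¹ hG')).add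
    (AgreeOn.smul 6⁻¹ hX')).trans' ?_ ?_
  · rw [obstruction, Op.mul_add, Op.mul_add, Op.mul_smul, Op.mul_smul, Op.mul_smul, Op.mul_sum]
    simp only [Op.mul_assoc]
  · module

end Primitives

end FewOperations

end

/-! ### Distant cells -/

section

open Op

namespace FewOperations

variable {N ℓ : ℕ} [NeZero N] {S : FewOperations N ℓ}

/-- The cells are so far apart, relative to their positions on the arc, that they cannot both be
outputs of an `ℓ`-quasilocal operation. -/
def Far (ℓ : ℕ) (c c' : Cell N) : Prop :=
  cellVal c + 3 * (ℓ + 1) ≤ cellVal c' ∨ cellVal c' + 3 * (ℓ + 1) ≤ cellVal c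

/-- The cell is in a part of the arc far from its ends. -/
def InMiddle (ℓ : ℕ) (c : Cell N) : Prop := InArc (10 * (ℓ + 1)) (80 * (ℓ + 1)) c

theorem inMiddle_inl (hN : 100 * (ℓ + 1) ≤ N) {k : ℕ} (h1 : 10 * (ℓ + 1) ≤ k)
    (h2 : k ≤ 80 * (ℓ + 1)) : InMiddle ℓ (Sum.inl (k : ZMod N)) := by
  rw [InMiddle, InArc, ZMod.val_cast_of_lt (by omega)]
  exact ⟨h1, h2⟩

theorem inMiddle_inr (hN : 100 * (ℓ + 1) ≤ N) {k : ℕ} (h1 : 10 * (ℓ + 1) ≤ k)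
    (h2 : k + 1 ≤ 80 * (ℓ + 1)) : InMiddle ℓ (Sum.inr (k : ZMod N)) := by
  rw [InMiddle, InArc, ZMod.val_cast_of_lt (by omega)]
  exact ⟨h1, h2⟩

theorem cellVal_inl {k : ℕ} (h : k < N) : cellVal (Sum.inl (k : ZMod N)) = k :=
  ZMod.val_cast_of_lt h

theorem cellVal_inr {k : ℕ} (h : k < N) : cellVal (Sum.inr (k : ZMod N)) = k :=
  ZMod.val_cast_of_lt h

theorem apply_eq_zero_of_far (hN : 100 * (ℓ + 1) ≤ N) {m n : ℕ} {f : Op N (m + 1) n}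
    (hf : f.IsQuasilocal ℓ) (x : Fin (m + 1) → Cell N) {y : Fin n → Cell N} (j j' : Fin n)
    (hj : InMiddle ℓ (y j)) (h : Far ℓ (y j) (y j')) : f x y = 0 := by
  by_contra h0
  have h1 := hf.cellVal_output h0 j j' (InArc.mono hj (by omega) le_rfl) (by omega)
  rcases h with h | h <;> omega

theorem mul_apply_eq_zero_of_far (hN : 100 * (ℓ + 1) ≤ N) {p m n : ℕ} {f : Op N (m + 1) n}
    (hf : f.IsQuasilocal ℓ) (v : Op N p (m + 1)) (x : Fin p → Cell N) {y : Fin n → Cell N}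
    (j j' : Fin n) (hj : InMiddle ℓ (y j)) (h : Far ℓ (y j) (y j')) : (v ⊙ f) x y = 0 :=
  Finset.sum_eq_zero fun z _ => by
    rw [apply_eq_zero_of_far hN hf z j j' hj h, MulZeroClass.mul_zero]

namespace Primitives

theorem vec_two_update_zero (a b t : ℕ) : Function.update ![a, b] 0 t = ![t, b] := by
  funext i; fin_cases i <;> rfl

theorem vec_three_update_zero (a b c t : ℕ) : Function.update ![a, b, c] 0 t = ![t, b, c] := by
  funext i; fin_cases i <;> rfl

theorem vec_three_update_one (a b c t : ℕ) : Function.update ![a, b, c] 1 t = ![a, t, c] := by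
  funext i; fin_cases i <;> rfl

theorem vec_three_update_two (a b c t : ℕ) : Function.update ![a, b, c] 2 t = ![a, b, t] := by
  funext i; fin_cases i <;> rfl

theorem edg_two_zero (a b : ℕ) :
    (edg ![a, b] 0 : Fin 2 → Cell N) = ![Sum.inr (a : ZMod N), Sum.inl (b : ZMod N)] := by
  funext i; fin_cases i <;> rfl

theorem edg_three_zero (a b c : ℕ) : (edg ![a, b, c] 0 : Fin 3 → Cell N) =
    ![Sum.inr (a : ZMod N), Sum.inl (b : ZMod N), Sum.inl (c : ZMod N)] := by
  funext i; fin_cases i <;> rfl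

theorem edg_three_one (a b c : ℕ) : (edg ![a, b, c] 1 : Fin 3 → Cell N) =
    ![Sum.inl (a : ZMod N), Sum.inr (b : ZMod N), Sum.inl (c : ZMod N)] := by
  funext i; fin_cases i <;> rfl

theorem edg_three_two (a b c : ℕ) : (edg ![a, b, c] 2 : Fin 3 → Cell N) =
    ![Sum.inl (a : ZMod N), Sum.inl (b : ZMod N), Sum.inr (c : ZMod N)] := by
  funext i; fin_cases i <;> rfl

variable (P : S.Primitives)

/-! ### Values of the kernel away from the diagonal -/

theorem K_swap (a b : ℕ) : P.K default (vtx ![b, a]) = -P.K default (vtx ![a, b]) := by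
  have h := congrFun (congrFun P.relabel_K default) (vtx ![a, b])
  rw [relabel_vtx] at h
  rw [← show ![a, b] ∘ Equiv.swap (0 : Fin 2) 1 = ![b, a] by funext i; fin_cases i <;> rfl]
  exact h

theorem K_sub (hN : 100 * (ℓ + 1) ≤ N) {a a' c : ℕ} (h : a ≤ a') (ha' : a' ≤ 80 * (ℓ + 1))
    (hc : c ≤ 80 * (ℓ + 1)) :
    P.K default (vtx ![a', c]) - P.K default (vtx ![a, c]) =
      ∑ r ∈ Finset.Ico a a', (unit 1 ⊙ S.Δ) default (edg ![r, c] 0) := by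
  have h1 := AgreeOn.apply_update (by omega) P.K_mul_d default (k := ![a, c])
    (by
      intro i
      fin_cases i
      · exact ⟨by omega, show a ≤ _ by omega⟩
      · exact ⟨by omega, show c ≤ _ by omega⟩) 0 (s := a) (t := a') (by omega) h (by omega)
  simpa only [vec_two_update_zero] using h1

/-- The kernel is locally constant away from the diagonal, since the coproduct is quasilocal. -/
theorem K_eq (hN : 100 * (ℓ + 1) ≤ N) {a a' c : ℕ} (hc : 10 * (ℓ + 1) ≤ c)
    (hc' : c ≤ 80 * (ℓ + 1)) (ha : a ≤ 80 * (ℓ + 1)) (ha' : a' ≤ 80 * (ℓ + 1))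
    (h : a + 3 * (ℓ + 1) ≤ c ∧ a' + 3 * (ℓ + 1) ≤ c ∨ c + 3 * (ℓ + 1) ≤ a ∧ c + 3 * (ℓ + 1) ≤ a') :
    P.K default (vtx ![a, c]) = P.K default (vtx ![a', c]) := by
  wlog hle : a ≤ a' generalizing a a'
  · exact (this ha' ha (by omega) (le_of_not_ge hle)).symm
  have h1 := P.K_sub hN hle ha' hc'
  rw [Finset.sum_eq_zero] at h1
  · linarith
  · intro r hr
    rw [Finset.mem_Ico] at hr
    rw [edg_two_zero]
    refine mul_apply_eq_zero_of_far hN S.isQuasilocal_Δ _ _ 1 0 (inMiddle_inl hN hc hc') ?_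
    change cellVal (Sum.inl (c : ZMod N)) + _ ≤ cellVal (Sum.inr (r : ZMod N)) ∨
      cellVal (Sum.inr (r : ZMod N)) + _ ≤ cellVal (Sum.inl (c : ZMod N))
    rw [cellVal_inl (by omega), cellVal_inr (by omega)]
    omega

/-- The jump of the kernel across the diagonal is the coefficient of `ω ⊗ 1` in `Δ(1)`. -/
theorem sum_jump (hN : 100 * (ℓ + 1) ≤ N) :
    ∑ r ∈ Finset.Ico (20 * (ℓ + 1)) (60 * (ℓ + 1)), ((unit 1 : Op N 0 1) ⊙ S.Δ) default
      (edg ![r, 40 * (ℓ + 1)] 0) = 1 := by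
  have h := sum_unit_mul_of_induces_comult S.induces_Δ default ((40 * (ℓ + 1) : ℕ) : ZMod N)
  rw [sum_zmod fun t => ((unit 1 : Op N 0 1) ⊙ S.Δ) default
    ![Sum.inr t, Sum.inl ((40 * (ℓ + 1) : ℕ) : ZMod N)]] at h
  rw [← h]
  simp only [edg_two_zero]
  refine Finset.sum_subset (fun r hr => ?_) fun r hr hr' => ?_
  · rw [Finset.mem_Ico] at hr
    exact Finset.mem_range.2 (by omega)
  · rw [Finset.mem_range] at hr
    rw [Finset.mem_Ico] at hr'
    refine mul_apply_eq_zero_of_far hN S.isQuasilocal_Δ _ _ 1 0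
      (inMiddle_inl hN (by omega) (by omega)) ?_
    change cellVal (Sum.inl ((40 * (ℓ + 1) : ℕ) : ZMod N)) + _ ≤ cellVal (Sum.inr (r : ZMod N)) ∨
      cellVal (Sum.inr (r : ZMod N)) + _ ≤ cellVal (Sum.inl ((40 * (ℓ + 1) : ℕ) : ZMod N))
    rw [cellVal_inl (by omega), cellVal_inr hr]
    omega

/-- By antisymmetry, a jump of one across the diagonal makes the kernel equal to `±1 / 2` on its
sides. -/
theorem K_low_and_high (hN : 100 * (ℓ + 1) ≤ N) {u : ℕ} (h1 : 30 * (ℓ + 1) ≤ u)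
    (h2 : u ≤ 50 * (ℓ + 1)) : P.K default (vtx ![20 * (ℓ + 1), u]) = -(1 / 2) ∧
      P.K default (vtx ![60 * (ℓ + 1), u]) = 1 / 2 := by
  have h3 := P.K_sub hN (a := 20 * (ℓ + 1)) (a' := 60 * (ℓ + 1)) (c := 40 * (ℓ + 1)) (by omega)
    (by omega) (by omega)
  rw [sum_jump hN] at h3
  have h4 := P.K_eq hN (a := 40 * (ℓ + 1)) (a' := 60 * (ℓ + 1)) (c := 20 * (ℓ + 1)) (by omega)
    (by omega) (by omega) (by omega) (by omega)
  have h5 := P.K_eq hN (a := 40 * (ℓ + 1)) (a' := 20 * (ℓ + 1)) (c := 60 * (ℓ + 1)) (by omega)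
    (by omega) (by omega) (by omega) (by omega)
  have h6 := P.K_eq hN (a := u) (a' := 40 * (ℓ + 1)) (c := 20 * (ℓ + 1)) (by omega)
    (by omega) (by omega) (by omega) (by omega)
  have h7 := P.K_eq hN (a := u) (a' := 40 * (ℓ + 1)) (c := 60 * (ℓ + 1)) (by omega)
    (by omega) (by omega) (by omega) (by omega)
  have e1 := P.K_swap (20 * (ℓ + 1)) (40 * (ℓ + 1))
  have e2 := P.K_swap (20 * (ℓ + 1)) (60 * (ℓ + 1))
  have e3 := P.K_swap (60 * (ℓ + 1)) (40 * (ℓ + 1))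
  have e4 := P.K_swap (20 * (ℓ + 1)) u
  have e5 := P.K_swap (60 * (ℓ + 1)) u
  constructor <;> linarith

/-! ### Values of the symmetrised primitive -/

/-- The derivative of `mean` on the arc. -/
def meanD : Op N 0 3 := unit 1 ⊙ S.Y + (P.K ⊙ tensorRight S.Δ +
    relabel (Equiv.refl _) (Equiv.swap 0 1) (P.K ⊙ tensorRight S.Δ))

theorem meanD_apply (y : Fin 3 → Cell N) : P.meanD default y = (unit 1 ⊙ S.Y) default y +
    ((P.K ⊙ tensorRight S.Δ) default y +
      relabel (Equiv.refl _) (Equiv.swap 0 1) (P.K ⊙ tensorRight S.Δ) default y) := rfl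

theorem K_mul_tensorRight_eq_zero (hN : 100 * (ℓ + 1) ≤ N) {y : Fin 3 → Cell N}
    (hy : InMiddle ℓ (y 2)) (h : Far ℓ (y 2) (y 1)) :
    (P.K ⊙ tensorRight S.Δ) default y = 0 := by
  rw [mul_tensorRight_apply]
  refine Finset.sum_eq_zero fun z _ => ?_
  rw [apply_eq_zero_of_far hN S.isQuasilocal_Δ z (y := Fin.tail y) 1 0 hy h, MulZeroClass.mul_zero,
    MulZeroClass.mul_zero]

theorem relabel_K_mul_tensorRight_eq_zero (hN : 100 * (ℓ + 1) ≤ N) {y : Fin 3 → Cell N}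
    (hy : InMiddle ℓ (y 2)) (h : Far ℓ (y 2) (y 0)) :
    relabel (Equiv.refl _) (Equiv.swap 0 1) (P.K ⊙ tensorRight S.Δ) default y = 0 := by
  rw [Op.relabel]
  refine mul_eq_zero_of_right _ ?_
  exact P.K_mul_tensorRight_eq_zero hN (y := y ∘ Equiv.swap (0 : Fin 3) 1) hy h

/-- The derivative of `mean` vanishes when its third argument is far from the other two. -/
theorem meanD_eq_zero (hN : 100 * (ℓ + 1) ≤ N) {y : Fin 3 → Cell N} (hy : InMiddle ℓ (y 2))
    (h0 : Far ℓ (y 2) (y 0)) (h1 : Far ℓ (y 2) (y 1)) : P.meanD default y = 0 := by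
  rw [meanD_apply,
    mul_apply_eq_zero_of_far hN S.isQuasilocal_Y _ _ 2 0 hy h0,
    P.K_mul_tensorRight_eq_zero hN hy h1, P.relabel_K_mul_tensorRight_eq_zero hN hy h0]
  norm_num

/-- Near the vertex `40 * (ℓ + 1)`, where `K` is constant in its second argument, `K` factors
out of its composition with the coproduct. -/
theorem K_mul_tensorRight_near (hN : 100 * (ℓ + 1) ≤ N) {c r : ℕ} {κ : ℝ}
    (hK : ∀ u, 30 * (ℓ + 1) ≤ u → u ≤ 50 * (ℓ + 1) → P.K default (vtx ![c, u]) = κ) :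
    (P.K ⊙ tensorRight S.Δ) default (edg ![c, r, 40 * (ℓ + 1)] 1) =
      κ * (unit 1 ⊙ S.Δ) default (edg ![r, 40 * (ℓ + 1)] 0) := by
  rw [mul_tensorRight_apply, mul, Finset.mul_sum, edg_three_one, edg_two_zero]
  refine Finset.sum_congr rfl fun z _ => ?_
  by_cases h0 : S.Δ z ![Sum.inr (r : ZMod N), Sum.inl ((40 * (ℓ + 1) : ℕ) : ZMod N)] = 0
  · rw [h0, MulZeroClass.mul_zero, MulZeroClass.mul_zero]
    exact mul_eq_zero_of_right _ (mul_eq_zero_of_right _ h0)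
  · have h1 := S.isHomogeneous_Δ z _ h0
    have h2 : tensorDeg ![(Sum.inr (r : ZMod N) : Cell N),
        Sum.inl ((40 * (ℓ + 1) : ℕ) : ZMod N)] = 1 := by simp [tensorDeg, cellDeg]
    have h3 : tensorDeg z = 0 := by rw [h2] at h1; omega
    have h4 := S.isQuasilocal_Δ.cellVal_input h0 0 1 (a := 39 * (ℓ + 1)) (b := 60 * (ℓ + 1))
      (InArc.mono (a := 40 * (ℓ + 1)) (b := 40 * (ℓ + 1)) (by
        change _ ≤ ZMod.val _ ∧ ZMod.val _ ≤ _
        rw [ZMod.val_cast_of_lt (by omega)]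
        exact ⟨le_rfl, le_rfl⟩) (by omega) (by omega)) (by omega)
    have h5 : cellVal (![(Sum.inr (r : ZMod N) : Cell N),
        Sum.inl ((40 * (ℓ + 1) : ℕ) : ZMod N)] 1) = 40 * (ℓ + 1) := cellVal_inl (by omega)
    rw [h5] at h4
    have h6 : (Fin.cons (Sum.inl (c : ZMod N)) z : Fin 2 → Cell N) = vtx ![c, cellVal (z 0)] := by
      rw [eq_vtx_of_tensorDeg_eq_zero h3]
      funext i
      fin_cases i
      · rfl
      · simp [vtx, cellVal]
    have h7 : P.K default (Fin.cons (Sum.inl (c : ZMod N)) z : Fin 2 → Cell N) = κ := by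
      rw [h6]
      exact hK _ (by omega) (by omega)
    have h8 : (![Sum.inl (c : ZMod N), Sum.inr (r : ZMod N),
      Sum.inl ((40 * (ℓ + 1) : ℕ) : ZMod N)] : Fin 3 → Cell N) 0 = Sum.inl (c : ZMod N) := rfl
    rw [h8, h7, cellDeg, MulZeroClass.mul_zero, pow_zero, _root_.one_mul, unit, if_pos h3,
      _root_.one_mul]
    rfl

theorem meanD_near_one (hN : 100 * (ℓ + 1) ≤ N) {c r : ℕ} {κ : ℝ} (hc : c < N)
    (hc' : c + 3 * (ℓ + 1) ≤ 40 * (ℓ + 1) ∨ 40 * (ℓ + 1) + 3 * (ℓ + 1) ≤ c)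
    (hK : ∀ u, 30 * (ℓ + 1) ≤ u → u ≤ 50 * (ℓ + 1) → P.K default (vtx ![c, u]) = κ) :
    P.meanD default (edg ![c, r, 40 * (ℓ + 1)] 1) =
      κ * (unit 1 ⊙ S.Δ) default (edg ![r, 40 * (ℓ + 1)] 0) := by
  have hm : InMiddle ℓ ((edg ![c, r, 40 * (ℓ + 1)] 1 : Fin 3 → Cell N) 2) := by
    rw [edg_three_one]
    exact inMiddle_inl hN (by omega) (by omega)
  have hf : Far ℓ ((edg ![c, r, 40 * (ℓ + 1)] 1 : Fin 3 → Cell N) 2)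
      ((edg ![c, r, 40 * (ℓ + 1)] 1 : Fin 3 → Cell N) 0) := by
    rw [edg_three_one]
    change cellVal (Sum.inl ((40 * (ℓ + 1) : ℕ) : ZMod N)) + _ ≤ cellVal (Sum.inl (c : ZMod N)) ∨
      cellVal (Sum.inl (c : ZMod N)) + _ ≤ cellVal (Sum.inl ((40 * (ℓ + 1) : ℕ) : ZMod N))
    rw [cellVal_inl (by omega), cellVal_inl hc]
    omega
  rw [meanD_apply,
    mul_apply_eq_zero_of_far hN S.isQuasilocal_Y _ _ 2 0 hm hf,
    P.relabel_K_mul_tensorRight_eq_zero hN hm hf, P.K_mul_tensorRight_near hN hK]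
  ring

/-- Where `Y` does not contribute, the derivative of `mean` is symmetric in its first two
arguments. -/
theorem meanD_swap (y : Fin 3 → Cell N) (hy : tensorDeg y ≤ 1)
    (hY : (unit 1 ⊙ S.Y) default y = 0)
    (hY' : (unit 1 ⊙ S.Y) default (y ∘ Equiv.swap (0 : Fin 3) 1) = 0) :
    P.meanD default y = P.meanD default (y ∘ Equiv.swap (0 : Fin 3) 1) := by
  have h1 : ∀ z : Fin 3 → Cell N, tensorDeg z ≤ 1 →
      relabel (Equiv.refl _) (Equiv.swap 0 1) (P.K ⊙ tensorRight S.Δ) default z =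
      (P.K ⊙ tensorRight S.Δ) default (z ∘ Equiv.swap (0 : Fin 3) 1) := by
    intro z hz
    rw [Op.relabel, koszulSign_refl, koszulSign_of_tensorDeg_le_one, _root_.one_mul, _root_.one_mul]
    · rfl
    · rwa [tensorDeg_comp_equiv]
  have h2 : (y ∘ Equiv.swap (0 : Fin 3) 1) ∘ Equiv.swap (0 : Fin 3) 1 = y := by
    funext i
    simp
  rw [meanD_apply, meanD_apply, h1 y hy, h1 _ (by rwa [tensorDeg_comp_equiv]), h2, hY, hY']
  ring

theorem meanD_near_zero (hN : 100 * (ℓ + 1) ≤ N) {c r : ℕ} {κ : ℝ} (hc : c < N)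
    (hc' : c + 3 * (ℓ + 1) ≤ 40 * (ℓ + 1) ∨ 40 * (ℓ + 1) + 3 * (ℓ + 1) ≤ c)
    (hK : ∀ u, 30 * (ℓ + 1) ≤ u → u ≤ 50 * (ℓ + 1) → P.K default (vtx ![c, u]) = κ) :
    P.meanD default (edg ![r, c, 40 * (ℓ + 1)] 0) =
      κ * (unit 1 ⊙ S.Δ) default (edg ![r, 40 * (ℓ + 1)] 0) := by
  rw [← P.meanD_near_one hN hc hc' hK]
  have h1 : (edg ![r, c, 40 * (ℓ + 1)] 0 : Fin 3 → Cell N) ∘ Equiv.swap (0 : Fin 3) 1 =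
      edg ![c, r, 40 * (ℓ + 1)] 1 := by
    rw [edg_three_zero, edg_three_one]
    funext i; fin_cases i <;> rfl
  have hm : InMiddle ℓ (Sum.inl ((40 * (ℓ + 1) : ℕ) : ZMod N)) :=
    inMiddle_inl hN (by omega) (by omega)
  have hf : Far ℓ (Sum.inl ((40 * (ℓ + 1) : ℕ) : ZMod N)) (Sum.inl (c : ZMod N)) := by
    rw [Far, cellVal_inl (by omega), cellVal_inl hc]
    omega
  rw [← h1]
  refine P.meanD_swap _ ?_ ?_ ?_
  · rw [edg_three_zero]
    simp [tensorDeg, Fin.sum_univ_three, cellDeg]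
  · rw [edg_three_zero]
    exact mul_apply_eq_zero_of_far hN S.isQuasilocal_Y _ _ 2 1 hm hf
  · rw [h1, edg_three_one]
    exact mul_apply_eq_zero_of_far hN S.isQuasilocal_Y _ _ 2 0 hm hf

end Primitives

end FewOperations

end

/-! ### The constant of the obstruction -/

section

open Op

namespace FewOperations

variable {N ℓ : ℕ} [NeZero N] {S : FewOperations N ℓ}

namespace Primitives

variable (P : S.Primitives)

theorem mean_sub (hN : 100 * (ℓ + 1) ≤ N) {k : Fin 3 → ℕ}
    (hk : InBox (10 * (ℓ + 1)) (80 * (ℓ + 1)) k) (i : Fin 3) {s t : ℕ} (hs : 10 * (ℓ + 1) ≤ s)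
    (hst : s ≤ t) (ht : t ≤ 80 * (ℓ + 1)) :
    P.mean default (vtx (Function.update k i t)) - P.mean default (vtx (Function.update k i s)) =
      ∑ r ∈ Finset.Ico s t, P.meanD default (edg (Function.update k i r) i) := by
  have h : AgreeOn (10 * (ℓ + 1)) (80 * (ℓ + 1)) (P.mean ⊙ d) P.meanD :=
    AgreeOn.mono P.mean_mul_d (by omega) (by omega)
  exact h.apply_update (by omega) default hk i hs hst ht

theorem inBox_three {a b c lo hi : ℕ} (h : lo ≤ a ∧ a ≤ hi ∧ lo ≤ b ∧ b ≤ hi ∧ lo ≤ c ∧ c ≤ hi) :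
    InBox lo hi ![a, b, c] := by
  intro i
  fin_cases i
  · exact ⟨h.1, h.2.1⟩
  · exact ⟨h.2.2.1, h.2.2.2.1⟩
  · exact h.2.2.2.2

theorem mean_eq_of_third (hN : 100 * (ℓ + 1) ≤ N) {a c c' : ℕ} (ha : 10 * (ℓ + 1) ≤ a)
    (ha' : a ≤ 80 * (ℓ + 1)) (hc : 10 * (ℓ + 1) ≤ c) (hcc : c ≤ c') (hc' : c' ≤ 80 * (ℓ + 1))
    (h : a + 3 * (ℓ + 1) ≤ c ∨ c' + 3 * (ℓ + 1) ≤ a) :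
    P.mean default (vtx ![a, a, c]) = P.mean default (vtx ![a, a, c']) := by
  have h1 := P.mean_sub hN (k := ![a, a, c]) (inBox_three (by omega)) 2 hc hcc hc'
  rw [Finset.sum_eq_zero] at h1
  · simp only [vec_three_update_two] at h1
    linarith
  · intro r hr
    rw [Finset.mem_Ico] at hr
    rw [vec_three_update_two, edg_three_two]
    have hf : Far ℓ (Sum.inr (r : ZMod N)) (Sum.inl (a : ZMod N)) := by
      rw [Far, cellVal_inl (by omega), cellVal_inr (by omega)]
      omega
    exact P.meanD_eq_zero hN (inMiddle_inr hN (by omega) (by omega)) hf hf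

/-- `mean` is constant in its first two arguments while both stay far from the third. -/
theorem mean_eq (hN : 100 * (ℓ + 1) ≤ N) {lo hi c : ℕ} (hlo : 10 * (ℓ + 1) ≤ lo)
    (hhi : hi ≤ 80 * (ℓ + 1)) (hc : 10 * (ℓ + 1) ≤ c) (hc' : c ≤ 80 * (ℓ + 1))
    (h : hi + 3 * (ℓ + 1) ≤ c ∨ c + 3 * (ℓ + 1) ≤ lo) {a b a' b' : ℕ} (ha : lo ≤ a ∧ a ≤ hi)
    (hb : lo ≤ b ∧ b ≤ hi) (ha' : lo ≤ a' ∧ a' ≤ hi) (hb' : lo ≤ b' ∧ b' ≤ hi) :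
    P.mean default (vtx ![a, b, c]) = P.mean default (vtx ![a', b', c]) := by
  have hm : InMiddle ℓ (Sum.inl (c : ZMod N)) := inMiddle_inl hN hc hc'
  have hl : ∀ t, lo ≤ t → t ≤ hi → Far ℓ (Sum.inl (c : ZMod N)) (Sum.inl (t : ZMod N)) := by
    intro t h1 h2
    rw [Far, cellVal_inl (by omega), cellVal_inl (by omega)]
    omega
  have hr : ∀ t, lo ≤ t → t ≤ hi → Far ℓ (Sum.inl (c : ZMod N)) (Sum.inr (t : ZMod N)) := by
    intro t h1 h2
    rw [Far, cellVal_inl (by omega), cellVal_inr (by omega)]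
    omega
  have key0 : ∀ a a' b, lo ≤ a → a ≤ a' → a' ≤ hi → lo ≤ b → b ≤ hi →
      P.mean default (vtx ![a, b, c]) = P.mean default (vtx ![a', b, c]) := by
    intro a a' b h1 h2 h3 h4 h5
    have h6 := P.mean_sub hN (k := ![a, b, c]) (inBox_three (by omega)) 0 (s := a) (t := a')
      (by omega) h2 (by omega)
    rw [Finset.sum_eq_zero] at h6
    · simp only [vec_three_update_zero] at h6
      linarith
    · intro r hr'
      rw [Finset.mem_Ico] at hr'
      rw [vec_three_update_zero, edg_three_zero]
      exact P.meanD_eq_zero hN hm (hr r (by omega) (by omega)) (hl b h4 h5)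
  have key1 : ∀ a b b', lo ≤ a → a ≤ hi → lo ≤ b → b ≤ b' → b' ≤ hi →
      P.mean default (vtx ![a, b, c]) = P.mean default (vtx ![a, b', c]) := by
    intro a b b' h1 h2 h3 h4 h5
    have h6 := P.mean_sub hN (k := ![a, b, c]) (inBox_three (by omega)) 1 (s := b) (t := b')
      (by omega) h4 (by omega)
    rw [Finset.sum_eq_zero] at h6
    · simp only [vec_three_update_one] at h6
      linarith
    · intro r hr'
      rw [Finset.mem_Ico] at hr'
      rw [vec_three_update_one, edg_three_one]
      exact P.meanD_eq_zero hN hm (hl a h1 h2) (hr r (by omega) (by omega))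
  have h1 : P.mean default (vtx ![a, b, c]) = P.mean default (vtx ![a', b, c]) := by
    rcases le_total a a' with h2 | h2
    · exact key0 a a' b ha.1 h2 ha'.2 hb.1 hb.2
    · exact (key0 a' a b ha'.1 h2 ha.2 hb.1 hb.2).symm
  rw [h1]
  rcases le_total b b' with h2 | h2
  · exact key1 a' b b' ha'.1 ha'.2 hb.1 h2 hb'.2
  · exact (key1 a' b' b ha'.1 ha'.2 hb'.1 h2 hb.2).symm

/-- The jump of `mean` as its second argument crosses the third one, with the first argument at
`c`, is the value of the kernel at `c`. -/
theorem mean_sub_one (hN : 100 * (ℓ + 1) ≤ N) {c : ℕ} {κ : ℝ} (h10 : 10 * (ℓ + 1) ≤ c)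
    (hc : c ≤ 80 * (ℓ + 1))
    (hc' : c + 3 * (ℓ + 1) ≤ 40 * (ℓ + 1) ∨ 40 * (ℓ + 1) + 3 * (ℓ + 1) ≤ c)
    (hK : ∀ u, 30 * (ℓ + 1) ≤ u → u ≤ 50 * (ℓ + 1) → P.K default (vtx ![c, u]) = κ) :
    P.mean default (vtx ![c, 60 * (ℓ + 1), 40 * (ℓ + 1)]) -
      P.mean default (vtx ![c, 20 * (ℓ + 1), 40 * (ℓ + 1)]) = κ := by
  have h := P.mean_sub hN (k := ![c, 20 * (ℓ + 1), 40 * (ℓ + 1)]) (inBox_three (by omega)) 1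
    (s := 20 * (ℓ + 1)) (t := 60 * (ℓ + 1)) (by omega) (by omega) (by omega)
  simp only [vec_three_update_one] at h
  rw [h, Finset.sum_congr rfl fun r _ => P.meanD_near_one hN (r := r) (by omega) hc' hK,
    ← Finset.mul_sum, sum_jump hN, _root_.mul_one]

theorem mean_sub_zero (hN : 100 * (ℓ + 1) ≤ N) {c : ℕ} {κ : ℝ} (h10 : 10 * (ℓ + 1) ≤ c)
    (hc : c ≤ 80 * (ℓ + 1))
    (hc' : c + 3 * (ℓ + 1) ≤ 40 * (ℓ + 1) ∨ 40 * (ℓ + 1) + 3 * (ℓ + 1) ≤ c)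
    (hK : ∀ u, 30 * (ℓ + 1) ≤ u → u ≤ 50 * (ℓ + 1) → P.K default (vtx ![c, u]) = κ) :
    P.mean default (vtx ![60 * (ℓ + 1), c, 40 * (ℓ + 1)]) -
      P.mean default (vtx ![20 * (ℓ + 1), c, 40 * (ℓ + 1)]) = κ := by
  have h := P.mean_sub hN (k := ![20 * (ℓ + 1), c, 40 * (ℓ + 1)]) (inBox_three (by omega)) 0
    (s := 20 * (ℓ + 1)) (t := 60 * (ℓ + 1)) (by omega) (by omega) (by omega)
  simp only [vec_three_update_zero] at h
  rw [h, Finset.sum_congr rfl fun r _ => P.meanD_near_zero hN (r := r) (by omega) hc' hK,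
    ← Finset.mul_sum, sum_jump hN, _root_.mul_one]

theorem permSum_eq (f : Op N 0 3) (a b c : ℕ) : permSum ![a, b, c] f =
    f default (vtx ![a, b, c]) + f default (vtx ![b, a, c]) + f default (vtx ![b, c, a]) +
      f default (vtx ![c, b, a]) + f default (vtx ![c, a, b]) + f default (vtx ![a, c, b]) := by
  have h1 : ![a, b, c] ∘ Equiv.refl (Fin 3) = ![a, b, c] := rfl
  have h2 : ![a, b, c] ∘ Equiv.swap (0 : Fin 3) 1 = ![b, a, c] := by
    funext i; fin_cases i <;> rfl
  have h3 : ![a, b, c] ∘ finRotate 3 = ![b, c, a] := by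
    funext i; fin_cases i <;> rfl
  have h4 : ![a, b, c] ∘ (Equiv.swap 0 1).trans (finRotate 3) = ![c, b, a] := by
    funext i; fin_cases i <;> rfl
  have h5 : ![a, b, c] ∘ (finRotate 3).symm = ![c, a, b] := by
    funext i; fin_cases i <;> rfl
  have h6 : ![a, b, c] ∘ (Equiv.swap 0 1).trans (finRotate 3).symm = ![a, c, b] := by
    funext i; fin_cases i <;> rfl
  rw [permSum, sum_perm_fin_three, h1, h2, h3, h4, h5, h6]

/-- The value of `mean` at two equal arguments far from the third. Of the values at the six
permutations of `points ℓ`, the two with the middle point in third place are smaller by `1 / 2`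
than the other four, which agree; as their sum is zero, these four are equal to `1 / 6`. -/
theorem mean_low_and_high (hN : 100 * (ℓ + 1) ≤ N) :
    P.mean default (vtx ![20 * (ℓ + 1), 20 * (ℓ + 1), 60 * (ℓ + 1)]) = 1 / 6 ∧
      P.mean default (vtx ![60 * (ℓ + 1), 60 * (ℓ + 1), 20 * (ℓ + 1)]) = 1 / 6 := by
  have hlow := fun u h1 h2 => (P.K_low_and_high hN (u := u) h1 h2).1
  have hhigh := fun u h1 h2 => (P.K_low_and_high hN (u := u) h1 h2).2
  have h1 := P.mean_eq_of_third hN (a := 20 * (ℓ + 1)) (c := 40 * (ℓ + 1)) (c' := 60 * (ℓ + 1))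
    (by omega) (by omega) (by omega) (by omega) (by omega) (by omega)
  have h2 := P.mean_eq hN (lo := 20 * (ℓ + 1)) (hi := 40 * (ℓ + 1)) (c := 60 * (ℓ + 1))
    (by omega) (by omega) (by omega) (by omega) (by omega) (a := 20 * (ℓ + 1))
    (b := 20 * (ℓ + 1)) (a' := 20 * (ℓ + 1)) (b' := 40 * (ℓ + 1)) (by omega) (by omega) (by omega)
    (by omega)
  have h3 := P.mean_eq hN (lo := 20 * (ℓ + 1)) (hi := 40 * (ℓ + 1)) (c := 60 * (ℓ + 1))
    (by omega) (by omega) (by omega) (by omega) (by omega) (a := 20 * (ℓ + 1))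
    (b := 20 * (ℓ + 1)) (a' := 40 * (ℓ + 1)) (b' := 20 * (ℓ + 1)) (by omega) (by omega) (by omega)
    (by omega)
  have h4 := P.mean_eq_of_third hN (a := 60 * (ℓ + 1)) (c := 20 * (ℓ + 1)) (c' := 40 * (ℓ + 1))
    (by omega) (by omega) (by omega) (by omega) (by omega) (by omega)
  have h5 := P.mean_eq hN (lo := 40 * (ℓ + 1)) (hi := 60 * (ℓ + 1)) (c := 20 * (ℓ + 1))
    (by omega) (by omega) (by omega) (by omega) (by omega) (a := 60 * (ℓ + 1))
    (b := 60 * (ℓ + 1)) (a' := 60 * (ℓ + 1)) (b' := 40 * (ℓ + 1)) (by omega) (by omega) (by omega)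
    (by omega)
  have h6 := P.mean_eq hN (lo := 40 * (ℓ + 1)) (hi := 60 * (ℓ + 1)) (c := 20 * (ℓ + 1))
    (by omega) (by omega) (by omega) (by omega) (by omega) (a := 60 * (ℓ + 1))
    (b := 60 * (ℓ + 1)) (a' := 40 * (ℓ + 1)) (b' := 60 * (ℓ + 1)) (by omega) (by omega) (by omega)
    (by omega)
  have h7 := P.mean_sub_one hN (by omega) (by omega) (by omega) hlow
  have h8 := P.mean_sub_zero hN (by omega) (by omega) (by omega) hlow
  have h9 := P.mean_sub_zero hN (by omega) (by omega) (by omega) hhigh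
  have h10 := P.permSum_mean
  rw [points, permSum_eq] at h10
  constructor <;> linarith

/-- The multiplication in the first two arguments reproduces the value of `mean` where `mean` is
constant. -/
theorem mean_mul_tensorLeft (hN : 100 * (ℓ + 1) ≤ N) {q c : ℕ} (hq : 10 * (ℓ + 1) ≤ q)
    (hq' : q ≤ 80 * (ℓ + 1)) {κ : ℝ} (h : ∀ u w, q ≤ u + (ℓ + 1) → u ≤ q + (ℓ + 1) →
      q ≤ w + (ℓ + 1) → w ≤ q + (ℓ + 1) → P.mean default (vtx ![u, w, c]) = κ) :
    (P.mean ⊙ tensorLeft S.m) default (vtx ![q, c]) = κ := by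
  have h1 : κ = κ * (unit 2 ⊙ S.m) default (vtx ![q] : Fin 1 → Cell N) := by
    rw [unit_mul_of_induces_mult S.isHomogeneous_m S.induces_m, unit_vtx, _root_.mul_one]
  rw [h1, mul_tensorLeft_apply, mul, Finset.mul_sum]
  have h2 : Fin.init (vtx ![q, c] : Fin 2 → Cell N) = vtx ![q] := by
    funext i; fin_cases i; rfl
  refine Finset.sum_congr rfl fun z _ => ?_
  rw [h2]
  by_cases h0 : S.m z (vtx ![q]) = 0
  · rw [h0, MulZeroClass.mul_zero, MulZeroClass.mul_zero, MulZeroClass.mul_zero]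
  · have h3 := S.isHomogeneous_m z _ h0
    have h4 : tensorDeg (vtx ![q] : Fin 1 → Cell N) = 0 := by simp [tensorDeg, vtx, cellDeg]
    have h5 : tensorDeg z = 0 := by rw [h4] at h3; omega
    have h6 : InArc (10 * (ℓ + 1)) (80 * (ℓ + 1)) ((vtx ![q] : Fin 1 → Cell N) 0) :=
      inMiddle_inl hN hq hq'
    have h7 := fun i => S.isQuasilocal_m.cellVal_input h0 i 0 (a := 9 * (ℓ + 1))
      (h6.mono (by omega) le_rfl) (by omega)
    have h8 : cellVal ((vtx ![q] : Fin 1 → Cell N) 0) = q := cellVal_inl (k := q) (by omega)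
    rw [h8] at h7
    have h9 : (Fin.snoc z ((vtx ![q, c] : Fin 2 → Cell N) (Fin.last 1)) : Fin 3 → Cell N) =
        vtx ![cellVal (z 0), cellVal (z 1), c] := by
      rw [eq_vtx_of_tensorDeg_eq_zero h5]
      funext i
      fin_cases i
      · simp [vtx, cellVal, Fin.snoc]
      · simp [vtx, cellVal, Fin.snoc]
      · simp [vtx, Fin.snoc, Fin.last]
    have h10 := h7 0
    have h11 := h7 1
    have h12 : P.mean default (Fin.snoc z ((vtx ![q, c] : Fin 2 → Cell N) (Fin.last 1)) :
        Fin 3 → Cell N) = κ := by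
      rw [h9]
      exact h _ _ (by omega) (by omega) (by omega) (by omega)
    rw [unit, if_pos h5, _root_.one_mul]
    exact congrArg (· * _) h12

/-- At distant vertices `H` and `F` do not contribute to `correction`, and only values of `mean`
remain. -/
theorem correction_low_high (hN : 100 * (ℓ + 1) ≤ N) :
    P.correction default (vtx ![20 * (ℓ + 1), 60 * (ℓ + 1)]) = 1 / 6 := by
  have h1 : (P.mean ⊙ tensorLeft S.m) default (vtx ![20 * (ℓ + 1), 60 * (ℓ + 1)]) = 1 / 6 := by
    refine P.mean_mul_tensorLeft hN (by omega) (by omega) fun u w h1 h2 h3 h4 => ?_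
    rw [← (P.mean_low_and_high hN).1]
    exact P.mean_eq hN (lo := 19 * (ℓ + 1)) (hi := 21 * (ℓ + 1)) (by omega) (by omega) (by omega)
      (by omega) (by omega) (by omega) (by omega) (by omega) (by omega)
  have h2 : (P.mean ⊙ tensorLeft S.m) default (vtx ![60 * (ℓ + 1), 20 * (ℓ + 1)]) = 1 / 6 := by
    refine P.mean_mul_tensorLeft hN (by omega) (by omega) fun u w h1 h2 h3 h4 => ?_
    rw [← (P.mean_low_and_high hN).2]
    exact P.mean_eq hN (lo := 59 * (ℓ + 1)) (hi := 61 * (ℓ + 1)) (by omega) (by omega) (by omega)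
      (by omega) (by omega) (by omega) (by omega) (by omega) (by omega)
  have hs : ![20 * (ℓ + 1), 60 * (ℓ + 1)] ∘ Equiv.swap (0 : Fin 2) 1 =
      ![60 * (ℓ + 1), 20 * (ℓ + 1)] := by
    funext i; fin_cases i <;> rfl
  have hl : InMiddle (N := N) ℓ (Sum.inl ((20 * (ℓ + 1) : ℕ) : ZMod N)) :=
    inMiddle_inl hN (by omega) (by omega)
  have hh : InMiddle (N := N) ℓ (Sum.inl ((60 * (ℓ + 1) : ℕ) : ZMod N)) :=
    inMiddle_inl hN (by omega) (by omega)
  have hf : Far (N := N) ℓ (Sum.inl ((20 * (ℓ + 1) : ℕ) : ZMod N))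
      (Sum.inl ((60 * (ℓ + 1) : ℕ) : ZMod N)) := by
    rw [Far, cellVal_inl (by omega), cellVal_inl (by omega)]
    omega
  have h3 : ((unit 1 : Op N 0 1) ⊙ S.H) default (vtx ![20 * (ℓ + 1), 60 * (ℓ + 1)]) = 0 :=
    mul_apply_eq_zero_of_far hN S.isQuasilocal_H _ _ 0 1 hl hf
  have h4 : (P.K ⊙ S.F) default (vtx ![20 * (ℓ + 1), 60 * (ℓ + 1)]) = 0 :=
    mul_apply_eq_zero_of_far hN S.isQuasilocal_F _ _ 0 1 hl hf
  have h5 : (P.K ⊙ S.F) default (vtx ![60 * (ℓ + 1), 20 * (ℓ + 1)]) = 0 :=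
    mul_apply_eq_zero_of_far hN S.isQuasilocal_F _ _ 1 0 hl hf
  simp only [correction, Pi.add_apply, Pi.smul_apply, relabel_vtx,
    sum_perm_fin_two, hs, h3, h5, smul_eq_mul]
  rw [show ![20 * (ℓ + 1), 60 * (ℓ + 1)] ∘ Equiv.refl (Fin 2) = ![20 * (ℓ + 1), 60 * (ℓ + 1)] from
    rfl, h1, h2, h4]
  norm_num

end Primitives

variable (S) in
theorem unit_mul_obstruction_agree (hN : 100 * (ℓ + 1) ≤ N) :
    DeepAgree ℓ 3 (unit 1 ⊙ S.obstruction) ((-(1 / 12) : ℝ) • unit 1) := by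
  obtain ⟨P⟩ := S.nonempty_primitives hN
  have h1 := P.correction_agree hN (p := ![20 * (ℓ + 1), 60 * (ℓ + 1)]) (by
    intro i
    fin_cases i
    · exact ⟨show _ ≤ 20 * (ℓ + 1) by omega, show 20 * (ℓ + 1) ≤ _ by omega⟩
    · exact ⟨show _ ≤ 60 * (ℓ + 1) by omega, show 60 * (ℓ + 1) ≤ _ by omega⟩)
    (P.correction_low_high hN)
  have h2 := P.unit_mul_obstruction hN h1
  rwa [show (-(1 / 6) / 2 : ℝ) = -(1 / 12) by norm_num] at h2

end FewOperations

end

section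

namespace Op

variable {N : ℕ} [NeZero N]

/-! ### Cochains of degree one -/

/-- Outputs of a quasilocal operation are close to each input. -/
theorem IsQuasilocal.cellVal_output_of_input {m n ℓ : ℕ} {f : Op N m n} (hf : f.IsQuasilocal ℓ)
    {x : Fin m → Cell N} {y : Fin n → Cell N} (h : f x y ≠ 0) (i : Fin m) (j : Fin n)
    (h1 : ℓ + 1 ≤ cellVal (x i)) (h2 : cellVal (x i) + ℓ < N) :
    cellVal (y j) ≤ cellVal (x i) + ℓ ∧ cellVal (x i) ≤ cellVal (y j) + ℓ + 1 := by
  obtain ⟨p, hp, hpx⟩ := exists_mem_cellVerts (x i)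
  obtain ⟨q, hq, hpq⟩ := (Finset.inf'_le_iff _).1 ((Finset.sup'_le_iff _ _).1 (hf x y h i j) p hp)
  rw [vertexDist_comm] at hpq
  have h3 := val_of_vertexDist_le (a := p.val - ℓ) (b := p.val) (by omega) hpq (by omega) le_rfl
  have h4 := cellVal_of_mem_cellVerts hq (by omega)
  omega

/-- The same for a composition of two quasilocal operations with one input and one output. -/
theorem mul_cellVal_output_of_input {ℓ n : ℕ} {f : Op N 1 (n + 1)} {g : Op N (n + 1) 1}
    (hf : f.IsQuasilocal ℓ) (hg : g.IsQuasilocal ℓ) {x y : Fin 1 → Cell N} (h : (f ⊙ g) x y ≠ 0)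
    (h1 : 2 * ℓ + 2 ≤ cellVal (x 0)) (h2 : cellVal (x 0) + 2 * ℓ < N) :
    cellVal (y 0) ≤ cellVal (x 0) + 2 * ℓ ∧ cellVal (x 0) ≤ cellVal (y 0) + 2 * ℓ + 2 := by
  obtain ⟨z, -, hz⟩ := Finset.exists_ne_zero_of_sum_ne_zero h
  have h3 := hf.cellVal_output_of_input (left_ne_zero_of_mul hz) 0 0 (by omega) (by omega)
  have h4 := hg.cellVal_output_of_input (right_ne_zero_of_mul hz) 0 0 (by omega) (by omega)
  omega

/-- The sum of the vertex cochains `f_x` with `q < x ≤ p`. -/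
def chain (q p : ℕ) : Op N 0 1 := fun _ y =>
  Sum.elim (fun x => if q < x.val ∧ x.val ≤ p then 1 else 0) (fun _ => 0) (y 0)

/-- The cochain of the edge after the vertex `q`, a representative of the class `ω`. -/
def edgeCochain (q : ℕ) : Op N 0 1 := fun _ y =>
  Sum.elim (fun _ => 0) (fun x => if x.val = q then 1 else 0) (y 0)

theorem mul_d_apply_one (v : Op N 0 1) (x : Fin 0 → Cell N) (y : Fin 1 → Cell N) :
    (v ⊙ d) x y = Sum.elim (fun _ => (0 : ℝ)) (fun k => v x (fun _ => Sum.inl (k + 1)) -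
      v x (fun _ => Sum.inl k)) (y 0) := by
  have h : ∀ c, Function.update y 0 c = fun _ => c := by
    intro c
    funext i
    rw [Subsingleton.elim i 0, Function.update_self]
  rw [mul_d_apply, Fin.sum_univ_one]
  simp [h]

theorem val_add_one_eq (k : ZMod N) :
    (k + 1).val = if k.val + 1 < N then k.val + 1 else 0 := by
  split_ifs with h1
  · exact val_add_one h1
  · have h2 : k.val + 1 = N := le_antisymm (ZMod.val_lt k) (not_lt.1 h1)
    have h3 : k + 1 = 0 := by
      rw [← ZMod.natCast_zmod_val k]
      exact_mod_cast (congrArg (Nat.cast : ℕ → ZMod N) h2).trans (ZMod.natCast_self N)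
    rw [h3, ZMod.val_zero]

theorem chain_mul_d {q p : ℕ} (hq : q ≤ p) (hp : p + 1 < N) :
    (chain q p : Op N 0 1) ⊙ d = edgeCochain q - edgeCochain p := by
  funext x y
  rw [mul_d_apply_one, Pi.sub_apply, Pi.sub_apply]
  rcases h : y 0 with k | k
  · simp [edgeCochain, h]
  · simp only [edgeCochain, h, chain, Sum.elim_inl, Sum.elim_inr]
    have h1 := val_add_one_eq k
    have h2 := ZMod.val_lt k
    split_ifs at h1 <;> split_ifs <;> first | omega | norm_num

theorem edgeCochain_mul {n : ℕ} {q : ℕ} (hq : q < N) (f : Op N 1 n) (x : Fin 0 → Cell N)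
    (y : Fin n → Cell N) : (edgeCochain q ⊙ f) x y = f (fun _ => Sum.inr (q : ZMod N)) y := by
  rw [mul, Fintype.sum_eq_single (fun _ => Sum.inr (q : ZMod N))]
  · simp [edgeCochain, ZMod.val_cast_of_lt hq]
  · intro z hz
    rw [edgeCochain]
    rcases h : z 0 with k | k
    · simp
    · rw [Sum.elim_inr, if_neg, MulZeroClass.zero_mul]
      intro h1
      apply hz
      funext i
      rw [Subsingleton.elim i 0, h, ← h1, ZMod.natCast_zmod_val]

theorem sum_mul_d (v : Op N 0 1) (x : Fin 0 → Cell N) :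
    ∑ t : ZMod N, (v ⊙ d) x (fun _ => Sum.inr t) = 0 := by
  simp only [mul_d_apply_one, Sum.elim_inr, Finset.sum_sub_distrib]
  rw [sub_eq_zero]
  exact Equiv.sum_comp (Equiv.addRight (1 : ZMod N)) fun t => v x (fun _ => Sum.inl t)

/-- A degree-one cochain with vanishing integral is exact. -/
theorem exists_mul_d_eq {v : Op N 0 1} (hv : v.IsHomogeneous 1)
    (h : ∑ t : ZMod N, v default (fun _ => Sum.inr t) = 0) : ∃ w : Op N 0 1, w ⊙ d = v := by
  rw [sum_zmod fun t => v default fun _ => Sum.inr t] at h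
  refine ⟨fun _ y => Sum.elim (fun x => ∑ r ∈ Finset.range x.val,
    v default (fun _ => Sum.inr (r : ZMod N))) (fun _ => 0) (y 0), ?_⟩
  funext x y
  rw [Subsingleton.elim x default, mul_d_apply_one]
  rcases hy : y 0 with k | k
  · rw [hv.eq_zero, Sum.elim_inl]
    rw [tensorDeg_fin_zero, tensorDeg_fin_one, hy]
    simp [cellDeg]
  · have h2 : y = fun _ => Sum.inr k := by
      funext i
      rw [Subsingleton.elim i 0, hy]
    simp only [Sum.elim_inr, Sum.elim_inl]
    rw [val_add_one_eq k]
    split_ifs with h1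
    · rw [Finset.sum_range_succ, add_sub_cancel_left, ZMod.natCast_zmod_val, h2]
    · have h3 : N = k.val + 1 := le_antisymm (not_lt.1 h1) (ZMod.val_lt k)
      have h4 : ∑ r ∈ Finset.range (k.val + 1), v default (fun _ => Sum.inr (r : ZMod N)) = 0 := by
        rw [← h3]
        exact h
      rw [Finset.sum_range_succ, ZMod.natCast_zmod_val] at h4
      rw [Finset.sum_range_zero, h2]
      linarith

end Op

open Op

namespace FewOperations

variable {N ℓ : ℕ} [NeZero N] (S : FewOperations N ℓ)

/-- The obstruction multiplies the unit by `-1 / 12` on the whole circle: the product is closed,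
hence constant, and its value is known on an arc. -/
theorem unit_mul_obstruction (hN : 100 * (ℓ + 1) ≤ N) :
    unit 1 ⊙ S.obstruction = (-(1 / 12) : ℝ) • unit 1 := by
  have h1 : AgreeOn 0 (N - 1) (unit 1 ⊙ S.obstruction ⊙ d) 0 := by
    refine AgreeOn.of_eq ?_
    rw [Op.mul_assoc, S.obstruction_mul_d, ← Op.mul_assoc, unit_mul_d, Op.zero_mul]
  have h2 : (unit 1 ⊙ S.obstruction) default (vtx ![50 * (ℓ + 1)]) = -(1 / 12) := by
    rw [S.unit_mul_obstruction_agree hN default (vtx ![50 * (ℓ + 1)])]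
    · rw [Pi.smul_apply, Pi.smul_apply, unit_vtx, smul_eq_mul, _root_.mul_one]
    · refine inArc_vtx ?_ (by omega)
      intro i
      fin_cases i
      exact ⟨show _ ≤ 50 * (ℓ + 1) by omega, show 50 * (ℓ + 1) ≤ _ by omega⟩
  funext x y
  rw [Subsingleton.elim x default]
  by_cases hy : tensorDeg y = 0
  · have h3 : ∀ j, InArc 0 (N - 1) (vtx (N := N) (fun j => cellVal (y j)) j) := by
      intro j
      exact ⟨Nat.zero_le _, Nat.le_sub_one_of_lt (ZMod.val_lt _)⟩
    rw [← eq_vtx_of_tensorDeg_eq_zero hy] at h3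
    have h4 := h1.apply_eq_of_mul_d (by omega) default (inBox_cellVal h3)
      (l := ![50 * (ℓ + 1)]) (by
        intro i
        fin_cases i
        exact ⟨Nat.zero_le _, show 50 * (ℓ + 1) ≤ _ by omega⟩)
    rw [← eq_vtx_of_tensorDeg_eq_zero hy] at h4
    rw [h4, h2, Pi.smul_apply, Pi.smul_apply, unit, if_pos hy, smul_eq_mul, _root_.mul_one]
  · have h3 : ((tensorDeg y : ℕ) : ℤ) - (tensorDeg (default : Fin 0 → Cell N) : ℕ) ≠ 0 := by
      rw [tensorDeg_fin_zero]; omega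
    rw [((isHomogeneous_unit 1).mul S.isHomogeneous_obstruction).eq_zero (by simpa using h3),
      ((isHomogeneous_unit 1).smul _).eq_zero h3]

theorem agreeOn_mul_obstruction {a b : ℕ} {v w : Op N 0 1} (h : AgreeOn a (b + ℓ + ℓ) v w)
    (hN : b + ℓ + ℓ + 1 < N) :
    AgreeOn (a + ℓ + ℓ) b (v ⊙ S.obstruction) (w ⊙ S.obstruction) := by
  have key : ∀ v : Op N 0 1, v ⊙ S.obstruction = (-2⁻¹ : ℝ) • (v ⊙ S.H ⊙ S.m) +
      (2⁻¹ : ℝ) • (v ⊙ S.Δ ⊙ S.G) + (6⁻¹ : ℝ) • ∑ i, v ⊙ S.X i ⊙ S.M i := by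
    intro v
    rw [obstruction, Op.mul_add, Op.mul_add, Op.mul_smul, Op.mul_smul, Op.mul_smul, Op.mul_sum]
    simp only [Op.mul_assoc]
  have h2 : ∀ {n : ℕ} {f : Op N 1 (n + 1)} {g : Op N (n + 1) 1}, f.IsQuasilocal ℓ →
      g.IsQuasilocal ℓ → AgreeOn (a + ℓ + ℓ) b (v ⊙ f ⊙ g) (w ⊙ f ⊙ g) := fun hf hg =>
    (h.mul hf.spreads (by omega)).mul hg.spreads (by omega)
  rw [key, key]
  exact (((h2 S.isQuasilocal_H S.isQuasilocal_m).smul _).add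
    ((h2 S.isQuasilocal_Δ S.isQuasilocal_G).smul _)).add
    ((AgreeOn.sum _ fun i => h2 (S.isQuasilocal_X i) (S.isQuasilocal_M i)).smul _)

/-- The obstruction is quasilocal. -/
theorem obstruction_apply_eq_zero {x y : Fin 1 → Cell N} (h1 : 2 * ℓ + 2 ≤ cellVal (x 0))
    (h2 : cellVal (x 0) + 2 * ℓ < N)
    (h : cellVal (x 0) + 2 * ℓ < cellVal (y 0) ∨ cellVal (y 0) + 2 * ℓ + 2 < cellVal (x 0)) :
    S.obstruction x y = 0 := by
  have key : ∀ {n : ℕ} {f : Op N 1 (n + 1)} {g : Op N (n + 1) 1}, f.IsQuasilocal ℓ →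
      g.IsQuasilocal ℓ → (f ⊙ g) x y = 0 := by
    intro n f g hf hg
    by_contra h0
    have := mul_cellVal_output_of_input hf hg h0 h1 h2
    omega
  simp only [obstruction, Pi.add_apply, Pi.smul_apply, Finset.sum_apply,
    key S.isQuasilocal_H S.isQuasilocal_m, key S.isQuasilocal_Δ S.isQuasilocal_G,
    key (S.isQuasilocal_X _) (S.isQuasilocal_M _)]
  simp

/-- The integral of the value of the obstruction on an edge does not depend on the edge, as all
edges are cohomologous. -/
theorem sum_obstruction_eq {q p : ℕ} (hq : q ≤ p) (hp : p + 1 < N) :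
    ∑ t : ZMod N, S.obstruction (fun _ => Sum.inr (q : ZMod N)) (fun _ => Sum.inr t) =
      ∑ t : ZMod N, S.obstruction (fun _ => Sum.inr (p : ZMod N)) (fun _ => Sum.inr t) := by
  have h := sum_mul_d (chain q p ⊙ S.obstruction) default
  have h1 : chain q p ⊙ S.obstruction ⊙ d = edgeCochain q ⊙ S.obstruction -
      edgeCochain p ⊙ S.obstruction := by
    rw [Op.mul_assoc, S.obstruction_mul_d, ← Op.mul_assoc, chain_mul_d hq hp, Op.sub_mul]
  rw [h1] at h
  simp only [Pi.sub_apply, Finset.sum_sub_distrib] at h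
  rw [sub_eq_zero] at h
  simpa only [edgeCochain_mul (show q < N by omega), edgeCochain_mul (show p < N by omega)] using h

/-- The integral of the value of the obstruction on an edge is `-1 / 12`. The edges after
`10 * (ℓ + 1)` and `50 * (ℓ + 1)` differ by the coboundary of a chain of vertices that looks
like the unit near `25 * (ℓ + 1)` and like zero near `75 * (ℓ + 1)`; between these vertices only
the second edge contributes. -/
theorem sum_obstruction_middle (hN : 100 * (ℓ + 1) ≤ N) :
    ∑ t : ZMod N, S.obstruction (fun _ => Sum.inr ((50 * (ℓ + 1) : ℕ) : ZMod N))
      (fun _ => Sum.inr t) = -(1 / 12) := by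
  have hin : ∀ {q : ℕ}, q < N → cellVal (Sum.inr (q : ZMod N)) = q := cellVal_inr
  have h1 : AgreeOn (25 * (ℓ + 1)) (75 * (ℓ + 1))
      (chain (10 * (ℓ + 1)) (50 * (ℓ + 1)) ⊙ S.obstruction ⊙ d)
      (edgeCochain (10 * (ℓ + 1)) ⊙ S.obstruction - edgeCochain (50 * (ℓ + 1)) ⊙ S.obstruction) :=
        by
    refine AgreeOn.of_eq ?_
    rw [Op.mul_assoc, S.obstruction_mul_d, ← Op.mul_assoc, chain_mul_d (by omega) (by omega),
      Op.sub_mul]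
  have h2 := h1.apply_update (by omega) default (k := ![25 * (ℓ + 1)]) (by
    intro i
    fin_cases i
    exact ⟨le_rfl, show 25 * (ℓ + 1) ≤ _ by omega⟩) 0 (s := 25 * (ℓ + 1)) (t := 75 * (ℓ + 1)) le_rfl
    (by omega) le_rfl
  have hu : ∀ t : ℕ, Function.update ![25 * (ℓ + 1)] 0 t = ![t] := by
    intro t
    funext i
    rw [Subsingleton.elim i 0]
    rfl
  have he : ∀ t : ℕ, (edg ![t] 0 : Fin 1 → Cell N) = fun _ => Sum.inr (t : ZMod N) := by
    intro t
    funext i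
    rw [Subsingleton.elim i 0]
    rfl
  have hlow : (chain (10 * (ℓ + 1)) (50 * (ℓ + 1)) ⊙ S.obstruction) default
      (vtx ![25 * (ℓ + 1)]) = -(1 / 12) := by
    have h3 : AgreeOn (N := N) (11 * (ℓ + 1)) (48 * (ℓ + 1) + ℓ + ℓ)
        (chain (10 * (ℓ + 1)) (50 * (ℓ + 1))) (unit 1) := by
      intro x y hy
      have h4 := hy 0
      rw [chain, unit, tensorDeg_fin_one]
      rcases h5 : y 0 with k | k
      · rw [h5] at h4
        have h6 := h4.1
        have h7 := h4.2
        rw [Sum.elim_inl, if_pos (by omega)]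
        rfl
      · rw [Sum.elim_inr, if_neg (by simp [cellDeg])]
    rw [S.agreeOn_mul_obstruction h3 (by omega), S.unit_mul_obstruction hN, Pi.smul_apply,
      Pi.smul_apply, unit_vtx, smul_eq_mul, _root_.mul_one]
    refine inArc_vtx ?_ (by omega)
    intro i
    fin_cases i
    exact ⟨show _ ≤ 25 * (ℓ + 1) by omega, show 25 * (ℓ + 1) ≤ _ by omega⟩
  have hhigh : (chain (10 * (ℓ + 1)) (50 * (ℓ + 1)) ⊙ S.obstruction) default
      (vtx ![75 * (ℓ + 1)]) = 0 := by
    have h3 : AgreeOn (N := N) (51 * (ℓ + 1)) (90 * (ℓ + 1) + ℓ + ℓ)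
        (chain (10 * (ℓ + 1)) (50 * (ℓ + 1))) 0 := by
      intro x y hy
      have h4 := hy 0
      rw [chain]
      rcases h5 : y 0 with k | k
      · rw [h5] at h4
        have h6 := h4.1
        rw [Sum.elim_inl, if_neg (by omega)]
        rfl
      · rfl
    rw [S.agreeOn_mul_obstruction h3 (by omega), Op.zero_mul]
    · rfl
    refine inArc_vtx ?_ (by omega)
    intro i
    fin_cases i
    exact ⟨show _ ≤ 75 * (ℓ + 1) by omega, show 75 * (ℓ + 1) ≤ _ by omega⟩
  -- Between the two vertices, the value on the edge at `10 * (ℓ + 1)` vanishes by quasilocality.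
  simp only [hu, he, hlow, hhigh] at h2
  have h3 : ∀ r ∈ Finset.Ico (25 * (ℓ + 1)) (75 * (ℓ + 1)),
      (edgeCochain (10 * (ℓ + 1)) ⊙ S.obstruction - edgeCochain (50 * (ℓ + 1)) ⊙ S.obstruction)
        default (fun _ => Sum.inr (r : ZMod N)) =
      -S.obstruction (fun _ => Sum.inr ((50 * (ℓ + 1) : ℕ) : ZMod N))
        (fun _ => Sum.inr (r : ZMod N)) := by
    intro r hr
    rw [Finset.mem_Ico] at hr
    rw [Pi.sub_apply, Pi.sub_apply, edgeCochain_mul (by omega), edgeCochain_mul (by omega),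
      S.obstruction_apply_eq_zero (x := fun _ => Sum.inr ((10 * (ℓ + 1) : ℕ) : ZMod N)), zero_sub]
    · rw [hin (by omega)]; omega
    · rw [hin (by omega)]; omega
    · rw [hin (by omega), hin (by omega)]; omega
  rw [Finset.sum_congr rfl h3, Finset.sum_neg_distrib] at h2
  rw [sum_zmod fun t => S.obstruction (fun _ => Sum.inr ((50 * (ℓ + 1) : ℕ) : ZMod N))
    (fun _ => Sum.inr t), ← Finset.sum_subset (s₁ := Finset.Ico (25 * (ℓ + 1)) (75 * (ℓ + 1)))]
  · linarith
  · intro r hr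
    rw [Finset.mem_Ico] at hr
    exact Finset.mem_range.2 (by omega)
  · intro r hr hr'
    rw [Finset.mem_range] at hr
    rw [Finset.mem_Ico] at hr'
    refine S.obstruction_apply_eq_zero ?_ ?_ ?_
    · rw [hin (by omega)]; omega
    · rw [hin (by omega)]; omega
    · rw [hin (by omega), hin (by omega)]; omega

/-- The obstruction acts on both cohomology classes as multiplication by `-1 / 12`. On `1` this
holds exactly, and on `ω` up to the differential of a vertex cochain, by integration. -/
theorem obstruction_induces (hN : 100 * (ℓ + 1) ≤ N) :
    S.obstruction.Induces (fun h k => if h = k then -(1 / 12) else 0) := by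
  have hT := S.isHomogeneous_obstruction
  refine ⟨by rw [bracketD_of_even hT (by decide), S.obstruction_mul_d, sub_self], ?_⟩
  have hsum : ∀ (h : Fin 1 → Fin 2) (y : Fin 1 → Cell N),
      ∑ k : Fin 1 → Fin 2, (if h = k then (-(1 / 12) : ℝ) else 0) * ∏ j,
        representative (k j) (y j) =
        -(1 / 12) * representative (h 0) (y 0) := by
    intro h y
    rw [Fintype.sum_eq_single h]
    · simp
    · intro k hk
      rw [if_neg hk.symm, MulZeroClass.zero_mul]
  have hω : ∃ w : Op N 0 1, w ⊙ d =
      edgeCochain 0 ⊙ S.obstruction + (1 / 12 : ℝ) • edgeCochain 0 := by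
    refine exists_mul_d_eq ?_ ?_
    · have h1 : (edgeCochain 0 : Op N 0 1).IsHomogeneous 1 := by
        intro x y hxy
        rw [edgeCochain] at hxy
        rw [tensorDeg_fin_zero, tensorDeg_fin_one]
        rcases hy : y 0 with k | k
        · rw [hy] at hxy
          exact absurd rfl hxy
        · rfl
      exact (by simpa using h1.mul hT : (edgeCochain 0 ⊙ S.obstruction).IsHomogeneous 1).add
        (h1.smul _)
    · simp only [Pi.add_apply, Finset.sum_add_distrib, edgeCochain_mul (NeZero.pos N)]
      rw [S.sum_obstruction_eq (Nat.zero_le (50 * (ℓ + 1))) (by omega),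
        S.sum_obstruction_middle hN]
      simp [edgeCochain]
  obtain ⟨w, hw⟩ := hω
  refine ⟨fun h z => if h 0 = 0 then 0 else w default z, fun h y => ?_⟩
  rw [hsum]
  rcases Fin.exists_fin_two.1 ⟨h 0, rfl⟩ with h0 | h0
  · have h1 := congrFun (congrFun (S.unit_mul_obstruction hN) default) y
    rw [unit_mul_apply] at h1
    have h2 : ∀ x : Fin 1 → Cell N, ∏ i, representative (h i) (x i) =
        ∏ i, representative 0 (x i) := fun x =>
      Finset.prod_congr rfl fun i _ => by rw [Subsingleton.elim i 0, h0]
    simp only [h2, h1, h0]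
    rw [Pi.smul_apply, Pi.smul_apply, unit, ← prod_representative_zero]
    simp
  · have h1 := congrFun (congrFun hw default) y
    have h2 : ∑ x : Fin 1 → Cell N, (∏ i, representative (h i) (x i)) * S.obstruction x y =
        (edgeCochain 0 ⊙ S.obstruction) default y := by
      refine Finset.sum_congr rfl fun x _ => ?_
      rw [Fin.prod_univ_one, h0, edgeCochain]
      rcases x 0 with k | k <;> simp [representative]
    have h3 : representative (h 0) (y 0) = (edgeCochain 0 : Op N 0 1) default y := by
      rw [h0, edgeCochain]
      rcases y 0 with k | k <;> simp [representative]
    have h4 : ∑ z, (if h 0 = 0 then 0 else w default z) * tensorD z y = (w ⊙ d) default y := by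
      refine Finset.sum_congr rfl fun z _ => ?_
      rw [if_neg (by rw [h0]; decide)]
      rfl
    rw [h2, h3, h4, h1, Pi.add_apply, Pi.add_apply, Pi.smul_apply, Pi.smul_apply, smul_eq_mul]
    ring

end FewOperations

end

/-! ### The obstruction to extending an action -/

section

/-- All binary decompositions of `genusTwo`. -/
def genusTwoDecomposition : Decomposition 1 1 :=
  decTwo multGen comultGen genusTwo lowerFactor upperFactor

theorem isDecomposition_genusTwoDecomposition : IsDecomposition genusTwo genusTwoDecomposition :=
  isDecomposition_decTwo coeff_mult_multGen coeff_comult_comultGen genusTwo lowerFactor upperFactor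
    fun σ τ _ _ hs ht => sum_coeff_lowerFactor_mul_coeff_upperFactor σ τ hs ht

variable {N ℓ : ℕ} [NeZero N] {η : GenMap N}

theorem imageOfDerivative_genusTwo (hη : IsAction firstFewBefore η) (hF : LiftsFrobenius η)
    (hℓ : IsQuasilocalOn firstFewBefore ℓ η) :
    imageOfDerivative η 2 genusTwoDecomposition = (fewOperations hη hF hℓ).obstruction :=
  imageOfDerivative_decTwo η multGen comultGen genusTwo lowerFactor upperFactor

theorem IsAction.mono {I J : Set (ℕ × ℕ × ℕ)} (h : IsAction J η) (hIJ : I ⊆ J) : IsAction I η where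
  homogeneous hi := h.homogeneous (hIJ hi)
  equivariant hi := h.equivariant (hIJ hi)
  map_derivative hi := h.map_derivative (hIJ hi)

/-- A boundary of an operation of degree `-1` annihilates the unit, as there are no cochains of
negative degree. -/
theorem unit_mul_bracketD_eq_zero {b : Op N 1 1} (hb : b.IsHomogeneous (-1)) :
    Op.unit 1 ⊙ b.bracketD = 0 := by
  have h : Op.unit 1 ⊙ b = 0 :=
    ((Op.isHomogeneous_unit 1).mul hb).eq_zero_of_neg (by norm_num)
  rw [Op.bracketD_of_odd hb (by decide), Op.mul_add, ← Op.mul_assoc, ← Op.mul_assoc, h,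
    Op.unit_mul_d, Op.zero_mul, Op.zero_mul, add_zero]

end

end ShFrob

end

theorem mainTheorem3 :
    ∃ (b : Gen 2 1 1) (Δb : Decomposition 1 1),
      coeff genusTwoGraph b = 1 ∧ IsDecomposition b Δb ∧
      ∃ C : ℕ, ∀ (N ℓ : ℕ) [NeZero N], C * (ℓ + 1) ≤ N →
        (¬ ∃ η : GenMap N,
          IsAction Set.univ η ∧ LiftsFrobenius η ∧ IsQuasilocalOn firstFew ℓ η) ∧
        (∀ η : GenMap N,
          IsAction firstFewBefore η → LiftsFrobenius η → IsQuasilocalOn firstFewBefore ℓ η →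
          (imageOfDerivative η 2 Δb).Induces (fun h k => if h = k then -(1 / 12) else 0)) := by
  refine ⟨genusTwo, genusTwoDecomposition, coeff_genusTwoGraph_genusTwo,
    isDecomposition_genusTwoDecomposition, 100, fun N ℓ _ hN => ⟨?_, fun η hη hF hℓ => ?_⟩⟩
  · rintro ⟨η, hη, hF, hℓ⟩
    have hη' := hη.mono (Set.subset_univ firstFewBefore)
    have hℓ' : IsQuasilocalOn firstFewBefore ℓ η := fun hi => hℓ hi.1
    have h1 := (fewOperations hη' hF hℓ').unit_mul_obstruction hN
    rw [← imageOfDerivative_genusTwo,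
      ← hη.map_derivative (Set.mem_univ _) _ _ isDecomposition_genusTwoDecomposition,
      unit_mul_bracketD_eq_zero (hη.homogeneous (Set.mem_univ _) genusTwo)] at h1
    have h2 := congrFun (congrFun h1 default) (Op.vtx 0)
    rw [Pi.smul_apply, Pi.smul_apply, Op.unit_vtx] at h2
    norm_num at h2
  · rw [imageOfDerivative_genusTwo hη hF hℓ]
    exact (fewOperations hη hF hℓ).obstruction_induces hN
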